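/- Let $\mu$ be a finite measure on $\mathbb N=\{0,1,2,\dots\}$ with $\mu(1)=0$ and $\mu(0)>0$. Consider the continuous-time Bienaymé–Galton–Watson process started from $x\in\mathbb N$ individuals at time $0$: each individual lives, independently of all others, for an exponential time with parameter $\mu(\mathbb N)$ and is then replaced by a random number of children with law $\mu(\mathbb N)^{-1}\mu$, independent of its lifetime. Let $Z_r$ be the number of individuals at time $r$, let $\mathbb P_x$, $\mathbb E_x$ denote probability and expectation when $Z_0=x$, and put $\psi_r(s)=\mathbb E_1(s^{Z_r})$ for $r\ge 0$, $s\in[0,1)$ (with $s^{\infty}=0$ if the process can explode); $\psi_r'$ is the derivative in $s$. Let $n\ge 1$ and $t>0$. If $n+1\le Z_t<\infty$, sample $n+1$ individuals uniformly without replacement from the population at time $t$, and for $k=1,\dots,n$ let $T_k^*$ be their $k$-th coalescence time measured backwards from time $t$, that is, the infimum of the $u\in(0,t]$ for which the sampled individuals have at most $n+1-k$ distinct ancestors at time $t-u$ (with $\inf\emptyset=\infty$). Otherwise put $T_k^*=\infty$ for all $k$. Let $\mathbb E_x^{(t)}$ denote expectation for the process together with the sample at the current time $t$. Then for every $s\in[0,1)$,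 all the derivatives and series below exist and converge, and on the set $\{(t_1,\dots,t_n): 0<t_1<t_2<\dots<t_n\le t\}$ the weighted joint law of $(T_1^*,\dots,T_n^*)$ has the following density with respect to Lebesgue measure: $$\mathbb E_x^{(t)}\big(Z_t(Z_t-1)\cdots(Z_t-n)\,s^{Z_t-n-1},\ T_1^*\in dt_1,\dots,T_n^*\in dt_n\big)/dt_1\cdots dt_n=\frac{n!\,(n+1)!}{2^n}\;x\,\psi_t'(s)\,\psi_t(s)^{x-1}\prod_{i=1}^n\psi_{t_i}'(s)\Big[\sum_{k\ge 2}k(k-1)\mu(k)\,\psi_{t_i}(s)^{k-2}\Big].$$ That is, for every Borel subset $B$ of this set, the expectation of $Z_t(Z_t-1)\cdots(Z_t-n)\,s^{Z_t-n-1}$ on the event $\{(T_1^*,\dots,T_n^*)\in B\}$ equals the Lebesgue integral over $B$ of the right-hand side. (For $x=0$ the right-hand side is $0$.) -/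

import Mathlib

open MeasureTheory ProbabilityTheory
open scoped ENNReal

noncomputable section

namespace BGW

/-- Labels of potential individuals: `(i, [jₘ, …, j₁])` is the `jₘ`-th child of … of the `j₁`-th
child of the `i`-th founder (all ranks start at `0`). -/
abbrev Individual : Type := ℕ × List ℕ

/-- A realization: every potential individual gets a lifetime and a number of children. -/
abbrev Realization : Type := Individual → ℝ × ℕ

/-- The law of the realization when reproduction is governed by the finite measure `μ` on `ℕ`:
all pairs are independent, the lifetime is exponential with parameter `μ(ℕ)`, the number of
children is independent of the lifetime and has law `μ(ℕ)⁻¹ μ`. -/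
def law (μ : Measure ℕ) : Measure Realization :=
  Measure.infinitePi fun _ : Individual =>
    (expMeasure (μ.real Set.univ)).prod ((μ Set.univ)⁻¹ • μ)

/-- The time at which an individual is born; founders are present from time `0`. -/
def birth (ω : Realization) (i : ℕ) : List ℕ → ℝ
  | [] => 0
  | _ :: l => birth ω i l + (ω (i, l)).1

/-- The label `(i, l)` is realized in the genealogical tree founded by `x` individuals. -/
def InTree (x : ℕ) (ω : Realization) (i : ℕ) : List ℕ → Prop
  | [] => i < x
  | j :: l => InTree x ω i l ∧ j < (ω (i, l)).2

/-- The individual `v` belongs to the population at time `r`. -/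
def Alive (x : ℕ) (ω : Realization) (r : ℝ) (v : Individual) : Prop :=
  InTree x ω v.1 v.2 ∧ birth ω v.1 v.2 ≤ r ∧ r < birth ω v.1 v.2 + (ω v).1

/-- The population size `Z_r` when `Z_0 = x` (`∞` after an explosion, if there is one). -/
def Z (x : ℕ) (r : ℝ) (ω : Realization) : ℕ∞ := {v | Alive x ω r v}.encard

/-- The generating function `ψ_r(s) = 𝔼₁[s ^ Z_r]`, with `s ^ ∞ = 0`, as a power series in `s`. -/
def psi (μ : Measure ℕ) (r s : ℝ) : ℝ :=
  ∑' k : ℕ, (law μ).real {ω | Z 1 r ω = (k : ℕ∞)} * s ^ k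

/-- `w` is an ancestor of `v`, or `v` itself. -/
def IsAncestor (w v : Individual) : Prop := w.1 = v.1 ∧ w.2 <:+ v.2

/-- Outcomes of sampling `n + 1` individuals; `none` means that no sample could be taken. -/
def Sample (n : ℕ) : Type := Option (Fin (n + 1) → Individual)

instance (n : ℕ) : MeasurableSpace (Sample n) := ⊤

instance (n : ℕ) : DiscreteMeasurableSpace (Sample n) := ⟨fun _ => trivial⟩

instance (n : ℕ) : Countable (Sample n) :=
  inferInstanceAs (Countable (Option (Fin (n + 1) → Individual)))

/-- The samples of `n + 1` distinct individuals (in order) from the population at time `t`. -/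
def samples (n x : ℕ) (t : ℝ) (ω : Realization) : Set (Sample n) :=
  {q | ∃ σ : Fin (n + 1) → Individual,
    q = some σ ∧ Function.Injective σ ∧ ∀ i, Alive x ω t (σ i)}

theorem measurable_birth (i : ℕ) (l : List ℕ) : Measurable fun ω => birth ω i l := by
  induction l with
  | nil => exact measurable_const
  | cons j l ih => exact ih.add (measurable_pi_apply (i, l)).fst

theorem measurableSet_inTree (x i : ℕ) (l : List ℕ) : MeasurableSet {ω | InTree x ω i l} := by
  induction l with
  | nil => exact MeasurableSet.const _
  | cons j l ih =>
    have h : MeasurableSet {ω : Realization | j < (ω (i, l)).2} :=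
      measurableSet_lt measurable_const (measurable_pi_apply (i, l)).snd
    exact ih.inter h

theorem measurableSet_alive (x : ℕ) (r : ℝ) (v : Individual) :
    MeasurableSet {ω | Alive x ω r v} :=
  (measurableSet_inTree x v.1 v.2).inter
    ((measurableSet_le (measurable_birth v.1 v.2) measurable_const).inter
      (measurableSet_lt measurable_const
        ((measurable_birth v.1 v.2).add (measurable_pi_apply v).fst)))

theorem measurableSet_mem_samples (n x : ℕ) (t : ℝ) (q : Sample n) :
    MeasurableSet {ω | q ∈ samples n x t ω} := by
  have h : {ω | q ∈ samples n x t ω} = ⋃ σ : Fin (n + 1) → Individual,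
      {_ω | q = some σ} ∩ ({_ω | Function.Injective σ} ∩ ⋂ i, {ω | Alive x ω t (σ i)}) := by
    ext ω
    simp [samples]
  rw [h]
  exact MeasurableSet.iUnion fun σ => (MeasurableSet.const _).inter
    ((MeasurableSet.const _).inter (MeasurableSet.iInter fun i => measurableSet_alive x t (σ i)))

theorem measurable_count_samples (n x : ℕ) (t : ℝ) (A : Set (Sample n)) :
    Measurable fun ω => Measure.count (samples n x t ω ∩ A) := by
  have h : ∀ ω, Measure.count (samples n x t ω ∩ A)
      = ∑' q, (samples n x t ω ∩ A).indicator (1 : Sample n → ℝ≥0∞) q := by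
    intro ω
    rw [← lintegral_count, lintegral_indicator_one (MeasurableSet.of_discrete)]
  simp only [h]
  refine Measurable.tsum fun q => ?_
  have : (fun ω => (samples n x t ω ∩ A).indicator (1 : Sample n → ℝ≥0∞) q)
      = ({ω | q ∈ samples n x t ω} ∩ {_ω | q ∈ A}).indicator 1 := by
    ext ω
    by_cases h1 : q ∈ samples n x t ω <;> by_cases h2 : q ∈ A <;>
      simp [Set.indicator, h1, h2]
  rw [this]
  exact measurable_one.indicator ((measurableSet_mem_samples n x t q).inter (MeasurableSet.const _))

theorem measurable_uniformOn_samples (n x : ℕ) (t : ℝ) :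
    Measurable fun ω => uniformOn (samples n x t ω) := by
  refine Measure.measurable_of_measurable_coe _ fun A _ => ?_
  have h : ∀ ω, uniformOn (samples n x t ω) A
      = (Measure.count (samples n x t ω ∩ Set.univ))⁻¹ * Measure.count (samples n x t ω ∩ A) := by
    intro ω
    rw [uniformOn, cond_apply MeasurableSet.of_discrete, Set.inter_univ]
  simp only [h]
  exact (measurable_count_samples n x t _).inv.mul (measurable_count_samples n x t A)

theorem measurableSet_samples_finite (n x : ℕ) (t : ℝ) :
    MeasurableSet {ω | (samples n x t ω).Finite ∧ (samples n x t ω).Nonempty} := by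
  have h : {ω | (samples n x t ω).Finite ∧ (samples n x t ω).Nonempty}
      = {ω | Measure.count (samples n x t ω ∩ Set.univ) < ⊤} ∩
        {ω | Measure.count (samples n x t ω ∩ Set.univ) = 0}ᶜ := by
    ext ω
    simp [Measure.count_eq_zero_iff, Set.nonempty_iff_ne_empty]
  rw [h]
  exact (measurableSet_lt (measurable_count_samples n x t _) measurable_const).inter
    ((measurable_count_samples n x t _) (measurableSet_singleton 0)).compl

open Classical in
/-- Sampling at time `t`: given the realization, `n + 1` individuals are drawn uniformly without
replacement from the population at time `t`, if it is finite and has at least `n + 1` members;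
otherwise the outcome is `none`. -/
def sampling (n x : ℕ) (t : ℝ) : Kernel Realization (Sample n) where
  toFun ω := if (samples n x t ω).Finite ∧ (samples n x t ω).Nonempty
    then uniformOn (samples n x t ω) else Measure.dirac (α := Sample n) none
  measurable' := Measurable.ite (measurableSet_samples_finite n x t)
    (measurable_uniformOn_samples n x t) measurable_const

instance (n x : ℕ) (t : ℝ) : IsMarkovKernel (sampling n x t) := by
  refine ⟨fun ω => ?_⟩
  classical
  simp only [sampling, Kernel.coe_mk]
  split_ifs with h
  · exact isProbabilityMeasure_uniformOn h.1 h.2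
  · exact Measure.dirac.isProbabilityMeasure

theorem isProbabilityMeasure_law (μ : Measure ℕ) [IsFiniteMeasure μ] (h0 : μ {0} ≠ 0) :
    IsProbabilityMeasure (law μ) := by
  have hu : μ Set.univ ≠ 0 := fun h => h0 (measure_mono_null (Set.subset_univ _) h)
  have hr : 0 < μ.real Set.univ := ENNReal.toReal_pos hu (measure_ne_top μ _)
  have h1 := isProbabilityMeasure_expMeasure hr
  have h2 : IsProbabilityMeasure ((μ Set.univ)⁻¹ • μ) :=
    ⟨by simpa using ENNReal.inv_mul_cancel hu (measure_ne_top μ _)⟩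
  unfold law
  infer_instance

/-- The joint law, under `ℙ_x^{(t)}`, of the realization and of the sample of `n + 1` individuals
taken at the current time `t`. -/
def sampledLaw (μ : Measure ℕ) (n x : ℕ) (t : ℝ) : Measure (Realization × Sample n) :=
  (law μ).compProd (sampling n x t)

/-- The individuals living at time `t - u` from which the individuals `σ i` descend (or which are
themselves among the `σ i`). -/
def ancestors (n x : ℕ) (t u : ℝ) (ω : Realization) (σ : Fin (n + 1) → Individual) :
    Set Individual :=
  {w | Alive x ω (t - u) w ∧ ∃ i, IsAncestor w (σ i)}

/-- The `(k + 1)`-th coalescence time (`k = 0, …, n - 1`), measured backwards from the current time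
`t`: the infimum of the `u ∈ (0, t]` for which the `n + 1` sampled individuals have at most
`(n + 1) - (k + 1)` distinct ancestors at time `t - u`; it is `∞` if there is no such `u`, and if
no sample could be taken. -/
def coalescenceTime {n : ℕ} (x : ℕ) (t : ℝ) (k : Fin n) :
    Realization × Sample n → EReal
  | (_, none) => ⊤
  | (ω, some σ) =>
    sInf {e : EReal | ∃ u : ℝ, e = (u : EReal) ∧ 0 < u ∧ u ≤ t ∧
      (ancestors n x t u ω σ).encard ≤ ((n - (k : ℕ) : ℕ) : ℕ∞)}

end BGW

end

/-! Take a grid 0 = c 0 ≤ c 1 ≤ … of look-back times and a finite set J of indices below N. A finite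
set P of individuals living at time t shows the pattern J if its number of ancestral lines at time t
- c i, as i runs from 0 to N, ends at 1 and drops by exactly one from i to i + 1 when i ∈ J and not
at all otherwise. Let h_J(t) be the expectation, for one founder, of the sum over all such P of s ^
(number of living individuals outside P). For J = ∅ these P are the singletons, so h_∅(t) = 𝔼₁[Z_t
s^(Z_t - 1)] = ψ_t'(s).

This quantity contains the theorem. The factor Z_t(Z_t - 1)⋯(Z_t - n) counts the ordered samples and
cancels the probability of each (`lintegral_sampling`), so the weighted expectation is (n + 1)!
times a sum over sets P. When a_0 ≤ b_0 ≤ a_1 ≤ b_1 ≤ …, the event that every coalescence time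
T*_(k+1) lies in [a_k, b_k), k = 0, …, n - 1, is a pattern on the grid 0, a_0, b_0, a_1, …
(`pattern_chain_iff`). Lines of different founders never meet, so P lies in one of the x families
and the others contribute ψ_t(s)^(x-1).

The heart is a recursion at the death of the founder (`coalescenceSum_of_le`,
`coalescenceGen_renewal`). Let the founder die when time u remains, leaving k children. Either P
lies in the family of one child and shows J there, or it meets exactly two of these families. In the
second case the two groups merge at look-back time u, so u lies in [c m, c (m + 1)) for some m ∈ J,
and J \ {m} is shared out between the groups. Three or more groups would merge at once and lose two
lines in one step. With φ(u) = ∑ k μ(k) ψ_u(s)^(k-1) and g(u) = ∑ k(k-1) μ(k) ψ_u(s)^(k-2) this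
reads, for right derivatives, h_J' = (φ - μ(ℕ)) h_J + (g/2) ∑_(m ∈ J) 1_[c m, c (m+1)) ∑_(J₁ ⊔ J₂ =
J \ {m}) h_(J₁) h_(J₂).

By strong induction on J the solution is h_J(t) = |J|! / 2^|J| · ψ_t'(s) · ∏_(j ∈ J) ∫_0^t 1_[c j, c
(j+1)) ψ_u'(s) g(u) du (`eq_factorial_mul_prod_of_renewal`). Each merger costs a factor 1/2, and the
ways of sharing out the indices add up to the factorial. The two sides agree because their
difference solves a homogeneous linear equation with initial value 0.

This is the claimed density on ordered boxes. Countably many of them cover the increasing vectors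
with entries in (0, t), and both measures vanish where an entry equals t (`measure_eq_of_box`). -/

noncomputable section

/-! ### Family trees, ancestral lines and the number of lineages. -/

namespace BGW

/-- The marks (lifetime, number of children) of all potential members of one family. -/
abbrev Tree : Type := List ℕ → ℝ × ℕ

/-- The birth time of a member of the family, relative to its founder. -/
def treeBirth (τ : Tree) : List ℕ → ℝ
  | [] => 0
  | _ :: l => treeBirth τ l + (τ l).1

/-- The label is realized in the family tree. -/
def TreeMem (τ : Tree) : List ℕ → Prop
  | [] => True
  | j :: l => TreeMem τ l ∧ j < (τ l).2

/-- The members of the family living at time `t`. -/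
def living (τ : Tree) (t : ℝ) : Set (List ℕ) :=
  {l | TreeMem τ l ∧ treeBirth τ l ≤ t ∧ t < treeBirth τ l + (τ l).1}

/-- The youngest member of the ancestral line of `l` born by time `r`
(the founder if there is none). -/
def lastBorn (τ : Tree) (r : ℝ) : List ℕ → List ℕ
  | [] => []
  | j :: l => if treeBirth τ (j :: l) ≤ r then j :: l else lastBorn τ r l

/-- The number of distinct ancestral lines of `P` at time `r`. -/
def lineages (τ : Tree) (r : ℝ) (P : Finset (List ℕ)) : ℕ :=
  (P.image (lastBorn τ r)).card

/-- The family of the founder `i`. -/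
def branch (ω : Realization) (i : ℕ) : Tree := fun l => ω (i, l)

/-- The forest of the families of the children of the founder. -/
def offspring (τ : Tree) : Realization := fun v => τ (v.2 ++ [v.1])

theorem birth_eq (ω : Realization) (i : ℕ) (l : List ℕ) :
    birth ω i l = treeBirth (branch ω i) l := by
  induction l with
  | nil => rfl
  | cons j l ih => simp [birth, treeBirth, ih, branch]

theorem inTree_iff (x : ℕ) (ω : Realization) (i : ℕ) (l : List ℕ) :
    InTree x ω i l ↔ i < x ∧ TreeMem (branch ω i) l := by
  induction l with
  | nil => simp [InTree, TreeMem]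
  | cons j l ih => simp [InTree, TreeMem, ih, branch, and_assoc]

theorem alive_iff (x : ℕ) (ω : Realization) (r : ℝ) (v : Individual) :
    Alive x ω r v ↔ v.1 < x ∧ v.2 ∈ living (branch ω v.1) r := by
  simp only [Alive, inTree_iff, birth_eq, living, Set.mem_ofPred_eq, and_assoc]
  rfl

/-- Labels carry the latest rank at the head, so the last entry names the child of the founder.
Appending on the right re-roots the tree at that child, which prepares the decomposition at the
death of the founder. -/
theorem treeBirth_append (τ : Tree) (j : ℕ) (l : List ℕ) :
    treeBirth τ (l ++ [j]) = (τ []).1 + treeBirth (branch (offspring τ) j) l := by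
  induction l with
  | nil => simp [treeBirth]
  | cons i l ih => simp [treeBirth, ih, add_assoc, branch, offspring]

theorem treeMem_append (τ : Tree) (j : ℕ) (l : List ℕ) :
    TreeMem τ (l ++ [j]) ↔ j < (τ []).2 ∧ TreeMem (branch (offspring τ) j) l := by
  induction l with
  | nil => simp [TreeMem]
  | cons i l ih => simp [TreeMem, ih, and_assoc, branch, offspring]

theorem append_mem_living (τ : Tree) (t : ℝ) (j : ℕ) (l : List ℕ) :
    l ++ [j] ∈ living τ t ↔
      j < (τ []).2 ∧ l ∈ living (branch (offspring τ) j) (t - (τ []).1) := by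
  have h : (τ (l ++ [j])) = branch (offspring τ) j l := rfl
  simp only [living, Set.mem_ofPred_eq, treeMem_append, treeBirth_append, h, and_assoc,
    le_sub_iff_add_le, sub_lt_iff_lt_add]
  constructor
  · rintro ⟨h1, h2, h3, h4⟩; exact ⟨h1, h2, by linarith, by linarith⟩
  · rintro ⟨h1, h2, h3, h4⟩; exact ⟨h1, h2, by linarith, by linarith⟩

theorem nil_mem_living (τ : Tree) (t : ℝ) : [] ∈ living τ t ↔ 0 ≤ t ∧ t < (τ []).1 := by
  simp [living, TreeMem, treeBirth]

section Nonneg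

variable {τ : Tree} (hτ : ∀ l, 0 ≤ (τ l).1)
include hτ

theorem treeBirth_nonneg (l : List ℕ) : 0 ≤ treeBirth τ l := by
  induction l with
  | nil => exact le_rfl
  | cons j l ih => exact add_nonneg ih (hτ l)

theorem branch_offspring_nonneg (j : ℕ) (l : List ℕ) :
    0 ≤ (branch (offspring τ) j l).1 := hτ _

theorem le_treeBirth_append (j : ℕ) (l : List ℕ) : (τ []).1 ≤ treeBirth τ (l ++ [j]) := by
  rw [treeBirth_append]
  linarith [treeBirth_nonneg (branch_offspring_nonneg hτ j) l]

theorem living_eq_singleton {t : ℝ} (ht : 0 ≤ t) (h : t < (τ []).1) : living τ t = {[]} := by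
  ext l
  rcases List.eq_nil_or_concat' l with rfl | ⟨l, j, rfl⟩
  · simp [nil_mem_living, ht, h]
  · have := le_treeBirth_append hτ j l
    simp only [living, Set.mem_ofPred_eq, Set.mem_singleton_iff, List.append_eq_nil_iff,
      List.cons_ne_self, and_false, iff_false]
    rintro ⟨-, h1, -⟩
    linarith

theorem lastBorn_eq_nil {r : ℝ} (hr : r < 0) (l : List ℕ) : lastBorn τ r l = [] := by
  induction l with
  | nil => rfl
  | cons j l ih =>
    rw [lastBorn, if_neg, ih]
    exact not_le.2 (hr.trans_le (treeBirth_nonneg hτ _))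

theorem lastBorn_append_of_lt {r : ℝ} (hr : r < (τ []).1) (j : ℕ) (l : List ℕ) :
    lastBorn τ r (l ++ [j]) = [] := by
  induction l with
  | nil =>
    rw [List.nil_append, lastBorn, if_neg, lastBorn]
    simpa [treeBirth] using hr
  | cons i l ih =>
    rw [List.cons_append, lastBorn, if_neg, ih]
    exact not_le.2 (hr.trans_le (le_treeBirth_append hτ j (i :: l)))

end Nonneg

theorem lastBorn_append_of_le {τ : Tree} {r : ℝ} (hr : (τ []).1 ≤ r) (j : ℕ) (l : List ℕ) :
    lastBorn τ r (l ++ [j]) = lastBorn (branch (offspring τ) j) (r - (τ []).1) l ++ [j] := by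
  induction l with
  | nil =>
    simp [lastBorn, treeBirth, hr]
  | cons i l ih =>
    have h := treeBirth_append τ j (i :: l)
    rw [List.cons_append] at h ⊢
    rw [lastBorn, lastBorn, h, ih]
    simp only [le_sub_iff_add_le, add_comm (τ []).1]
    split_ifs <;> rfl

theorem lastBorn_of_le {τ : Tree} {r : ℝ} {l : List ℕ} (h : treeBirth τ l ≤ r) :
    lastBorn τ r l = l := by
  cases l with
  | nil => rfl
  | cons j l => rw [lastBorn, if_pos h]

/-- Following the ancestral line further back. -/
theorem lastBorn_lastBorn {τ : Tree} {r r' : ℝ} (h : r ≤ r') (l : List ℕ) :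
    lastBorn τ r (lastBorn τ r' l) = lastBorn τ r l := by
  induction l with
  | nil => rfl
  | cons j l ih =>
    rw [lastBorn.eq_2 τ r' j l]
    split_ifs with h1
    · rfl
    · rw [ih, lastBorn.eq_2 τ r j l, if_neg fun h2 => h1 (h2.trans h)]

/-- Tracing back to `r` factors through the lines at `r'`, and an image cannot be larger than its
source. -/
theorem lineages_mono {τ : Tree} {r r' : ℝ} (h : r ≤ r') (P : Finset (List ℕ)) :
    lineages τ r P ≤ lineages τ r' P := by
  have : P.image (lastBorn τ r) = (P.image (lastBorn τ r')).image (lastBorn τ r) := by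
    rw [Finset.image_image]
    exact Finset.image_congr fun l _ => (lastBorn_lastBorn h l).symm
  rw [lineages, lineages, this]
  exact Finset.card_image_le

theorem lineages_pos {τ : Tree} {r : ℝ} {P : Finset (List ℕ)} (h : P.Nonempty) :
    0 < lineages τ r P :=
  Finset.card_pos.2 (h.image _)

@[simp] theorem lineages_empty (τ : Tree) (r : ℝ) : lineages τ r ∅ = 0 := by simp [lineages]

/-- The default value of `lastBorn` is the founder, so a nonempty set counts as one lineage before
the family exists. The grid of look-back times may thus reach beyond the age of a subtree. -/
theorem lineages_of_neg {τ : Tree} (hτ : ∀ l, 0 ≤ (τ l).1) {r : ℝ} (hr : r < 0)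
    {P : Finset (List ℕ)} (h : P.Nonempty) : lineages τ r P = 1 := by
  rw [lineages, Finset.card_eq_one]
  refine ⟨[], ?_⟩
  rw [Finset.image_congr fun l _ => lastBorn_eq_nil hτ hr l, Finset.image_const h]

theorem lineages_eq_card {τ : Tree} {t : ℝ} {P : Finset (List ℕ)}
    (h : (P : Set (List ℕ)) ⊆ living τ t) : lineages τ t P = P.card := by
  rw [lineages, Finset.image_congr (g := id), Finset.image_id]
  intro l hl
  exact lastBorn_of_le (h hl).2.1

/-- The number of lineages of a set of members of several families. -/
def forestLineages (ω : Realization) (r : ℝ) (P : Finset Individual) : ℕ :=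
  (P.image fun v => (v.1, lastBorn (branch ω v.1) r v.2)).card

/-- The members of `P` in the family of the founder `i`. -/
def slice (P : Finset Individual) (i : ℕ) : Finset (List ℕ) :=
  (P.filter fun v => v.1 = i).image Prod.snd

@[simp] theorem mem_slice {P : Finset Individual} {i : ℕ} {l : List ℕ} :
    l ∈ slice P i ↔ (i, l) ∈ P := by
  simp [slice]

/-- The label in a family of a descendant of a child of the founder. -/
def graft : Individual ↪ List ℕ where
  toFun v := v.2 ++ [v.1]
  inj' := by
    rintro ⟨i, l⟩ ⟨j, m⟩ h
    simpa [and_comm] using h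

theorem graft_apply (v : Individual) : graft v = v.2 ++ [v.1] := rfl

/-- The pairs keep the index of the founder, so lines of different families are never identified. -/
theorem forestLineages_eq_sum (ω : Realization) (r : ℝ) (P : Finset Individual) (k : ℕ)
    (hP : ∀ v ∈ P, v.1 < k) :
    forestLineages ω r P = ∑ i ∈ Finset.range k, lineages (branch ω i) r (slice P i) := by
  rw [forestLineages, Finset.card_eq_sum_card_fiberwise (f := Prod.fst) (t := Finset.range k)]
  · refine Finset.sum_congr rfl fun i _ => ?_
    rw [lineages, ← Finset.card_map (⟨Prod.mk i, Prod.mk_right_injective i⟩ : List ℕ ↪ Individual)]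
    refine congrArg Finset.card ?_
    ext ⟨a, b⟩
    simp only [Finset.mem_filter, Finset.mem_image, Prod.mk.injEq, Prod.exists, Finset.mem_map,
      mem_slice, Function.Embedding.coeFn_mk]
    constructor
    · rintro ⟨⟨a, c, h1, rfl, h2⟩, rfl⟩
      exact ⟨b, ⟨c, h1, h2⟩, rfl, rfl⟩
    · rintro ⟨_, ⟨c, h1, rfl⟩, rfl, rfl⟩
      exact ⟨⟨_, c, h1, rfl, rfl⟩, rfl⟩
  · intro v hv
    simp only [Finset.coe_image, Set.mem_image, Finset.mem_coe] at hv
    obtain ⟨w, hw, rfl⟩ := hv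
    simpa using hP w hw

theorem lineages_map_graft_of_le {τ : Tree} {r : ℝ} (hr : (τ []).1 ≤ r) (P : Finset Individual) :
    lineages τ r (P.map graft) = forestLineages (offspring τ) (r - (τ []).1) P := by
  rw [lineages, forestLineages, ← Finset.card_map graft]
  congr 1
  ext l
  simp only [Finset.mem_image, Finset.mem_map, exists_exists_and_eq_and]
  refine exists_congr fun v => and_congr_right fun _ => ?_
  rw [graft_apply, graft_apply, lastBorn_append_of_le hr]

theorem lineages_map_graft_of_lt {τ : Tree} (hτ : ∀ l, 0 ≤ (τ l).1) {r : ℝ} (hr : r < (τ []).1)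
    {P : Finset Individual} (hP : P.Nonempty) : lineages τ r (P.map graft) = 1 := by
  rw [lineages, Finset.card_eq_one]
  refine ⟨[], ?_⟩
  rw [Finset.image_congr (g := fun _ => []), Finset.image_const (by simpa using hP)]
  intro l hl
  simp only [Finset.coe_map, Set.mem_image] at hl
  obtain ⟨v, _, rfl⟩ := hl
  exact lastBorn_append_of_lt hτ hr _ _

end BGW

/-! ### Powers with extended exponents, and patterns of mergers. -/

namespace BGW

/-- `s ^ N` for an extended natural number `N`, with `s ^ ∞ = 0`. -/
def epow (s : ℝ≥0∞) (N : ℕ∞) : ℝ≥0∞ := if N = ⊤ then 0 else s ^ N.toNat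

@[simp] theorem epow_coe (s : ℝ≥0∞) (n : ℕ) : epow s n = s ^ n := by simp [epow]

@[simp] theorem epow_top (s : ℝ≥0∞) : epow s ⊤ = 0 := by simp [epow]

@[simp] theorem epow_zero (s : ℝ≥0∞) : epow s 0 = 1 := by simp [epow]

@[simp] theorem epow_one (s : ℝ≥0∞) : epow s 1 = s := by simp [epow]

theorem epow_add (s : ℝ≥0∞) (M N : ℕ∞) : epow s (M + N) = epow s M * epow s N := by
  induction M using ENat.recTopCoe with
  | top => simp
  | coe m =>
    induction N using ENat.recTopCoe with
    | top => simp
    | coe n => rw [← Nat.cast_add, epow_coe, epow_coe, epow_coe, pow_add]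

theorem epow_sum {ι : Type*} (s : ℝ≥0∞) (I : Finset ι) (N : ι → ℕ∞) :
    epow s (∑ i ∈ I, N i) = ∏ i ∈ I, epow s (N i) := by
  classical
  induction I using Finset.induction_on with
  | empty => simp
  | insert a I ha ih => rw [Finset.sum_insert ha, Finset.prod_insert ha, epow_add, ih]

/-- `A` decreases to `1` at the index `N`, dropping by one exactly after the indices in `J`. -/
def Pattern (N : ℕ) (J : Finset ℕ) (A : ℕ → ℕ) : Prop :=
  A N = 1 ∧ ∀ i < N, A i = A (i + 1) + if i ∈ J then 1 else 0

open Classical in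
/-- The indicator of a pattern. -/
def patternIndicator (N : ℕ) (J : Finset ℕ) (A : ℕ → ℕ) : ℝ≥0∞ := if Pattern N J A then 1 else 0

theorem Pattern.eq_add_card {N : ℕ} {J : Finset ℕ} {A : ℕ → ℕ} (h : Pattern N J A) {i : ℕ}
    (hi : i ≤ N) : A i = 1 + (J.filter fun j => i ≤ j ∧ j < N).card := by
  induction hi using Nat.decreasingInduction with
  | self =>
    rw [h.1, Finset.filter_false_of_mem, Finset.card_empty]
    intro j _; omega
  | of_succ i hi ih =>
    rw [h.2 i hi, ih]
    have : (J.filter fun j => i ≤ j ∧ j < N)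
        = (J.filter fun j => i + 1 ≤ j ∧ j < N) ∪ (if i ∈ J then {i} else ∅) := by
      ext j
      split_ifs with hJ
      · simp only [Finset.mem_filter, Finset.mem_union, Finset.mem_singleton]
        constructor
        · rintro ⟨h1, h2, h3⟩
          rcases h2.eq_or_lt with rfl | h2
          · exact Or.inr rfl
          · exact Or.inl ⟨h1, h2, h3⟩
        · rintro (⟨h1, h2, h3⟩ | rfl)
          · exact ⟨h1, by omega, h3⟩
          · exact ⟨hJ, le_rfl, hi⟩
      · simp only [Finset.mem_filter, Finset.union_empty]
        constructor
        · rintro ⟨h1, h2, h3⟩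
          refine ⟨h1, ?_, h3⟩
          rcases h2.eq_or_lt with rfl | h2
          · exact absurd h1 hJ
          · exact h2
        · rintro ⟨h1, h2, h3⟩
          exact ⟨h1, by omega, h3⟩
    rw [this, Finset.card_union_of_disjoint, add_assoc]
    · split_ifs <;> simp
    · split_ifs <;> simp

/-- At `c 0 = 0` the lineages of a living set are its members, so this fixes the size of every set
showing `J`. -/
theorem Pattern.zero_eq {N : ℕ} {J : Finset ℕ} {A : ℕ → ℕ} (h : Pattern N J A)
    (hJ : ∀ j ∈ J, j < N) : A 0 = J.card + 1 := by
  rw [h.eq_add_card (Nat.zero_le _), add_comm, Finset.filter_true_of_mem]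
  exact fun j hj => ⟨Nat.zero_le _, hJ j hj⟩

/-- A lineage count determines its pattern, so sums over possible patterns have at most one nonzero
term. -/
theorem Pattern.eq_filter {N : ℕ} {J : Finset ℕ} {A : ℕ → ℕ} (h : Pattern N J A)
    (hJ : ∀ j ∈ J, j < N) : J = (Finset.range N).filter fun i => A i = A (i + 1) + 1 := by
  ext i
  simp only [Finset.mem_filter, Finset.mem_range]
  constructor
  · intro hi
    exact ⟨hJ i hi, by simpa [hi] using h.2 i (hJ i hi)⟩
  · rintro ⟨h1, h2⟩
    by_contra hi
    have := h.2 i h1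
    rw [if_neg hi] at this
    omega

section Merge

variable {N : ℕ} {c : ℕ → ℝ} (hc : Monotone c) {u : ℝ} (hu : c 0 ≤ u)

include hu in
theorem exists_mem_Ico_of_lt (h : u < c N) : ∃ m < N, c m ≤ u ∧ u < c (m + 1) := by
  induction N with
  | zero => exact absurd h (not_lt.2 hu)
  | succ n ih =>
    rcases lt_or_ge u (c n) with h1 | h1
    · obtain ⟨m, hm, h2⟩ := ih h1
      exact ⟨m, by omega, h2⟩
    · exact ⟨n, by omega, h1, h⟩

include hc in
theorem eq_of_mem_Ico {m m' : ℕ} (h : c m ≤ u ∧ u < c (m + 1))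
    (h' : c m' ≤ u ∧ u < c (m' + 1)) : m = m' := by
  rcases lt_trichotomy m m' with h1 | h1 | h1
  · have := hc (Nat.succ_le_of_lt h1); simp only [Nat.succ_eq_add_one] at this; linarith [h.2, h'.1]
  · exact h1
  · have := hc (Nat.succ_le_of_lt h1); simp only [Nat.succ_eq_add_one] at this; linarith [h.1, h'.2]

include hc in
/-- Two groups of lineages with a common ancestor splitting at `u` show the pattern `J` iff `u` lies
in the interval of some `m ∈ J`, and the rest of `J` is distributed among the groups. -/
theorem pattern_merge_iff {J : Finset ℕ} {B₁ B₂ : ℕ → ℕ}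
    (h₁ : Antitone B₁) (h₂ : Antitone B₂) (p₁ : ∀ i, 0 < B₁ i) (p₂ : ∀ i, 0 < B₂ i)
    (q₁ : ∀ i, u < c i → B₁ i = 1) (q₂ : ∀ i, u < c i → B₂ i = 1)
    {m : ℕ} (hm : m < N) (hmu : c m ≤ u ∧ u < c (m + 1)) :
    Pattern N J (fun i => if u < c i then 1 else B₁ i + B₂ i) ↔
      m ∈ J ∧ ∃ J₁ ∈ (J.erase m).powerset, Pattern N J₁ B₁ ∧ Pattern N (J.erase m \ J₁) B₂ := by
  have lt_of : ∀ i, m < i → u < c i := fun i hi =>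
    hmu.2.trans_le (hc (Nat.succ_le_of_lt hi))
  have le_of : ∀ i, i ≤ m → ¬ u < c i := fun i hi => not_lt.2 ((hc hi).trans hmu.1)
  constructor
  · rintro ⟨hN, hA⟩
    have hAm := hA m hm
    simp only [le_of m le_rfl, lt_of (m + 1) (by omega), if_true, if_false] at hAm
    -- Across `m` the count passes from `B₁ m + B₂ m ≥ 2` to 1, so it cannot stay constant.
    have hmJ : m ∈ J := by
      by_contra h
      have := p₁ m; have := p₂ m
      rw [if_neg h] at hAm; omega
    rw [if_pos hmJ] at hAm
    -- The share of the first group has to be the set of drops of `B₁`. Below `m` both counts are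
    -- nonincreasing and their sum drops by at most one, so each drop belongs to exactly one group;
    -- above `m` both equal 1.
    refine ⟨hmJ, (J.erase m).filter fun i => B₁ i = B₁ (i + 1) + 1,
      Finset.mem_powerset.2 (Finset.filter_subset _ _),
      ⟨q₁ N (lt_of N hm), fun i hi => ?_⟩, ⟨q₂ N (lt_of N hm), fun i hi => ?_⟩⟩ <;>
    · have hAi := hA i hi
      have a₁ := h₁ (Nat.le_succ i)
      have a₂ := h₂ (Nat.le_succ i)
      have := p₁ m
      have := p₂ m
      simp only [Nat.succ_eq_add_one] at a₁ a₂
      rcases lt_trichotomy i m with him | rfl | him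
      · simp only [le_of i him.le, le_of (i + 1) him, if_false] at hAi
        simp only [Finset.mem_filter, Finset.mem_erase, him.ne, ne_eq, not_false_eq_true,
          true_and, Finset.mem_sdiff]
        by_cases hiJ : i ∈ J <;> simp only [hiJ, if_true, if_false] at hAi <;>
          simp only [hiJ, true_and, false_and, if_false] <;> (try split_ifs) <;> omega
      · have e₁ := q₁ (i + 1) (lt_of _ (by omega))
        have e₂ := q₂ (i + 1) (lt_of _ (by omega))
        simp
        omega
      · have e₁ := q₁ (i + 1) (lt_of _ (by omega))
        have e₂ := q₂ (i + 1) (lt_of _ (by omega))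
        have e₃ := q₁ i (lt_of _ (by omega))
        have e₄ := q₂ i (lt_of _ (by omega))
        simp only [lt_of i him, lt_of (i + 1) (by omega), if_true] at hAi
        have : i ∉ J := by
          intro h; simp [h] at hAi
        simp [this]
        omega
  · rintro ⟨hmJ, J₁, hJ₁, ⟨hN₁, hB₁⟩, ⟨hN₂, hB₂⟩⟩
    rw [Finset.mem_powerset] at hJ₁
    refine ⟨by simp [lt_of N hm], fun i hi => ?_⟩
    have e₁ := hB₁ i hi
    have e₂ := hB₂ i hi
    have hsub : i ∈ J₁ → i ≠ m ∧ i ∈ J := fun h => by simpa using hJ₁ h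
    simp only [Finset.mem_sdiff, Finset.mem_erase] at e₂
    rcases lt_trichotomy i m with him | rfl | him
    · simp only [le_of i him.le, le_of (i + 1) him, if_false]
      by_cases hiJ : i ∈ J <;> by_cases hiJ₁ : i ∈ J₁ <;>
        simp_all [him.ne] <;> omega
    · have f₁ := q₁ (i + 1) (lt_of _ (by omega))
      have f₂ := q₂ (i + 1) (lt_of _ (by omega))
      have : i ∉ J₁ := fun h => (hsub h).1 rfl
      simp only [this, ne_eq, not_true_eq_false, false_and, if_false, add_zero] at e₁ e₂
      simp [lt_of (i + 1) (by omega), le_of i le_rfl, hmJ, e₁, e₂, f₁, f₂]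
    · have f₁ := q₁ (i + 1) (lt_of _ (by omega))
      have f₂ := q₂ (i + 1) (lt_of _ (by omega))
      have f₃ := q₁ i (lt_of _ (by omega))
      have f₄ := q₂ i (lt_of _ (by omega))
      simp only [lt_of i him, lt_of (i + 1) (by omega), if_true]
      have h1 : i ∉ J₁ := by
        intro h; simp [h] at e₁; omega
      have h2 : i ∉ J := by
        intro h; simp [h, h1, him.ne'] at e₂; omega
      simp [h2]

-- Turns the existential criterion into an identity of indicators, which can be summed and
-- integrated: the intervals are disjoint, which leaves one `m`, and `Pattern.eq_filter` leaves at
-- most one `J₁`.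
include hc hu in
theorem patternIndicator_merge {J : Finset ℕ} (hJ : ∀ j ∈ J, j < N) {B₁ B₂ : ℕ → ℕ}
    (h₁ : Antitone B₁) (h₂ : Antitone B₂) (p₁ : ∀ i, 0 < B₁ i) (p₂ : ∀ i, 0 < B₂ i)
    (q₁ : ∀ i, u < c i → B₁ i = 1) (q₂ : ∀ i, u < c i → B₂ i = 1) :
    patternIndicator N J (fun i => if u < c i then 1 else B₁ i + B₂ i) =
      ∑ m ∈ J, (Set.Ico (c m) (c (m + 1))).indicator 1 u * ∑ J₁ ∈ (J.erase m).powerset,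
        patternIndicator N J₁ B₁ * patternIndicator N (J.erase m \ J₁) B₂ := by
  classical
  -- If the grid ends before the merger, two groups are still separate at index `N`, where a pattern
  -- has a single line.
  rcases le_or_gt (c N) u with hN | hN
  · rw [Finset.sum_eq_zero, patternIndicator, if_neg]
    · rintro ⟨h, -⟩
      simp only [if_neg (not_lt.2 hN)] at h
      have := p₁ N; have := p₂ N; omega
    · intro m hm
      rw [Set.indicator_of_notMem, zero_mul]
      rintro ⟨-, h⟩
      exact absurd (h.trans_le (hc (hJ m hm))) (not_lt.2 hN)
  obtain ⟨m, hm, hmu⟩ := exists_mem_Ico_of_lt hu hN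
  have key := pattern_merge_iff hc (J := J) h₁ h₂ p₁ p₂ q₁ q₂ hm hmu
  have huniq : ∀ m', u ∈ Set.Ico (c m') (c (m' + 1)) → m' = m := fun m' h =>
    eq_of_mem_Ico hc h hmu
  by_cases hmJ : m ∈ J
  · rw [Finset.sum_eq_single_of_mem m hmJ, Set.indicator_of_mem (show u ∈ Set.Ico _ _ from hmu),
      Pi.one_apply, one_mul, patternIndicator]
    · by_cases hP : Pattern N J (fun i => if u < c i then 1 else B₁ i + B₂ i)
      · rw [if_pos hP]
        obtain ⟨-, J₁, hJ₁, hB₁, hB₂⟩ := key.1 hP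
        have hlt : ∀ {J'}, J' ∈ (J.erase m).powerset → ∀ j ∈ J', j < N := fun h j hj =>
          hJ j (Finset.mem_of_mem_erase (Finset.mem_powerset.1 h hj))
        rw [Finset.sum_eq_single_of_mem J₁ hJ₁]
        · simp [patternIndicator, hB₁, hB₂]
        · intro J' hJ' hne
          rw [patternIndicator, if_neg, zero_mul]
          intro h
          exact hne ((h.eq_filter (hlt hJ')).trans (hB₁.eq_filter (hlt hJ₁)).symm)
      · rw [if_neg hP, eq_comm]
        refine Finset.sum_eq_zero fun J₁ hJ₁ => ?_
        by_contra h
        refine hP (key.2 ⟨hmJ, J₁, hJ₁, ?_, ?_⟩)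
        · by_contra h1; exact h (by simp [patternIndicator, h1])
        · by_contra h1; exact h (by simp [patternIndicator, h1])
    · intro m' _ hne
      rw [Set.indicator_of_notMem fun h => hne (huniq m' h), zero_mul]
  · rw [patternIndicator, if_neg fun h => hmJ (key.1 h).1, eq_comm]
    refine Finset.sum_eq_zero fun m' hm' => ?_
    rw [Set.indicator_of_notMem, zero_mul]
    intro h
    exact hmJ (huniq m' h ▸ hm')

end Merge

end BGW

/-! ### Weights of sets of living individuals, and their factorization over families. -/

namespace BGW

open Classical in
/-- `s ^ #(living members outside P)` if all of `P` is living, and `0` otherwise. -/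
def weight (s : ℝ≥0∞) (t : ℝ) (τ : Tree) (P : Finset (List ℕ)) : ℝ≥0∞ :=
  if (P : Set (List ℕ)) ⊆ living τ t then epow s (living τ t \ P).encard else 0

open Classical in
/-- The analogue of `weight` for the forest of `k` families. -/
def forestWeight (s : ℝ≥0∞) (k : ℕ) (t : ℝ) (ω : Realization) (P : Finset Individual) : ℝ≥0∞ :=
  if (P : Set Individual) ⊆ {v | Alive k ω t v}
  then epow s ({v | Alive k ω t v} \ (P : Set Individual)).encard else 0

/-- The copy of `P` in the family of the founder `i`. -/
def plant (i : ℕ) (P : Finset (List ℕ)) : Finset Individual :=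
  P.map ⟨Prod.mk i, Prod.mk_right_injective i⟩

@[simp] theorem mem_plant {i : ℕ} {P : Finset (List ℕ)} {v : Individual} :
    v ∈ plant i P ↔ v.1 = i ∧ v.2 ∈ P := by
  obtain ⟨a, b⟩ := v
  simp only [plant, Finset.mem_map, Function.Embedding.coeFn_mk, Prod.mk.injEq]
  constructor
  · rintro ⟨l, h, rfl, rfl⟩; exact ⟨rfl, h⟩
  · rintro ⟨rfl, h⟩; exact ⟨b, h, rfl, rfl⟩

theorem slice_plant (i j : ℕ) (P : Finset (List ℕ)) :
    slice (plant i P) j = if j = i then P else ∅ := by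
  ext l
  split_ifs with h <;> simp [h]

theorem slice_union (P Q : Finset Individual) (j : ℕ) :
    slice (P ∪ Q) j = slice P j ∪ slice Q j := by
  ext l; simp

theorem image_fst_plant {i : ℕ} {P : Finset (List ℕ)} (h : P.Nonempty) :
    (plant i P).image Prod.fst = {i} := by
  obtain ⟨l, hl⟩ := h
  ext a
  simp only [Finset.mem_image, mem_plant, Finset.mem_singleton]
  constructor
  · rintro ⟨v, hv, rfl⟩; exact hv.1
  · rintro rfl; exact ⟨(a, l), ⟨rfl, hl⟩, rfl⟩

theorem eq_plant_slice {P : Finset Individual} {i : ℕ} (h : P.image Prod.fst = {i}) :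
    P = plant i (slice P i) := by
  ext ⟨a, l⟩
  simp only [mem_plant, mem_slice]
  constructor
  · intro hv
    have : a ∈ P.image Prod.fst := Finset.mem_image_of_mem Prod.fst hv
    rw [h, Finset.mem_singleton] at this
    exact ⟨this, this ▸ hv⟩
  · rintro ⟨rfl, hv⟩; exact hv

theorem eq_plant_union {P : Finset Individual} {i j : ℕ} (h : P.image Prod.fst = {i, j}) :
    P = plant i (slice P i) ∪ plant j (slice P j) := by
  ext ⟨a, l⟩
  simp only [Finset.mem_union, mem_plant, mem_slice]
  constructor
  · intro hv
    have : a ∈ P.image Prod.fst := Finset.mem_image_of_mem Prod.fst hv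
    rw [h, Finset.mem_insert, Finset.mem_singleton] at this
    rcases this with rfl | rfl
    · exact Or.inl ⟨rfl, hv⟩
    · exact Or.inr ⟨rfl, hv⟩
  · rintro (⟨rfl, hv⟩ | ⟨rfl, hv⟩) <;> exact hv

theorem slice_nonempty {P : Finset Individual} {i : ℕ} :
    (slice P i).Nonempty ↔ i ∈ P.image Prod.fst := by
  simp [Finset.Nonempty]

/-- The living population is the disjoint union of the families, and `epow` turns sums of sizes into
products, also for infinite sizes. -/
theorem forestWeight_eq_prod (s : ℝ≥0∞) (k : ℕ) (t : ℝ) (ω : Realization)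
    {P : Finset Individual} (hP : ∀ v ∈ P, v.1 < k) :
    forestWeight s k t ω P = ∏ i ∈ Finset.range k, weight s t (branch ω i) (slice P i) := by
  by_cases h : (P : Set Individual) ⊆ {v | Alive k ω t v}
  · rw [forestWeight, if_pos h]
    have h' : ∀ i ∈ Finset.range k, weight s t (branch ω i) (slice P i) =
        epow s (living (branch ω i) t \ slice P i).encard := by
      intro i _
      refine if_pos fun l hl => ?_
      exact ((alive_iff _ _ _ _).1 (h (mem_slice.1 hl))).2
    rw [Finset.prod_congr rfl h', ← epow_sum]
    congr 1
    have : ({v | Alive k ω t v} \ (P : Set Individual)) = ⋃ i ∈ (Finset.range k : Set ℕ),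
        Prod.mk i '' (living (branch ω i) t \ slice P i) := by
      ext ⟨a, l⟩
      simp [alive_iff, and_assoc]
      tauto
    rw [this, Set.Finite.encard_biUnion (Finset.finite_toSet _), finsum_mem_coe_finset]
    · exact Finset.sum_congr rfl fun i _ => (Prod.mk_right_injective i).encard_image _
    · intro i _ j _ hij
      rw [Function.onFun, Set.disjoint_left]
      rintro _ ⟨l, _, rfl⟩ ⟨m, _, h⟩
      exact hij (congrArg Prod.fst h).symm
  · rw [forestWeight, if_neg h]
    obtain ⟨v, hv, hv'⟩ := Set.not_subset.1 h
    symm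
    refine Finset.prod_eq_zero (Finset.mem_range.2 (hP v hv)) ?_
    refine if_neg fun hs => hv' ?_
    exact (alive_iff _ _ _ _).2 ⟨hP v hv, hs (mem_slice.2 hv)⟩

theorem forestWeight_eq_zero {s : ℝ≥0∞} {k : ℕ} {t : ℝ} {ω : Realization}
    {P : Finset Individual} (hP : ¬ ∀ v ∈ P, v.1 < k) : forestWeight s k t ω P = 0 := by
  refine if_neg fun h => hP fun v hv => ?_
  exact ((alive_iff _ _ _ _).1 (h hv)).1

theorem tsum_plant {F : Finset Individual → ℝ≥0∞} (i : ℕ) :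
    ∑' P, (if P.image Prod.fst = {i} then F P else 0) =
      ∑' P, if P.Nonempty then F (plant i P) else 0 := by
  have hinj : Function.Injective (plant i) := Finset.map_injective _
  rw [← hinj.tsum_eq]
  · refine tsum_congr fun P => ?_
    by_cases h : P.Nonempty
    · rw [if_pos h, if_pos (image_fst_plant h)]
    · rw [if_neg h, if_neg]
      rw [Finset.not_nonempty_iff_eq_empty] at h
      subst h
      simp [plant]
  · intro P hP
    rw [Function.mem_support, ne_eq, ite_eq_right_iff, Classical.not_imp] at hP
    exact ⟨_, (eq_plant_slice hP.1).symm⟩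

theorem tsum_plant_pair {F : Finset Individual → ℝ≥0∞} {i j : ℕ} (hij : i ≠ j) :
    ∑' P, (if P.image Prod.fst = {i, j} then F P else 0) =
      ∑' p : Finset (List ℕ) × Finset (List ℕ),
        if p.1.Nonempty ∧ p.2.Nonempty then F (plant i p.1 ∪ plant j p.2) else 0 := by
  have hinj : Function.Injective fun p : Finset (List ℕ) × Finset (List ℕ) =>
      plant i p.1 ∪ plant j p.2 := by
    rintro ⟨P, Q⟩ ⟨P', Q'⟩ h
    have h1 := congrArg (fun R => slice R i) h
    have h2 := congrArg (fun R => slice R j) h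
    simp only [slice_union, slice_plant, if_neg hij, if_neg hij.symm, if_true,
      Finset.union_empty, Finset.empty_union] at h1 h2
    rw [h1, h2]
  rw [← hinj.tsum_eq]
  · refine tsum_congr fun p => ?_
    refine if_congr ?_ rfl rfl
    constructor
    · intro h
      have h1 : i ∈ (plant i p.1 ∪ plant j p.2).image Prod.fst := by simp [h]
      have h2 : j ∈ (plant i p.1 ∪ plant j p.2).image Prod.fst := by simp [h]
      rw [← slice_nonempty] at h1 h2
      simpa [slice_union, slice_plant, if_neg hij, if_neg hij.symm] using And.intro h1 h2
    · rintro ⟨h1, h2⟩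
      rw [Finset.image_union, image_fst_plant h1, image_fst_plant h2]
      rfl
  · intro P hP
    rw [Function.mem_support, ne_eq, ite_eq_right_iff, Classical.not_imp] at hP
    exact ⟨(_, _), (eq_plant_union hP.1).symm⟩

/-- A sum over sets meeting one or two out of `k` families. -/
theorem tsum_forest {F : Finset Individual → ℝ≥0∞} (k : ℕ)
    (hF : ∀ P, F P ≠ 0 → (∀ v ∈ P, v.1 < k) ∧
      ((P.image Prod.fst).card = 1 ∨ (P.image Prod.fst).card = 2)) :
    ∑' P, F P = ∑ i ∈ Finset.range k, (∑' P, if P.Nonempty then F (plant i P) else 0) +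
      ∑ j ∈ Finset.range k, ∑ i ∈ Finset.range j,
        ∑' p : Finset (List ℕ) × Finset (List ℕ),
          if p.1.Nonempty ∧ p.2.Nonempty then F (plant i p.1 ∪ plant j p.2) else 0 := by
  -- For a nonzero term the set of families met by `P` is one singleton or one pair; ordering the
  -- pair as `i < j` makes exactly one of the conditions true.
  have key : ∀ P, F P = ∑ i ∈ Finset.range k, (if P.image Prod.fst = {i} then F P else 0) +
      ∑ j ∈ Finset.range k, ∑ i ∈ Finset.range j,
        (if P.image Prod.fst = {i, j} then F P else 0) := by
    intro P
    by_cases h0 : F P = 0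
    · simp [h0]
    obtain ⟨h1, h2⟩ := hF P h0
    have hmem : ∀ a ∈ P.image Prod.fst, a < k := by
      intro a ha
      obtain ⟨v, hv, rfl⟩ := Finset.mem_image.1 ha
      exact h1 v hv
    have hpair : ∀ {a b : ℕ}, a < b → P.image Prod.fst = {a, b} →
        F P = ∑ i ∈ Finset.range k, (if P.image Prod.fst = {i} then F P else 0) +
        ∑ j ∈ Finset.range k, ∑ i ∈ Finset.range j,
        (if P.image Prod.fst = {i, j} then F P else 0) := by
      intro a b hlt hab
      have hcard : (P.image Prod.fst).card = 2 := by rw [hab, Finset.card_pair hlt.ne]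
      rw [Finset.sum_eq_zero, zero_add, Finset.sum_eq_single_of_mem b
        (Finset.mem_range.2 (hmem b (by simp [hab]))),
        Finset.sum_eq_single_of_mem a (Finset.mem_range.2 hlt), if_pos hab]
      · intro i hi hne
        refine if_neg fun h => ?_
        have : a ∈ ({i, b} : Finset ℕ) := by rw [← h, hab]; simp
        simp only [Finset.mem_insert, Finset.mem_singleton] at this
        omega
      · intro j _ hne
        refine Finset.sum_eq_zero fun i hi => if_neg fun h => ?_
        have h3 : a ∈ ({i, j} : Finset ℕ) := by rw [← h, hab]; simp
        have h4 : b ∈ ({i, j} : Finset ℕ) := by rw [← h, hab]; simp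
        simp only [Finset.mem_insert, Finset.mem_singleton, Finset.mem_range] at h3 h4 hi
        omega
      · intro i _
        refine if_neg fun h => ?_
        rw [h, Finset.card_singleton] at hcard
        omega
    rcases h2 with h2 | h2
    · obtain ⟨a, ha⟩ := Finset.card_eq_one.1 h2
      rw [Finset.sum_eq_single_of_mem a (Finset.mem_range.2 (hmem a (by simp [ha]))), if_pos ha]
      · rw [Finset.sum_eq_zero, add_zero]
        refine fun j _ => Finset.sum_eq_zero fun i hi => if_neg fun h => ?_
        rw [h, Finset.card_pair (Finset.mem_range.1 hi).ne] at h2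
        omega
      · intro i _ hne
        refine if_neg fun h => hne ?_
        rw [ha] at h
        exact (Finset.singleton_injective h).symm
    · obtain ⟨a, b, hne, hab⟩ := Finset.card_eq_two.1 h2
      rcases lt_or_gt_of_ne hne with h | h
      · exact hpair h hab
      · exact hpair h (hab.trans (Finset.pair_comm a b))
  rw [tsum_congr key, ENNReal.tsum_add]
  congr 1
  · rw [Summable.tsum_finsetSum fun _ _ => ENNReal.summable]
    exact Finset.sum_congr rfl fun i _ => tsum_plant i
  · rw [Summable.tsum_finsetSum fun _ _ => ENNReal.summable]
    refine Finset.sum_congr rfl fun j _ => ?_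
    rw [Summable.tsum_finsetSum fun _ _ => ENNReal.summable]
    exact Finset.sum_congr rfl fun i hi => tsum_plant_pair (Finset.mem_range.1 hi).ne

/-- `s ^ (number of living members)`. -/
def sizeWeight (s : ℝ≥0∞) (t : ℝ) (τ : Tree) : ℝ≥0∞ := epow s (living τ t).encard

theorem weight_empty (s : ℝ≥0∞) (t : ℝ) (τ : Tree) : weight s t τ ∅ = sizeWeight s t τ := by
  simp [weight, sizeWeight]

theorem forestWeight_plant (s : ℝ≥0∞) {k i : ℕ} (hi : i < k) (t : ℝ) (ω : Realization)
    (P : Finset (List ℕ)) :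
    forestWeight s k t ω (plant i P) = weight s t (branch ω i) P *
      ∏ j ∈ (Finset.range k).erase i, sizeWeight s t (branch ω j) := by
  rw [forestWeight_eq_prod, ← Finset.mul_prod_erase _ _ (Finset.mem_range.2 hi)]
  · congr 1
    · rw [slice_plant, if_pos rfl]
    · refine Finset.prod_congr rfl fun j hj => ?_
      rw [slice_plant, if_neg (Finset.ne_of_mem_erase hj), weight_empty]
  · intro v hv
    rw [(mem_plant.1 hv).1]
    exact hi

theorem forestWeight_plant_pair (s : ℝ≥0∞) {k i j : ℕ} (hij : i < j) (hj : j < k) (t : ℝ)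
    (ω : Realization) (P Q : Finset (List ℕ)) :
    forestWeight s k t ω (plant i P ∪ plant j Q) = weight s t (branch ω i) P *
      weight s t (branch ω j) Q *
      ∏ a ∈ ((Finset.range k).erase j).erase i, sizeWeight s t (branch ω a) := by
  have hi : i ∈ (Finset.range k).erase j :=
    Finset.mem_erase.2 ⟨hij.ne, Finset.mem_range.2 (hij.trans hj)⟩
  rw [forestWeight_eq_prod, ← Finset.mul_prod_erase _ _ (Finset.mem_range.2 hj),
    ← Finset.mul_prod_erase _ _ hi, ← mul_assoc, mul_comm (weight s t (branch ω i) P)]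
  · congr 1
    · congr 2
      · simp [slice_union, slice_plant, hij.ne']
      · simp [slice_union, slice_plant, hij.ne]
    · refine Finset.prod_congr rfl fun a ha => ?_
      rw [slice_union, slice_plant, slice_plant, if_neg (Finset.ne_of_mem_erase ha),
        if_neg (Finset.ne_of_mem_erase (Finset.mem_of_mem_erase ha)), Finset.union_empty,
        weight_empty]
  · intro v hv
    rcases Finset.mem_union.1 hv with h | h
    · rw [(mem_plant.1 h).1]; exact hij.trans hj
    · rw [(mem_plant.1 h).1]; exact hj

theorem forestLineages_plant (ω : Realization) (r : ℝ) (i : ℕ) (P : Finset (List ℕ)) :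
    forestLineages ω r (plant i P) = lineages (branch ω i) r P := by
  rw [forestLineages_eq_sum _ _ _ (i + 1),
    Finset.sum_eq_single_of_mem i (Finset.mem_range.2 (Nat.lt_succ_self i)), slice_plant,
    if_pos rfl]
  · intro j _ hj
    rw [slice_plant, if_neg hj, lineages_empty]
  · intro v hv
    rw [(mem_plant.1 hv).1]
    exact Nat.lt_succ_self i

theorem forestLineages_plant_pair (ω : Realization) (r : ℝ) {i j : ℕ} (hij : i < j)
    (P Q : Finset (List ℕ)) :
    forestLineages ω r (plant i P ∪ plant j Q) =
      lineages (branch ω i) r P + lineages (branch ω j) r Q := by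
  rw [← forestLineages_plant, ← forestLineages_plant, forestLineages, Finset.image_union,
    Finset.card_union_of_disjoint]
  · rfl
  · rw [Finset.disjoint_left]
    intro v hv hw
    obtain ⟨a, ha, rfl⟩ := Finset.mem_image.1 hv
    obtain ⟨b, hb, h⟩ := Finset.mem_image.1 hw
    have h1 := congrArg Prod.fst h
    simp only [(mem_plant.1 ha).1, (mem_plant.1 hb).1] at h1
    omega

theorem card_image_fst_le (ω : Realization) (r : ℝ) (P : Finset Individual) :
    (P.image Prod.fst).card ≤ forestLineages ω r P := by
  have : P.image Prod.fst =
      (P.image fun v => (v.1, lastBorn (branch ω v.1) r v.2)).image Prod.fst := by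
    rw [Finset.image_image]; rfl
  rw [this]
  exact Finset.card_image_le

/-! ### Decomposition of the coalescence sum at the death of the founder. -/

section Recursion

variable (s : ℝ≥0∞) (c : ℕ → ℝ) (N : ℕ)

/-- The sum of the weights of the sets of living members whose lineages coalesce exactly once in
each of the intervals `[c j, c (j + 1))`, `j ∈ J`, backwards from time `t`, and at no other time. -/
def coalescenceSum (t : ℝ) (J : Finset ℕ) (τ : Tree) : ℝ≥0∞ :=
  ∑' P : Finset (List ℕ), patternIndicator N J (fun i => lineages τ (t - c i) P) * weight s t τ P

theorem patternIndicator_of_not {N : ℕ} {J : Finset ℕ} {A : ℕ → ℕ} (h : ¬ Pattern N J A) :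
    patternIndicator N J A = 0 := if_neg h

theorem patternIndicator_empty (J : Finset ℕ) (τ : Tree) (t : ℝ) :
    patternIndicator N J (fun i => lineages τ (t - c i) ∅) = 0 :=
  patternIndicator_of_not fun h => by simpa using h.1

/-- While the founder lives it is the whole population; its singleton has one lineage at all times
and leaves nobody outside. -/
theorem coalescenceSum_of_lt {J : Finset ℕ} (hJ : ∀ j ∈ J, j < N) {τ : Tree}
    (hτ : ∀ l, 0 ≤ (τ l).1) {t : ℝ} (ht : 0 ≤ t) (h : t < (τ []).1) :
    coalescenceSum s c N t J τ = if J = ∅ then 1 else 0 := by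
  have hliv := living_eq_singleton hτ ht h
  have hlin : ∀ r, lineages τ r {[]} = 1 := fun r => by simp [lineages]
  have hpat : Pattern N J (fun i => lineages τ (t - c i) {[]}) ↔ J = ∅ := by
    constructor
    · intro hp
      have := hp.zero_eq hJ
      simp only [hlin] at this
      rw [← Finset.card_eq_zero]; omega
    · rintro rfl
      exact ⟨hlin _, fun i _ => by simp [hlin]⟩
  rw [coalescenceSum, tsum_eq_single {[]}]
  · simp [patternIndicator, hpat, weight, hliv]
  · intro P hP
    by_cases h0 : P = ∅
    · rw [h0, patternIndicator_empty, zero_mul]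
    · rw [weight, if_neg, mul_zero]
      rw [hliv]
      intro hsub
      refine hP (Finset.Subset.antisymm (fun l hl => by simpa using hsub hl) ?_)
      obtain ⟨l, hl⟩ := Finset.nonempty_iff_ne_empty.2 h0
      have : l = [] := hsub hl
      simpa [← this] using hl

theorem sizeWeight_of_lt {τ : Tree} (hτ : ∀ l, 0 ≤ (τ l).1) {t : ℝ} (ht : 0 ≤ t)
    (h : t < (τ []).1) : sizeWeight s t τ = s := by
  rw [sizeWeight, living_eq_singleton hτ ht h, Set.encard_singleton, epow_one]

theorem living_eq_image {τ : Tree} {t : ℝ} (h : (τ []).1 ≤ t) :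
    living τ t = graft '' {v | Alive (τ []).2 (offspring τ) (t - (τ []).1) v} := by
  ext l
  rcases List.eq_nil_or_concat' l with rfl | ⟨l, j, rfl⟩
  · simp [nil_mem_living, h, graft_apply]
  · have : l ++ [j] = graft (j, l) := rfl
    rw [append_mem_living, this, graft.injective.mem_set_image, Set.mem_ofPred_eq, alive_iff]

theorem weight_map_graft {τ : Tree} {t : ℝ} (h : (τ []).1 ≤ t) (P : Finset Individual) :
    weight s t τ (P.map graft) =
      forestWeight s (τ []).2 (t - (τ []).1) (offspring τ) P := by
  rw [weight, forestWeight, living_eq_image h, Finset.coe_map,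
    Set.image_subset_image_iff graft.injective, ← Set.image_sdiff graft.injective,
    graft.injective.encard_image]

theorem sizeWeight_eq_prod {τ : Tree} {t : ℝ} (h : (τ []).1 ≤ t) :
    sizeWeight s t τ = ∏ i ∈ Finset.range (τ []).2,
      sizeWeight s (t - (τ []).1) (branch (offspring τ) i) := by
  have h1 := weight_map_graft s h ∅
  rw [Finset.map_empty, weight_empty, forestWeight_eq_prod _ _ _ _ (by simp)] at h1
  rw [h1]
  refine Finset.prod_congr rfl fun i _ => ?_
  rw [← weight_empty]
  rfl

/-- In a forest, only sets within one family show a pattern. -/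
theorem tsum_forest_pattern (J : Finset ℕ) (k : ℕ) (t : ℝ) (ω : Realization) :
    ∑' P : Finset Individual, patternIndicator N J (fun i => forestLineages ω (t - c i) P) *
        forestWeight s k t ω P =
      ∑ i ∈ Finset.range k, coalescenceSum s c N t J (branch ω i) *
        ∏ a ∈ (Finset.range k).erase i, sizeWeight s t (branch ω a) := by
  rw [tsum_forest k]
  · refine (congrArg₂ (· + ·) ?_ ?_).trans (add_zero _)
    · refine Finset.sum_congr rfl fun i hi => ?_
      rw [coalescenceSum, ← ENNReal.tsum_mul_right]
      refine tsum_congr fun P => ?_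
      rcases P.eq_empty_or_nonempty with rfl | hP
      · rw [if_neg (by simp), patternIndicator_empty, zero_mul, zero_mul]
      rw [if_pos hP, forestWeight_plant s (Finset.mem_range.1 hi), mul_assoc]
      simp only [forestLineages_plant]
    -- Different founders keep at least two lineages at index `N`, where a pattern has one.
    · refine Finset.sum_eq_zero fun j _ => Finset.sum_eq_zero fun i hi => ?_
      rw [ENNReal.tsum_eq_zero]
      intro p
      split_ifs with h
      · rw [patternIndicator_of_not, zero_mul]
        intro hp
        have := hp.1
        simp only [forestLineages_plant_pair ω _ (Finset.mem_range.1 hi)] at this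
        have h1 := lineages_pos (τ := branch ω i) (r := t - c N) h.1
        have h2 := lineages_pos (τ := branch ω j) (r := t - c N) h.2
        omega
      · rfl
  · intro P hP
    constructor
    · by_contra hn
      exact hP (by rw [forestWeight_eq_zero hn, mul_zero])
    · have hp : Pattern N J (fun i => forestLineages ω (t - c i) P) := by
        by_contra hn
        exact hP (by rw [patternIndicator_of_not hn, zero_mul])
      have h1 := hp.1
      have h2 := card_image_fst_le ω (t - c N) P
      have h3 : P.Nonempty := by
        by_contra h0
        rw [Finset.not_nonempty_iff_eq_empty] at h0
        subst h0
        simp [forestLineages] at h1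
      have := Finset.card_pos.2 (h3.image Prod.fst)
      left; simp only at h1; omega

variable {c} (hc : Monotone c) (hc0 : c 0 = 0)
include hc hc0

/-- Decomposition at the death of the founder. -/
theorem coalescenceSum_of_le {J : Finset ℕ} (hJ : ∀ j ∈ J, j < N) {τ : Tree}
    (hτ : ∀ l, 0 ≤ (τ l).1) {t : ℝ} (h : (τ []).1 ≤ t) :
    coalescenceSum s c N t J τ =
      ∑ i ∈ Finset.range (τ []).2, coalescenceSum s c N (t - (τ []).1) J (branch (offspring τ) i) *
        ∏ a ∈ (Finset.range (τ []).2).erase i,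
          sizeWeight s (t - (τ []).1) (branch (offspring τ) a) +
      ∑ j ∈ Finset.range (τ []).2, ∑ i ∈ Finset.range j,
        (∑ m ∈ J, (Set.Ico (c m) (c (m + 1))).indicator 1 (t - (τ []).1) *
          ∑ J₁ ∈ (J.erase m).powerset,
            coalescenceSum s c N (t - (τ []).1) J₁ (branch (offspring τ) i) *
            coalescenceSum s c N (t - (τ []).1) (J.erase m \ J₁) (branch (offspring τ) j)) *
        ∏ a ∈ ((Finset.range (τ []).2).erase j).erase i,
          sizeWeight s (t - (τ []).1) (branch (offspring τ) a) := by
  set k := (τ []).2 with hk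
  set ω := offspring τ with hω
  set u := t - (τ []).1 with hu
  have hu0 : c 0 ≤ u := by rw [hc0]; linarith
  have hbr : ∀ i l, 0 ≤ (branch ω i l).1 := branch_offspring_nonneg hτ
  -- Looking back by more than `u`, the time elapsed since the death of the founder, all lines have
  -- reached the founder.
  have hlin : ∀ P : Finset Individual, P.Nonempty → ∀ i, lineages τ (t - c i) (P.map graft) =
      if u < c i then 1 else forestLineages ω (u - c i) P := by
    intro P hP i
    split_ifs with h1
    · exact lineages_map_graft_of_lt hτ (by linarith) hP
    · rw [lineages_map_graft_of_le (by linarith)]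
      congr 1
      rw [hu]; ring
  have hP0 : ∀ P : Finset Individual,
      Pattern N J (fun i => lineages τ (t - c i) (P.map graft)) → P.Nonempty := by
    intro P hp
    by_contra h0
    rw [Finset.not_nonempty_iff_eq_empty] at h0
    subst h0
    simpa using hp.1
  -- Three child families would lose at least two lineages inside a single interval, or would still
  -- be separate at index `N`.
  have hcard : ∀ P : Finset Individual,
      Pattern N J (fun i => lineages τ (t - c i) (P.map graft)) →
      (P.image Prod.fst).card = 1 ∨ (P.image Prod.fst).card = 2 := by
    intro P hp
    have hne := hP0 P hp
    have hpos : 0 < (P.image Prod.fst).card := Finset.card_pos.2 (hne.image _)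
    simp only [hlin P hne] at hp
    suffices (P.image Prod.fst).card ≤ 2 by omega
    by_cases hN : u < c N
    · obtain ⟨m, hm, hm1, hm2⟩ := exists_mem_Ico_of_lt hu0 hN
      have := hp.2 m hm
      simp only [not_lt.2 hm1, hm2, if_true, if_false] at this
      refine (card_image_fst_le ω (u - c m) P).trans ?_
      rw [this]
      split_ifs <;> omega
    · have := hp.1
      simp only [hN, if_false] at this
      exact (card_image_fst_le ω (u - c N) P).trans (by omega)
  -- The founder is dead at time `t`, so all living members lie in the image of `graft`.
  have hsum : coalescenceSum s c N t J τ = ∑' P : Finset Individual,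
      patternIndicator N J (fun i => lineages τ (t - c i) (P.map graft)) *
        forestWeight s k u ω P := by
    have hinj : Function.Injective (Finset.map graft) := Finset.map_injective graft
    rw [coalescenceSum, ← hinj.tsum_eq]
    · exact tsum_congr fun P => by rw [weight_map_graft s h]
    · intro P hP
      rw [Function.mem_support] at hP
      have hsub : (P : Set (List ℕ)) ⊆ living τ t := by
        by_contra hn
        exact hP (by rw [weight, if_neg hn, mul_zero])
      refine ⟨P.preimage graft graft.injective.injOn, ?_⟩
      ext l
      simp only [Finset.mem_map, Finset.mem_preimage]
      constructor
      · rintro ⟨v, hv, rfl⟩; exact hv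
      · intro hl
        have := hsub hl
        rw [living_eq_image h] at this
        obtain ⟨v, _, rfl⟩ := this
        exact ⟨v, hl, rfl⟩
  rw [hsum, tsum_forest k]
  · congr 1
    · refine Finset.sum_congr rfl fun i hi => ?_
      rw [coalescenceSum, ← ENNReal.tsum_mul_right]
      refine tsum_congr fun P => ?_
      rcases P.eq_empty_or_nonempty with rfl | hP
      · rw [if_neg (by simp), patternIndicator_empty, zero_mul, zero_mul]
      rw [if_pos hP, forestWeight_plant s (Finset.mem_range.1 hi), mul_assoc]
      congr 2
      funext a
      rw [hlin _ (by simpa [plant] using hP)]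
      -- Beyond `u` both counts are 1: in the whole tree because of the founder, in the subtree by
      -- the convention for times before its birth.
      split_ifs with h1
      · rw [lineages_of_neg (hbr i) (by linarith) hP]
      · rw [forestLineages_plant]
    · refine Finset.sum_congr rfl fun j hj => Finset.sum_congr rfl fun i hi => ?_
      rw [Finset.mem_range] at hi hj
      have hterm : ∀ p : Finset (List ℕ) × Finset (List ℕ),
          (if p.1.Nonempty ∧ p.2.Nonempty then
            patternIndicator N J (fun a => lineages τ (t - c a)
              ((plant i p.1 ∪ plant j p.2).map graft)) *
              forestWeight s k u ω (plant i p.1 ∪ plant j p.2) else 0) =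
          (∑ m ∈ J, (Set.Ico (c m) (c (m + 1))).indicator 1 u *
            ∑ J₁ ∈ (J.erase m).powerset,
              (patternIndicator N J₁ (fun a => lineages (branch ω i) (u - c a) p.1) *
                weight s u (branch ω i) p.1) *
              (patternIndicator N (J.erase m \ J₁)
                (fun a => lineages (branch ω j) (u - c a) p.2) *
                weight s u (branch ω j) p.2)) *
            ∏ a ∈ ((Finset.range k).erase j).erase i, sizeWeight s u (branch ω a) := by
        rintro ⟨P, Q⟩
        rcases P.eq_empty_or_nonempty with rfl | hP
        · simp only [patternIndicator_empty, zero_mul, mul_zero, Finset.sum_const_zero,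
            Finset.not_nonempty_empty, false_and, if_false]
        rcases Q.eq_empty_or_nonempty with rfl | hQ
        · simp only [patternIndicator_empty, zero_mul, mul_zero, Finset.sum_const_zero,
            Finset.not_nonempty_empty, and_false, if_false]
        have hne : (plant i P ∪ plant j Q).Nonempty := by
          simpa [plant] using Or.inl hP
        rw [if_pos ⟨hP, hQ⟩, forestWeight_plant_pair s hi hj]
        simp only [hlin _ hne, forestLineages_plant_pair ω _ hi]
        have hanti : ∀ a (R : Finset (List ℕ)),
            Antitone fun b => lineages (branch ω a) (u - c b) R := fun a R b b' hb =>
          lineages_mono (by linarith [hc hb]) R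
        rw [patternIndicator_merge hc hu0 hJ (hanti i P) (hanti j Q)
          (fun _ => lineages_pos hP) (fun _ => lineages_pos hQ)
          (fun a ha => lineages_of_neg (hbr i) (by linarith) hP)
          (fun a ha => lineages_of_neg (hbr j) (by linarith) hQ), ← mul_assoc]
        congr 1
        rw [Finset.sum_mul]
        refine Finset.sum_congr rfl fun m _ => ?_
        rw [mul_assoc, Finset.sum_mul]
        congr 1
        refine Finset.sum_congr rfl fun J₁ _ => ?_
        ring
      rw [tsum_congr hterm, ENNReal.tsum_mul_right]
      congr 1
      rw [Summable.tsum_finsetSum fun _ _ => ENNReal.summable]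
      refine Finset.sum_congr rfl fun m _ => ?_
      rw [ENNReal.tsum_mul_left]
      congr 1
      rw [Summable.tsum_finsetSum fun _ _ => ENNReal.summable]
      refine Finset.sum_congr rfl fun J₁ _ => ?_
      rw [ENNReal.tsum_prod']
      simp_rw [ENNReal.tsum_mul_left, ENNReal.tsum_mul_right]
      rfl
  · intro P hP
    constructor
    · by_contra hn
      exact hP (by rw [forestWeight_eq_zero hn, mul_zero])
    · refine hcard P ?_
      by_contra hn
      exact hP (by rw [patternIndicator_of_not hn, zero_mul])

end Recursion

end BGW

/-! ### Measurability, and the branching property of the law. -/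

namespace BGW

/-- The cardinality is a countable sum of indicators in `ℝ≥0∞`, and each finite value can be read
off there. -/
theorem measurable_encard {Ω α : Type*} [MeasurableSpace Ω] [Countable α] {S : Ω → Set α}
    (hS : ∀ a, MeasurableSet {ω | a ∈ S ω}) : Measurable fun ω => (S ω).encard := by
  have h : Measurable fun ω => ((S ω).encard : ℝ≥0∞) := by
    have : ∀ ω, ((S ω).encard : ℝ≥0∞) = ∑' a, (S ω).indicator 1 a := fun ω => by
      rw [← ENNReal.tsum_set_one, ← tsum_subtype]
      rfl
    simp only [this]
    refine Measurable.tsum fun a => ?_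
    have : (fun ω => (S ω).indicator (1 : α → ℝ≥0∞) a) = {ω | a ∈ S ω}.indicator 1 := by
      ext ω
      by_cases h : a ∈ S ω <;> simp [Set.indicator, h]
    rw [this]
    exact measurable_one.indicator (hS a)
  refine measurable_to_countable' fun n => ?_
  have : (fun ω => (S ω).encard) ⁻¹' {n} = (fun ω => ((S ω).encard : ℝ≥0∞)) ⁻¹' {(n : ℝ≥0∞)} := by
    ext ω
    simp
  rw [this]
  exact h (measurableSet_singleton _)

theorem measurable_treeBirth (l : List ℕ) : Measurable fun τ : Tree => treeBirth τ l := by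
  induction l with
  | nil => exact measurable_const
  | cons j l ih => exact ih.add (measurable_pi_apply l).fst

theorem measurableSet_treeMem (l : List ℕ) : MeasurableSet {τ : Tree | TreeMem τ l} := by
  induction l with
  | nil => exact MeasurableSet.const _
  | cons j l ih =>
    have h : MeasurableSet {τ : Tree | j < (τ l).2} :=
      measurableSet_lt measurable_const (measurable_pi_apply l).snd
    exact ih.inter h

theorem measurableSet_mem_living (l : List ℕ) :
    MeasurableSet {p : ℝ × Tree | l ∈ living p.2 p.1} := by
  have h1 : Measurable fun p : ℝ × Tree => treeBirth p.2 l :=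
    (measurable_treeBirth l).comp measurable_snd
  have h2 : Measurable fun p : ℝ × Tree => (p.2 l).1 :=
    ((measurable_pi_apply l).comp measurable_snd).fst
  exact (measurable_snd (measurableSet_treeMem l)).inter
    ((measurableSet_le h1 measurable_fst).inter
      (measurableSet_lt measurable_fst (h1.add h2)))

theorem measurableSet_lastBorn (l m : List ℕ) :
    MeasurableSet {p : ℝ × Tree | lastBorn p.2 p.1 l = m} := by
  induction l with
  | nil => exact MeasurableSet.const ([] = m)
  | cons j l ih =>
    have h : MeasurableSet {p : ℝ × Tree | treeBirth p.2 (j :: l) ≤ p.1} :=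
      measurableSet_le ((measurable_treeBirth (j :: l)).comp measurable_snd) measurable_fst
    simp only [lastBorn]
    have : {p : ℝ × Tree |
        (if treeBirth p.2 (j :: l) ≤ p.1 then j :: l else lastBorn p.2 p.1 l) = m} =
        ({p : ℝ × Tree | treeBirth p.2 (j :: l) ≤ p.1} ∩ {_p | j :: l = m}) ∪
        ({p : ℝ × Tree | treeBirth p.2 (j :: l) ≤ p.1}ᶜ ∩ {p | lastBorn p.2 p.1 l = m}) := by
      ext p
      by_cases h : treeBirth p.2 (j :: l) ≤ p.1 <;> simp [h]
    rw [this]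
    exact (h.inter (MeasurableSet.const _)).union (h.compl.inter ih)

theorem measurable_lineages (P : Finset (List ℕ)) :
    Measurable fun p : ℝ × Tree => lineages p.2 p.1 P := by
  have h : Measurable fun p : ℝ × Tree => {m | ∃ l ∈ P, lastBorn p.2 p.1 l = m}.encard := by
    refine measurable_encard fun m => ?_
    have : {p : ℝ × Tree | m ∈ {m | ∃ l ∈ P, lastBorn p.2 p.1 l = m}} =
        ⋃ l ∈ P, {p | lastBorn p.2 p.1 l = m} := by
      ext p; simp
    rw [this]
    exact Finset.measurableSet_biUnion _ fun l _ => measurableSet_lastBorn l m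
  have h2 : ∀ p : ℝ × Tree, lineages p.2 p.1 P =
      {m | ∃ l ∈ P, lastBorn p.2 p.1 l = m}.encard.toNat := by
    intro p
    have : {m | ∃ l ∈ P, lastBorn p.2 p.1 l = m} =
        ((P.image (lastBorn p.2 p.1) : Finset (List ℕ)) : Set (List ℕ)) := by
      ext m; simp
    rw [this, Set.encard_coe_eq_coe_finsetCard]
    rfl
  simp only [h2]
  exact (measurable_of_countable ENat.toNat).comp h

theorem measurable_patternIndicator {Ω : Type*} [MeasurableSpace Ω] (N : ℕ) (J : Finset ℕ)
    {A : Ω → ℕ → ℕ} (hA : ∀ i, Measurable fun ω => A ω i) :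
    Measurable fun ω => patternIndicator N J (A ω) := by
  refine Measurable.ite ?_ measurable_const measurable_const
  have : {ω | Pattern N J (A ω)} = {ω | A ω N = 1} ∩ ⋂ i ∈ Finset.range N,
      {ω | A ω i = A ω (i + 1) + if i ∈ J then 1 else 0} := by
    ext ω; simp [Pattern]
  rw [this]
  refine (hA N (measurableSet_singleton 1)).inter
    (Finset.measurableSet_biInter _ fun i _ => ?_)
  exact measurableSet_eq_fun (hA i) ((hA (i + 1)).add_const _)

theorem measurable_weight (s : ℝ≥0∞) (P : Finset (List ℕ)) :
    Measurable fun p : ℝ × Tree => weight s p.1 p.2 P := by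
  refine Measurable.ite ?_ ?_ measurable_const
  · have : {p : ℝ × Tree | (P : Set (List ℕ)) ⊆ living p.2 p.1} =
        ⋂ l ∈ P, {p | l ∈ living p.2 p.1} := by
      ext p; simp [Set.subset_def]
    rw [this]
    exact Finset.measurableSet_biInter _ fun l _ => measurableSet_mem_living l
  · refine (measurable_of_countable (epow s)).comp (measurable_encard fun l => ?_)
    exact (measurableSet_mem_living l).inter (MeasurableSet.const _)

theorem measurable_sizeWeight (s : ℝ≥0∞) :
    Measurable fun p : ℝ × Tree => sizeWeight s p.1 p.2 := by
  simp only [← weight_empty]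
  exact measurable_weight s ∅

theorem measurable_coalescenceSum (s : ℝ≥0∞) (c : ℕ → ℝ) (N : ℕ) (J : Finset ℕ) :
    Measurable fun p : ℝ × Tree => coalescenceSum s c N p.1 J p.2 := by
  refine Measurable.tsum fun P => (measurable_patternIndicator N J fun i => ?_).mul
    (measurable_weight s P)
  exact (measurable_lineages P).comp ((measurable_fst.sub_const (c i)).prodMk measurable_snd)

/-- The law of the marks of an individual. -/
def markLaw (μ : Measure ℕ) : Measure (ℝ × ℕ) :=
  (expMeasure (μ.real Set.univ)).prod ((μ Set.univ)⁻¹ • μ)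

/-- The law of the marks of a family. -/
def treeLaw (μ : Measure ℕ) : Measure Tree := Measure.infinitePi fun _ : List ℕ => markLaw μ

theorem isProbabilityMeasure_markLaw (μ : Measure ℕ) [IsFiniteMeasure μ] [NeZero μ] :
    IsProbabilityMeasure (markLaw μ) := by
  have hu : μ Set.univ ≠ 0 := by simpa using NeZero.ne μ
  have hr : 0 < μ.real Set.univ := ENNReal.toReal_pos hu (measure_ne_top μ _)
  have h1 := isProbabilityMeasure_expMeasure hr
  have h2 : IsProbabilityMeasure ((μ Set.univ)⁻¹ • μ) :=
    ⟨by simp⟩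
  unfold markLaw
  infer_instance

attribute [local instance] isProbabilityMeasure_markLaw

theorem law_eq (μ : Measure ℕ) : law μ = Measure.infinitePi fun _ : Individual => markLaw μ := rfl

/-- The family whose founder has the mark `a`, and whose founder's children have the families
given by `ω`. -/
def join (a : ℝ × ℕ) (ω : Realization) : Tree := fun l =>
  if h : l = [] then a else ω (l.getLast h, l.dropLast)

@[simp] theorem join_nil (a : ℝ × ℕ) (ω : Realization) : join a ω [] = a := by simp [join]

@[simp] theorem join_graft (a : ℝ × ℕ) (ω : Realization) (v : Individual) :
    join a ω (graft v) = ω v := by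
  simp [join, graft_apply]

@[simp] theorem offspring_join (a : ℝ × ℕ) (ω : Realization) : offspring (join a ω) = ω := by
  funext v
  exact join_graft a ω v

theorem measurable_join : Measurable fun p : (ℝ × ℕ) × Realization => join p.1 p.2 := by
  refine measurable_pi_lambda _ fun l => ?_
  rcases List.eq_nil_or_concat' l with rfl | ⟨l, j, rfl⟩
  · simpa using measurable_fst
  · have : ∀ p : (ℝ × ℕ) × Realization, join p.1 p.2 (l ++ [j]) = p.2 (j, l) := fun p =>
      join_graft p.1 p.2 (j, l)
    simp only [this]
    exact (measurable_pi_apply _).comp measurable_snd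

theorem join_nonneg {a : ℝ × ℕ} {ω : Realization} (ha : 0 ≤ a.1) (hω : ∀ v, 0 ≤ (ω v).1)
    (l : List ℕ) : 0 ≤ (join a ω l).1 := by
  unfold join
  split_ifs
  exacts [ha, hω _]

section Law

variable (μ : Measure ℕ) [IsFiniteMeasure μ] [NeZero μ]

instance : IsProbabilityMeasure (treeLaw μ) := by unfold treeLaw; infer_instance

theorem isProbabilityMeasure_law_of_neZero : IsProbabilityMeasure (law μ) := by
  rw [law_eq]; infer_instance

attribute [local instance] isProbabilityMeasure_law_of_neZero

/-- The branching property: the marks are i.i.d. over labels, and every label is either `[]` or a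
unique `graft v`, so the mark of the founder and the forest of its children are independent with the
right laws. -/
theorem map_join : ((markLaw μ).prod (law μ)).map (fun p => join p.1 p.2) = treeLaw μ := by
  classical
  refine Measure.eq_infinitePi _ fun I S hS => ?_
  rw [Measure.map_apply measurable_join (MeasurableSet.pi I.countable_toSet fun i _ => hS i)]
  have hpre : (fun p : (ℝ × ℕ) × Realization => join p.1 p.2) ⁻¹' (Set.pi (I : Set (List ℕ)) S) =
      (if [] ∈ I then S [] else Set.univ) ×ˢ
        Set.pi (I.preimage graft graft.injective.injOn : Set Individual) (fun v => S (graft v)) := by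
    ext ⟨a, ω⟩
    simp only [Set.mem_preimage, Set.mem_pi, Finset.mem_coe, Set.mem_prod, Finset.mem_preimage]
    constructor
    · intro h
      refine ⟨?_, fun v hv => by simpa using h _ hv⟩
      split_ifs with h0
      · simpa using h _ h0
      · trivial
    · rintro ⟨h1, h2⟩ l hl
      rcases List.eq_nil_or_concat' l with rfl | ⟨l, j, rfl⟩
      · simpa [hl] using h1
      · have := h2 (j, l) hl
        rw [← join_graft a ω] at this
        exact this
  rw [hpre, Measure.prod_prod, law_eq, Measure.infinitePi_pi _ fun v _ => hS _]
  have hprod : ∏ v ∈ I.preimage graft graft.injective.injOn, markLaw μ (S (graft v)) =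
      ∏ l ∈ I.erase [], markLaw μ (S l) := by
    refine Finset.prod_nbij graft ?_ graft.injective.injOn ?_ fun _ _ => rfl
    · intro v hv
      rw [Finset.mem_preimage] at hv
      exact Finset.mem_erase.2 ⟨by simp [graft_apply], hv⟩
    · intro l hl
      rw [Finset.mem_coe, Finset.mem_erase] at hl
      rcases List.eq_nil_or_concat' l with rfl | ⟨l, j, rfl⟩
      · exact absurd rfl hl.1
      · exact ⟨(j, l), Finset.mem_coe.2 (Finset.mem_preimage.2 hl.2), rfl⟩
  rw [hprod]
  split_ifs with h0
  · exact Finset.mul_prod_erase I (fun l => markLaw μ (S l)) h0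
  · rw [measure_univ, one_mul, Finset.erase_eq_of_notMem h0]

theorem lintegral_treeLaw {F : Tree → ℝ≥0∞} (hF : Measurable F) :
    ∫⁻ τ, F τ ∂treeLaw μ = ∫⁻ a, ∫⁻ ω, F (join a ω) ∂law μ ∂markLaw μ := by
  rw [← map_join, lintegral_map hF measurable_join,
    lintegral_prod (fun p : (ℝ × ℕ) × Realization => F (join p.1 p.2))
      (hF.comp measurable_join).aemeasurable]

theorem measurable_branch (i : ℕ) : Measurable fun ω : Realization => branch ω i :=
  measurable_pi_lambda _ fun _ => measurable_pi_apply _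

/-- Currying a product measure: families of different founders are i.i.d. -/
theorem map_branch : (law μ).map (fun ω i => branch ω i) =
    Measure.infinitePi fun _ : ℕ => treeLaw μ :=
  Measure.infinitePi_map_curry (ι := ℕ) (κ := List ℕ) fun _ _ => markLaw μ

theorem lintegral_prod_branch (I : Finset ℕ) {F : ℕ → Tree → ℝ≥0∞} (hF : ∀ i, Measurable (F i)) :
    ∫⁻ ω, ∏ i ∈ I, F i (branch ω i) ∂law μ = ∏ i ∈ I, ∫⁻ τ, F i τ ∂treeLaw μ := by
  have hm : Measurable fun (ω : Realization) i => branch ω i :=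
    measurable_pi_lambda _ fun i => measurable_branch i
  have h1 : ∫⁻ ω, ∏ i ∈ I, F i (branch ω i) ∂law μ =
      ∫⁻ ξ, ∏ i ∈ I, F i (ξ i) ∂(Measure.infinitePi fun _ : ℕ => treeLaw μ) := by
    rw [← map_branch, lintegral_map (f := fun ξ : ℕ → Tree => ∏ i ∈ I, F i (ξ i)) _ hm]
    exact Finset.measurable_prod _ fun i _ => (hF i).comp (measurable_pi_apply i)
  rw [h1, lintegral_prod_eq_prod_lintegral_of_indepFun I (fun i (ξ : ℕ → Tree) => F i (ξ i))
    (iIndepFun_infinitePi hF) fun i => (hF i).comp (measurable_pi_apply i)]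
  refine Finset.prod_congr rfl fun i _ => ?_
  have h := Measure.infinitePi_map_eval (fun _ : ℕ => treeLaw μ) i
  exact (lintegral_map (hF i) (measurable_pi_apply i)).symm.trans (by rw [h])

theorem ae_markLaw_nonneg : ∀ᵐ a ∂markLaw μ, 0 ≤ a.1 := by
  have hu : μ Set.univ ≠ 0 := by simpa using NeZero.ne μ
  have hr : 0 < μ.real Set.univ := ENNReal.toReal_pos hu (measure_ne_top μ _)
  have h1 := isProbabilityMeasure_expMeasure hr
  have h2 : ∀ᵐ w ∂expMeasure (μ.real Set.univ), 0 ≤ w := by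
    rw [ae_iff]
    simp only [not_le]
    change (volume.withDensity (exponentialPDF (μ.real Set.univ))) (Set.Iio 0) = 0
    rw [withDensity_apply _ measurableSet_Iio]
    exact lintegral_exponentialPDF_of_nonpos le_rfl
  exact Measure.quasiMeasurePreserving_fst.ae h2

theorem ae_law_nonneg : ∀ᵐ ω ∂law μ, ∀ v, 0 ≤ (ω v).1 := by
  rw [ae_all_iff]
  intro v
  have h := ae_markLaw_nonneg μ
  rw [← Measure.infinitePi_map_eval (fun _ : Individual => markLaw μ) v] at h
  exact ae_of_ae_map (measurable_pi_apply v).aemeasurable h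

end Law

end BGW

/-! ### Generating functions, their bounds and their renewal equations. -/

namespace BGW

attribute [local instance] isProbabilityMeasure_markLaw isProbabilityMeasure_law_of_neZero

theorem epow_le_one {s : ℝ≥0∞} (hs : s ≤ 1) (n : ℕ∞) : epow s n ≤ 1 := by
  unfold epow
  split_ifs
  exacts [zero_le_one, pow_le_one' hs _]

/-- All contributing sets have `J.card + 1` members, so the left side is part of the binomial
expansion of ((1 - s) + s)^|L| for the living set L. If the population is infinite, all weights
vanish. The bound gives finiteness of all expectations without moment assumptions on `μ`. -/
theorem mul_coalescenceSum_le_one {s : ℝ≥0∞} (hs : s ≤ 1) {c : ℕ → ℝ} (hc0 : c 0 = 0) {N : ℕ}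
    {J : Finset ℕ} (hJ : ∀ j ∈ J, j < N) (t : ℝ) (τ : Tree) :
    (1 - s) ^ (J.card + 1) * coalescenceSum s c N t J τ ≤ 1 := by
  classical
  by_cases hfin : (living τ t).Finite
  · set L := hfin.toFinset with hL
    have hcoe : living τ t = (L : Set (List ℕ)) := by simp [hL]
    calc (1 - s) ^ (J.card + 1) * coalescenceSum s c N t J τ
        = ∑' P : Finset (List ℕ), (1 - s) ^ (J.card + 1) *
            (patternIndicator N J (fun i => lineages τ (t - c i) P) * weight s t τ P) :=
          ENNReal.tsum_mul_left.symm
      _ ≤ ∑' P : Finset (List ℕ), if P ∈ L.powerset then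
            (1 - s) ^ P.card * s ^ (L.card - P.card) else 0 := by
          refine ENNReal.tsum_le_tsum fun P => ?_
          by_cases hP : (P : Set (List ℕ)) ⊆ living τ t
          · have hP' : P ⊆ L := by rw [hcoe] at hP; exact_mod_cast hP
            rw [if_pos (Finset.mem_powerset.2 hP'), weight, if_pos hP, hcoe,
              ← Finset.coe_sdiff, Set.encard_coe_eq_coe_finsetCard, epow_coe,
              Finset.card_sdiff_of_subset hP', patternIndicator]
            split_ifs with hp
            · have := hp.zero_eq hJ
              simp only [hc0, sub_zero, lineages_eq_card hP] at this
              rw [this, one_mul]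
            · simp
          · rw [weight, if_neg hP, mul_zero, mul_zero]
            exact zero_le
      _ = ∑ P ∈ L.powerset, (1 - s) ^ P.card * s ^ (L.card - P.card) := by
          rw [tsum_eq_sum (s := L.powerset)]
          · exact Finset.sum_congr rfl fun P hP => if_pos hP
          · exact fun P hP => if_neg hP
      _ = 1 := by rw [Finset.sum_pow_mul_eq_add_pow, tsub_add_cancel_of_le hs, one_pow]
  · have : coalescenceSum s c N t J τ = 0 := by
      rw [coalescenceSum, ENNReal.tsum_eq_zero]
      intro P
      rw [weight]
      split_ifs
      · have : (living τ t \ P).encard = ⊤ := by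
          rw [Set.encard_eq_top_iff]
          exact Set.Infinite.sdiff hfin P.finite_toSet
        rw [this, epow_top, mul_zero]
      · rw [mul_zero]
    rw [this, mul_zero]
    exact zero_le_one

theorem measurable_sizeWeight_right (s : ℝ≥0∞) (t : ℝ) :
    Measurable fun τ => sizeWeight s t τ :=
  (measurable_sizeWeight s).comp (measurable_prodMk_left (x := t))

theorem measurable_coalescenceSum_right (s : ℝ≥0∞) (c : ℕ → ℝ) (N : ℕ) (t : ℝ) (J : Finset ℕ) :
    Measurable fun τ => coalescenceSum s c N t J τ :=
  Measurable.of_uncurry_left (f := fun t τ => coalescenceSum s c N t J τ)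
    (measurable_coalescenceSum s c N J)

section Gen

variable (μ : Measure ℕ) [IsFiniteMeasure μ] [NeZero μ]

/-- The generating function of the size of a family. -/
def sizeGen (s : ℝ≥0∞) (t : ℝ) : ℝ≥0∞ := ∫⁻ τ, sizeWeight s t τ ∂treeLaw μ

/-- The expectation of `coalescenceSum`. -/
def coalescenceGen (s : ℝ≥0∞) (c : ℕ → ℝ) (N : ℕ) (t : ℝ) (J : Finset ℕ) : ℝ≥0∞ :=
  ∫⁻ τ, coalescenceSum s c N t J τ ∂treeLaw μ

variable {s : ℝ≥0∞}

theorem measurable_sizeGen : Measurable (sizeGen μ s) :=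
  (measurable_sizeWeight s).lintegral_prod_right'

theorem measurable_coalescenceGen {c : ℕ → ℝ} {N : ℕ} {J : Finset ℕ} :
    Measurable fun t => coalescenceGen μ s c N t J :=
  (measurable_coalescenceSum s c N J).lintegral_prod_right'

theorem sizeGen_le_one (hs : s ≤ 1) (t : ℝ) : sizeGen μ s t ≤ 1 := by
  calc sizeGen μ s t ≤ ∫⁻ _, 1 ∂treeLaw μ := lintegral_mono fun τ => epow_le_one hs _
    _ = 1 := by simp

theorem mul_coalescenceGen_le_one (hs : s ≤ 1) {c : ℕ → ℝ} (hc0 : c 0 = 0) {N : ℕ}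
    {J : Finset ℕ} (hJ : ∀ j ∈ J, j < N) (t : ℝ) :
    (1 - s) ^ (J.card + 1) * coalescenceGen μ s c N t J ≤ 1 := by
  rw [coalescenceGen, ← lintegral_const_mul]
  · calc _ ≤ ∫⁻ _, 1 ∂treeLaw μ :=
        lintegral_mono fun τ => mul_coalescenceSum_le_one hs hc0 hJ t τ
      _ = 1 := by simp
  · exact measurable_coalescenceSum_right s c N t J

theorem coalescenceGen_ne_top (hs : s < 1) {c : ℕ → ℝ} (hc0 : c 0 = 0) {N : ℕ}
    {J : Finset ℕ} (hJ : ∀ j ∈ J, j < N) (t : ℝ) : coalescenceGen μ s c N t J ≠ ⊤ := by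
  intro h
  have := mul_coalescenceGen_le_one μ hs.le hc0 hJ t
  rw [h, ENNReal.mul_top (pow_ne_zero _ (tsub_pos_of_lt hs).ne')] at this
  simp at this

/-- Conditioning on the mark of the founder: either it still lives and the size is 1, or its `a.2`
children have independent families of age `t - a.1`. -/
theorem sizeGen_renewal {t : ℝ} (ht : 0 ≤ t) :
    sizeGen μ s t = ∫⁻ a, (if t < a.1 then s else sizeGen μ s (t - a.1) ^ a.2) ∂markLaw μ := by
  rw [sizeGen, lintegral_treeLaw μ (measurable_sizeWeight_right s t)]
  refine lintegral_congr_ae ?_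
  filter_upwards [ae_markLaw_nonneg μ] with a ha
  have hae : (fun ω => sizeWeight s t (join a ω)) =ᵐ[law μ] fun ω => if t < a.1 then s else
      ∏ i ∈ Finset.range a.2, sizeWeight s (t - a.1) (branch ω i) := by
    filter_upwards [ae_law_nonneg μ] with ω hω
    split_ifs with h
    · exact sizeWeight_of_lt s (join_nonneg ha hω) ht (by simpa using h)
    · have := sizeWeight_eq_prod s (τ := join a ω) (t := t) (by simpa using h)
      simpa using this
  refine (lintegral_congr_ae hae).trans ?_
  split_ifs with h
  · simp
  · rw [lintegral_prod_branch μ _ fun _ => measurable_sizeWeight_right s (t - a.1)]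
    simp [sizeGen]

theorem lintegral_mul_prod_erase {F G : Tree → ℝ≥0∞} (hF : Measurable F) (hG : Measurable G)
    {i k : ℕ} (hi : i < k) :
    ∫⁻ ω, F (branch ω i) * ∏ a ∈ (Finset.range k).erase i, G (branch ω a) ∂law μ =
      (∫⁻ τ, F τ ∂treeLaw μ) * (∫⁻ τ, G τ ∂treeLaw μ) ^ (k - 1) := by
  have key := lintegral_prod_branch μ (Finset.range k) (F := fun a => if a = i then F else G)
    (fun a => by split_ifs; exacts [hF, hG])
  have hi' := Finset.mem_range.2 hi
  simp_rw [← Finset.mul_prod_erase _ _ hi', if_true] at key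
  rw [Finset.prod_congr rfl (g := fun _ => ∫⁻ τ, G τ ∂treeLaw μ), Finset.prod_const,
    Finset.card_erase_of_mem hi', Finset.card_range] at key
  · rw [← key]
    refine lintegral_congr fun ω => ?_
    congr 1
    exact Finset.prod_congr rfl fun a ha => by rw [if_neg (Finset.ne_of_mem_erase ha)]
  · intro a ha
    rw [if_neg (Finset.ne_of_mem_erase ha)]

theorem lintegral_mul_mul_prod_erase {F₁ F₂ G : Tree → ℝ≥0∞} (hF₁ : Measurable F₁)
    (hF₂ : Measurable F₂) (hG : Measurable G) {i j k : ℕ} (hij : i < j) (hj : j < k) :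
    ∫⁻ ω, F₁ (branch ω i) * F₂ (branch ω j) *
        ∏ a ∈ ((Finset.range k).erase j).erase i, G (branch ω a) ∂law μ =
      (∫⁻ τ, F₁ τ ∂treeLaw μ) * (∫⁻ τ, F₂ τ ∂treeLaw μ) * (∫⁻ τ, G τ ∂treeLaw μ) ^ (k - 2) := by
  have key := lintegral_prod_branch μ (Finset.range k)
    (F := fun a => if a = i then F₁ else if a = j then F₂ else G)
    (fun a => by split_ifs; exacts [hF₁, hF₂, hG])
  have hj' := Finset.mem_range.2 hj
  have hi' : i ∈ (Finset.range k).erase j :=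
    Finset.mem_erase.2 ⟨hij.ne, Finset.mem_range.2 (hij.trans hj)⟩
  simp_rw [← Finset.mul_prod_erase _ _ hj', ← Finset.mul_prod_erase _ _ hi', if_true,
    if_neg hij.ne'] at key
  rw [Finset.prod_congr rfl (g := fun _ => ∫⁻ τ, G τ ∂treeLaw μ), Finset.prod_const,
    Finset.card_erase_of_mem hi', Finset.card_erase_of_mem hj', Finset.card_range,
    Nat.sub_sub] at key
  · rw [mul_comm (∫⁻ τ, F₁ τ ∂treeLaw μ), mul_assoc, ← key]
    refine lintegral_congr fun ω => ?_
    rw [mul_comm (F₁ (branch ω i)), mul_assoc]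
    congr 2
    exact Finset.prod_congr rfl fun a ha => by
      rw [if_neg (Finset.ne_of_mem_erase ha),
        if_neg (Finset.ne_of_mem_erase (Finset.mem_of_mem_erase ha))]
  · intro a ha
    rw [if_neg (Finset.ne_of_mem_erase ha),
      if_neg (Finset.ne_of_mem_erase (Finset.mem_of_mem_erase ha))]

theorem sum_range_cast_mul (k : ℕ) (x : ℝ≥0∞) :
    ∑ j ∈ Finset.range k, ∑ _i ∈ Finset.range j, x = (k.choose 2 : ℝ≥0∞) * x := by
  simp only [Finset.sum_const, Finset.card_range, nsmul_eq_mul]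
  rw [← Finset.sum_mul, ← Nat.cast_sum, Finset.sum_range_id, Nat.choose_two_right]

/-- The rate at which two groups of lineages showing together the pattern `J` merge at time `u`. -/
def mergeGen (s : ℝ≥0∞) (c : ℕ → ℝ) (N : ℕ) (u : ℝ) (J : Finset ℕ) : ℝ≥0∞ :=
  ∑ m ∈ J, (Set.Ico (c m) (c (m + 1))).indicator 1 u * ∑ J₁ ∈ (J.erase m).powerset,
    coalescenceGen μ s c N u J₁ * coalescenceGen μ s c N u (J.erase m \ J₁)

theorem measurable_mergeGen {c : ℕ → ℝ} {N : ℕ} {J : Finset ℕ} :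
    Measurable fun t => mergeGen μ s c N t J :=
  Finset.measurable_sum _ fun _ _ => (measurable_one.indicator measurableSet_Ico).mul
    (Finset.measurable_sum _ fun _ _ =>
      (measurable_coalescenceGen μ).mul (measurable_coalescenceGen μ))

/-- Expectation of `coalescenceSum_of_le` given the mark `a` of the founder. Independence factorizes
every term, with `a.2` choices of one family and `a.2.choose 2` choices of two. -/
theorem coalescenceGen_renewal {c : ℕ → ℝ} (hc : Monotone c) (hc0 : c 0 = 0) {N : ℕ}
    {J : Finset ℕ} (hJ : ∀ j ∈ J, j < N) {t : ℝ} (ht : 0 ≤ t) :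
    coalescenceGen μ s c N t J = ∫⁻ a, (if t < a.1 then (if J = ∅ then 1 else 0) else
      a.2 * (coalescenceGen μ s c N (t - a.1) J * sizeGen μ s (t - a.1) ^ (a.2 - 1)) +
      a.2.choose 2 * (mergeGen μ s c N (t - a.1) J * sizeGen μ s (t - a.1) ^ (a.2 - 2)))
      ∂markLaw μ := by
  have hmeas : ∀ t J, Measurable fun τ => coalescenceSum s c N t J τ :=
    measurable_coalescenceSum_right s c N
  have hmeas' : ∀ t, Measurable fun τ => sizeWeight s t τ :=
    measurable_sizeWeight_right s
  rw [coalescenceGen, lintegral_treeLaw μ (hmeas t J)]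
  refine lintegral_congr_ae ?_
  filter_upwards [ae_markLaw_nonneg μ] with a ha
  split_ifs with h hJ0
  · rw [lintegral_congr_ae (g := fun _ => 1)]
    · simp
    · filter_upwards [ae_law_nonneg μ] with ω hω
      rw [coalescenceSum_of_lt s c N hJ (join_nonneg ha hω) ht (by simpa using h), if_pos hJ0]
  · rw [lintegral_congr_ae (g := fun _ => 0)]
    · simp
    · filter_upwards [ae_law_nonneg μ] with ω hω
      rw [coalescenceSum_of_lt s c N hJ (join_nonneg ha hω) ht (by simpa using h), if_neg hJ0]
  · set u := t - a.1 with hu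
    have hbr : ∀ J i, Measurable fun ω : Realization => coalescenceSum s c N u J (branch ω i) :=
      fun J i => (hmeas u J).comp (measurable_branch i)
    have hpr : ∀ I : Finset ℕ, Measurable fun ω : Realization =>
        ∏ b ∈ I, sizeWeight s u (branch ω b) := fun I =>
      Finset.measurable_prod _ fun b _ => (hmeas' u).comp (measurable_branch b)
    have hae : (fun ω => coalescenceSum s c N t J (join a ω)) =ᵐ[law μ] fun ω =>
        ∑ i ∈ Finset.range a.2, coalescenceSum s c N u J (branch ω i) *
          ∏ b ∈ (Finset.range a.2).erase i, sizeWeight s u (branch ω b) +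
        ∑ j ∈ Finset.range a.2, ∑ i ∈ Finset.range j,
          ∑ m ∈ J, (Set.Ico (c m) (c (m + 1))).indicator 1 u * ∑ J₁ ∈ (J.erase m).powerset,
            coalescenceSum s c N u J₁ (branch ω i) *
            coalescenceSum s c N u (J.erase m \ J₁) (branch ω j) *
            ∏ b ∈ ((Finset.range a.2).erase j).erase i, sizeWeight s u (branch ω b) := by
      filter_upwards [ae_law_nonneg μ] with ω hω
      have := coalescenceSum_of_le s N hc hc0 hJ (join_nonneg ha hω) (t := t)
        (by simpa using h)
      rw [offspring_join, join_nil, ← hu] at this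
      rw [this]
      congr 1
      refine Finset.sum_congr rfl fun j _ => Finset.sum_congr rfl fun i _ => ?_
      rw [Finset.sum_mul]
      refine Finset.sum_congr rfl fun m _ => ?_
      rw [mul_assoc, Finset.sum_mul]
    refine (lintegral_congr_ae hae).trans ?_
    have hm3 : ∀ i, Measurable fun ω : Realization => coalescenceSum s c N u J (branch ω i) *
        ∏ b ∈ (Finset.range a.2).erase i, sizeWeight s u (branch ω b) :=
      fun i => (hbr J i).mul (hpr _)
    rw [lintegral_add_left (Finset.measurable_sum _ fun i _ => hm3 i)]
    congr 1
    · rw [lintegral_finsetSum _ fun i _ => hm3 i,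
        Finset.sum_congr rfl fun i hi =>
          lintegral_mul_prod_erase μ (hmeas u J) (hmeas' u) (Finset.mem_range.1 hi),
        Finset.sum_const, Finset.card_range, nsmul_eq_mul]
      rfl
    · have hm2 : ∀ i j m J₁, Measurable fun ω : Realization =>
          coalescenceSum s c N u J₁ (branch ω i) *
            coalescenceSum s c N u (J.erase m \ J₁) (branch ω j) *
            ∏ b ∈ ((Finset.range a.2).erase j).erase i, sizeWeight s u (branch ω b) :=
        fun i j m J₁ => ((hbr _ i).mul (hbr _ j)).mul (hpr _)
      have hm1 : ∀ i j m, Measurable fun ω : Realization => ∑ J₁ ∈ (J.erase m).powerset,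
          coalescenceSum s c N u J₁ (branch ω i) *
            coalescenceSum s c N u (J.erase m \ J₁) (branch ω j) *
            ∏ b ∈ ((Finset.range a.2).erase j).erase i, sizeWeight s u (branch ω b) :=
        fun i j m => Finset.measurable_sum _ fun J₁ _ => hm2 i j m J₁
      have hm0 : ∀ i j, Measurable fun ω : Realization => ∑ m ∈ J,
          (Set.Ico (c m) (c (m + 1))).indicator 1 u * ∑ J₁ ∈ (J.erase m).powerset,
          coalescenceSum s c N u J₁ (branch ω i) *
            coalescenceSum s c N u (J.erase m \ J₁) (branch ω j) *
            ∏ b ∈ ((Finset.range a.2).erase j).erase i, sizeWeight s u (branch ω b) :=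
        fun i j => Finset.measurable_sum _ fun m _ => (hm1 i j m).const_mul _
      rw [← sum_range_cast_mul,
        lintegral_finsetSum _ fun j _ => Finset.measurable_sum _ fun i _ => hm0 i j]
      refine Finset.sum_congr rfl fun j hj => ?_
      rw [lintegral_finsetSum _ fun i _ => hm0 i j]
      refine Finset.sum_congr rfl fun i hi => ?_
      rw [lintegral_finsetSum _ fun m _ => (hm1 i j m).const_mul _, mergeGen, Finset.sum_mul]
      refine Finset.sum_congr rfl fun m _ => ?_
      rw [lintegral_const_mul _ (hm1 i j m), lintegral_finsetSum _ fun J₁ _ => hm2 i j m J₁,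
        mul_assoc, Finset.sum_mul]
      congr 1
      refine Finset.sum_congr rfl fun J₁ _ => ?_
      rw [lintegral_mul_mul_prod_erase μ (hmeas u _) (hmeas u _) (hmeas' u)
        (Finset.mem_range.1 hi) (Finset.mem_range.1 hj)]
      rfl

/-- The total mass in the exponential density cancels the normalization of the offspring law, so
only the unnormalized `μ` remains. -/
theorem lintegral_markLaw {f : ℝ × ℕ → ℝ≥0∞} (hf : Measurable f) :
    ∫⁻ a, f a ∂markLaw μ = ∫⁻ w in Set.Ici 0,
      ENNReal.ofReal (Real.exp (-(μ.real Set.univ * w))) * ∑' k, f (w, k) * μ {k} := by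
  have hu : μ Set.univ ≠ 0 := by simpa using NeZero.ne μ
  have hr : 0 < μ.real Set.univ := ENNReal.toReal_pos hu (measure_ne_top μ _)
  have hmeas : Measurable fun w => ∑' k, f (w, k) * μ {k} := by
    refine Measurable.tsum fun k => ?_
    exact (hf.comp (measurable_id.prodMk measurable_const)).mul_const _
  have : SFinite ((μ Set.univ)⁻¹ • μ) := inferInstance
  rw [markLaw, lintegral_prod _ hf.aemeasurable]
  simp_rw [lintegral_smul_measure, lintegral_countable', smul_eq_mul]
  change ∫⁻ w, _ ∂(volume.withDensity (exponentialPDF (μ.real Set.univ))) = _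
  have hpdf : Measurable (exponentialPDF (μ.real Set.univ)) :=
    (measurable_exponentialPDFReal _).ennreal_ofReal
  rw [lintegral_withDensity_eq_lintegral_mul _ hpdf (hmeas.const_mul _),
    ← lintegral_indicator measurableSet_Ici]
  refine lintegral_congr fun w => ?_
  rw [Pi.mul_apply]
  by_cases hw : 0 ≤ w
  · rw [Set.indicator_of_mem (show w ∈ Set.Ici 0 from hw), exponentialPDF_of_nonneg hw,
      ENNReal.ofReal_mul hr.le, ofReal_measureReal (measure_ne_top μ _), ← mul_assoc]
    congr 1
    rw [mul_comm (μ Set.univ), mul_assoc, ENNReal.mul_inv_cancel hu (measure_ne_top μ _), mul_one]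
  · rw [Set.indicator_of_notMem (show w ∉ Set.Ici 0 from hw), exponentialPDF_of_neg (not_le.1 hw),
      zero_mul]

theorem lintegral_exp_Ioi {r : ℝ} (hr : 0 < r) (t : ℝ) :
    ∫⁻ w in Set.Ioi t, ENNReal.ofReal (Real.exp (-(r * w))) =
      ENNReal.ofReal (Real.exp (-(r * t)) / r) := by
  have h1 := integral_exp_mul_Ioi (neg_lt_zero.2 hr) t
  have h2 := integrableOn_exp_mul_Ioi (neg_lt_zero.2 hr) t
  simp only [neg_mul] at h1 h2
  rw [← ofReal_integral_eq_lintegral_ofReal h2 (ae_of_all _ fun _ => (Real.exp_pos _).le), h1,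
    neg_div_neg_eq]

/-- The lifetime w is replaced by the remaining time u = t - w, which brings both renewal equations
into convolution form. -/
theorem lintegral_markLaw_ite (C : ℝ≥0∞) {g : ℝ → ℕ → ℝ≥0∞} (hg : ∀ k, Measurable fun u => g u k)
    {t : ℝ} (ht : 0 ≤ t) :
    ∫⁻ a, (if t < a.1 then C else g (t - a.1) a.2) ∂markLaw μ =
      C * ENNReal.ofReal (Real.exp (-(μ.real Set.univ * t))) +
      ∫⁻ u in Set.Icc 0 t, ENNReal.ofReal (Real.exp (-(μ.real Set.univ * (t - u)))) *
        ∑' k, g u k * μ {k} := by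
  have hu : μ Set.univ ≠ 0 := by simpa using NeZero.ne μ
  have hr : 0 < μ.real Set.univ := ENNReal.toReal_pos hu (measure_ne_top μ _)
  have hexp : Measurable fun w => ENNReal.ofReal (Real.exp (-(μ.real Set.univ * w))) := by
    fun_prop
  have hg' : Measurable fun p : ℝ × ℕ => g p.1 p.2 := measurable_from_prod_countable_left hg
  have hmeas : Measurable fun a : ℝ × ℕ => if t < a.1 then C else g (t - a.1) a.2 := by
    refine Measurable.ite (measurableSet_lt measurable_const measurable_fst) measurable_const ?_
    exact hg'.comp ((measurable_const.sub measurable_fst).prodMk measurable_snd)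
  rw [lintegral_markLaw μ hmeas]
  have hIci : Set.Ici (0 : ℝ) = Set.Icc 0 t ∪ Set.Ioi t := (Set.Icc_union_Ioi_eq_Ici ht).symm
  rw [hIci, lintegral_union measurableSet_Ioi
    (Set.disjoint_left.2 fun w h1 h2 => not_lt.2 h1.2 h2), add_comm]
  congr 1
  · rw [setLIntegral_congr_fun (g := fun w =>
      ENNReal.ofReal (Real.exp (-(μ.real Set.univ * w))) * (C * μ Set.univ)) measurableSet_Ioi,
      lintegral_mul_const _ hexp, lintegral_exp_Ioi hr, mul_comm, mul_assoc,
      ENNReal.ofReal_div_of_pos hr, ofReal_measureReal (measure_ne_top μ _),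
      ENNReal.mul_div_cancel hu (measure_ne_top μ _)]
    intro w hw
    simp only [if_pos (show t < w from hw), ENNReal.tsum_mul_left]
    congr 2
    have := lintegral_countable' (μ := μ) (fun _ => 1)
    simpa using this.symm
  · rw [← lintegral_indicator measurableSet_Icc, ← lintegral_indicator measurableSet_Icc,
      ← lintegral_sub_left_eq_self _ t]
    refine lintegral_congr fun w => ?_
    by_cases hw : w ∈ Set.Icc 0 t
    · have hw' : t - w ∈ Set.Icc 0 t := ⟨by linarith [hw.2], by linarith [hw.1]⟩
      rw [Set.indicator_of_mem hw, Set.indicator_of_mem hw']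
      simp only [not_lt.2 hw'.2, if_false, sub_sub_cancel]
    · have hw' : t - w ∉ Set.Icc 0 t := fun h => hw ⟨by linarith [h.2], by linarith [h.1]⟩
      rw [Set.indicator_of_notMem hw, Set.indicator_of_notMem hw']

end Gen

end BGW

/-! ### Solution of the recursive system of integral equations. -/

namespace BGW

section VariationOfConstants

open Filter Topology

/-- Intervals closed on the left have right-continuous indicators; hence all primitives below have
right derivatives at every point, which is enough for the uniqueness argument. -/
theorem continuousWithinAt_indicator_Ico (a b x : ℝ) :
    ContinuousWithinAt ((Set.Ico a b).indicator (1 : ℝ → ℝ)) (Set.Ici x) x := by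
  by_cases h : x ∈ Set.Ico a b
  · refine (continuousWithinAt_const (b := (1 : ℝ))).congr_of_eventuallyEq ?_ (by simp [h])
    filter_upwards [self_mem_nhdsWithin, mem_nhdsWithin_of_mem_nhds (Iio_mem_nhds h.2)] with y hy hyb
    rw [Set.indicator_of_mem (show y ∈ Set.Ico a b from ⟨h.1.trans hy, hyb⟩), Pi.one_apply]
  · refine (continuousWithinAt_const (b := (0 : ℝ))).congr_of_eventuallyEq ?_ (by simp [h])
    rcases lt_or_ge x a with hxa | hxa
    · filter_upwards [mem_nhdsWithin_of_mem_nhds (Iio_mem_nhds hxa)] with y hy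
      exact Set.indicator_of_notMem (fun h' => not_le.2 hy h'.1) _
    · have hb : b ≤ x := not_lt.1 fun hb => h ⟨hxa, hb⟩
      filter_upwards [self_mem_nhdsWithin] with y hy
      exact Set.indicator_of_notMem (fun h' => not_lt.2 (hb.trans hy) h'.2) _

/-- The subsets of each size m contribute |J| choose m times m! (|J| - m)!, which is |J|!, and there
are |J| + 1 sizes. -/
theorem sum_powerset_factorial (J : Finset ℕ) :
    ∑ J₁ ∈ J.powerset, ((J₁.card.factorial : ℝ) * ((J \ J₁).card.factorial : ℝ)) =
      ((J.card + 1).factorial : ℝ) := by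
  have h1 : ∀ J₁ ∈ J.powerset, ((J₁.card.factorial : ℝ) * ((J \ J₁).card.factorial : ℝ)) =
      (fun m => ((m.factorial : ℝ) * ((J.card - m).factorial : ℝ))) J₁.card := fun J₁ hJ₁ => by
    simp only [Finset.card_sdiff_of_subset (Finset.mem_powerset.1 hJ₁)]
  rw [Finset.sum_congr rfl h1, Finset.sum_powerset_apply_card
    (fun m => ((m.factorial : ℝ) * ((J.card - m).factorial : ℝ)))]
  have h2 : ∀ m ∈ Finset.range (J.card + 1),
      J.card.choose m • ((m.factorial : ℝ) * ((J.card - m).factorial : ℝ)) = J.card.factorial := by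
    intro m hm
    have := Nat.choose_mul_factorial_mul_factorial (Nat.lt_succ_iff.1 (Finset.mem_range.1 hm))
    rw [← this]
    push_cast
    rw [nsmul_eq_mul]
    ring
  rw [Finset.sum_congr rfl h2, Finset.sum_const, Finset.card_range, nsmul_eq_mul,
    Nat.factorial_succ]
  push_cast
  ring

variable {T : ℝ} {c : ℕ → ℝ} {E φ g : ℝ → ℝ} {h : Finset ℕ → ℝ → ℝ}

/-- The quadratic term in the recursion. -/
def mergeTerm (c : ℕ → ℝ) (h : Finset ℕ → ℝ → ℝ) (J : Finset ℕ) (u : ℝ) : ℝ :=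
  ∑ m ∈ J, (Set.Ico (c m) (c (m + 1))).indicator 1 u *
    ∑ J₁ ∈ (J.erase m).powerset, h J₁ u * h (J.erase m \ J₁) u

theorem hasDerivWithinAt_primitive {f : ℝ → ℝ} (hf : IntervalIntegrable f volume 0 T)
    (hm : Measurable f) {x : ℝ} (hx : x ∈ Set.Ico 0 T)
    (hcont : ContinuousWithinAt f (Set.Ici x) x) (C : ℝ) :
    HasDerivWithinAt (fun t => C + ∫ u in (0 : ℝ)..t, f u) (f x) (Set.Ici x) x := by
  have hint : IntervalIntegrable f volume 0 x := by
    refine hf.mono_set ?_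
    rw [Set.uIcc_of_le hx.1, Set.uIcc_of_le (hx.1.trans hx.2.le)]
    exact Set.Icc_subset_Icc_right hx.2.le
  exact (intervalIntegral.integral_hasDerivWithinAt_right hint
    (hm.stronglyMeasurable.stronglyMeasurableAtFilter)
    (hcont.mono Set.Ioi_subset_Ici_self)).const_add C

theorem continuousOn_primitive {f : ℝ → ℝ} (hf : IntervalIntegrable f volume 0 T) (hT : 0 ≤ T)
    (C : ℝ) : ContinuousOn (fun t => C + ∫ u in (0 : ℝ)..t, f u) (Set.Icc 0 T) := by
  refine continuousOn_const.add ?_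
  have := intervalIntegral.continuousOn_primitive_interval
    ((intervalIntegrable_iff' (μ := volume)).1 hf)
  rwa [Set.uIcc_of_le hT] at this

/-- The solution of the recursive system of integral equations for the coalescence densities. -/
theorem eq_factorial_mul_prod_of_renewal (hT : 0 ≤ T) {N : ℕ}
    (hE : ContinuousOn E (Set.Icc 0 T)) (hE0 : ∀ t, 0 < E t)
    (hφ : ContinuousOn φ (Set.Icc 0 T)) (hg : ContinuousOn g (Set.Icc 0 T))
    (hgm : Measurable g) (hhm : ∀ J, Measurable (h J))
    (hh : ∀ J ⊆ Finset.range N, ContinuousOn (h J) (Set.Icc 0 T))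
    {K : Finset ℕ → ℝ → ℝ} (hKm : ∀ J, Measurable (K J))
    (hKi : ∀ J ⊆ Finset.range N, IntervalIntegrable (K J) volume 0 T)
    (hK : ∀ J ⊆ Finset.range N, ∀ u ∈ Set.Icc 0 T,
      K J u = E u * (φ u * h J u + g u / 2 * mergeTerm c h J u))
    (heq : ∀ J ⊆ Finset.range N, ∀ t ∈ Set.Icc 0 T,
      E t * h J t = (if J = ∅ then 1 else 0) + ∫ u in (0 : ℝ)..t, K J u)
    (J : Finset ℕ) (hJ : J ⊆ Finset.range N) : ∀ t ∈ Set.Icc 0 T,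
      h J t = J.card.factorial / 2 ^ J.card * h ∅ t * ∏ j ∈ J,
        ∫ u in (0 : ℝ)..t, (Set.Ico (c j) (c (j + 1))).indicator 1 u * (h ∅ u * g u) := by
  induction J using Finset.strongInduction with
  | H J ih =>
  intro t ht
  set I : ℕ → ℝ → ℝ := fun j t =>
    ∫ u in (0 : ℝ)..t, (Set.Ico (c j) (c (j + 1))).indicator 1 u * (h ∅ u * g u) with hI
  by_cases hJ0 : J = ∅
  · subst hJ0; simp
  have right : ∀ {f : ℝ → ℝ} {x}, x ∈ Set.Ico 0 T → ContinuousOn f (Set.Icc 0 T) →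
      ContinuousWithinAt f (Set.Ici x) x := by
    intro f x hx hf
    have h1 := hf x ⟨hx.1, hx.2.le⟩
    refine h1.mono_of_mem_nhdsWithin ?_
    refine mem_of_superset (Icc_mem_nhdsGE hx.2) ?_
    exact Set.Icc_subset_Icc_left hx.1
  have hind : ∀ j, Measurable ((Set.Ico (c j) (c (j + 1))).indicator (1 : ℝ → ℝ)) := fun j =>
    measurable_one.indicator measurableSet_Ico
  have hIi : ∀ j, IntervalIntegrable
      (fun u => (Set.Ico (c j) (c (j + 1))).indicator 1 u * (h ∅ u * g u)) volume 0 T := by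
    intro j
    have h1 : IntervalIntegrable (fun u => h ∅ u * g u) volume 0 T := by
      refine ContinuousOn.intervalIntegrable ?_
      rw [Set.uIcc_of_le hT]
      exact (hh ∅ (Finset.empty_subset _)).mul hg
    refine h1.mono_fun ((hind j).mul ((hhm ∅).mul hgm)).aestronglyMeasurable
      (ae_of_all _ fun u => ?_)
    simp only [norm_mul]
    by_cases hu : u ∈ Set.Ico (c j) (c (j + 1))
    · simp [hu]
    · simp only [Set.indicator_of_notMem hu, norm_zero, zero_mul]
      positivity
  have hIc : ∀ j, ContinuousOn (I j) (Set.Icc 0 T) := fun j => by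
    simpa using continuousOn_primitive (hIi j) hT 0
  have hId : ∀ j, ∀ x ∈ Set.Ico 0 T, HasDerivWithinAt (I j)
      ((Set.Ico (c j) (c (j + 1))).indicator 1 x * (h ∅ x * g x)) (Set.Ici x) x := by
    intro j x hx
    have := hasDerivWithinAt_primitive (hIi j) ((hind j).mul ((hhm ∅).mul hgm)) hx
      ((continuousWithinAt_indicator_Ico _ _ x).mul
        ((right hx (hh ∅ (Finset.empty_subset _))).mul (right hx hg))) 0
    simpa using this
  have hKr : ∀ J' ⊆ Finset.range N, ∀ x ∈ Set.Ico 0 T,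
      ContinuousWithinAt (K J') (Set.Ici x) x := by
    intro J' hJ' x hx
    have h1 : ContinuousWithinAt (fun u => E u * (φ u * h J' u + g u / 2 * mergeTerm c h J' u))
        (Set.Ici x) x := by
      refine (right hx hE).mul (((right hx hφ).mul (right hx (hh J' hJ'))).add
        (((right hx hg).div_const 2).mul ?_))
      refine tendsto_finsetSum _ fun m hm => ?_
      refine (continuousWithinAt_indicator_Ico _ _ x).mul ?_
      refine tendsto_finsetSum _ fun J₁ hJ₁ => ?_
      have e1 : J₁ ⊆ Finset.range N :=
        (Finset.mem_powerset.1 hJ₁).trans ((Finset.erase_subset _ _).trans hJ')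
      have e2 : J'.erase m \ J₁ ⊆ Finset.range N :=
        Finset.sdiff_subset.trans ((Finset.erase_subset _ _).trans hJ')
      exact (right hx (hh _ e1)).mul (right hx (hh _ e2))
    refine h1.congr_of_eventuallyEq ?_ (hK J' hJ' x ⟨hx.1, hx.2.le⟩)
    filter_upwards [Icc_mem_nhdsGE hx.2] with u hu
    exact hK J' hJ' u ⟨hx.1.trans hu.1, hu.2⟩
  have hEh : ∀ J' ⊆ Finset.range N, ∀ x ∈ Set.Ico 0 T,
      HasDerivWithinAt (fun t => E t * h J' t) (K J' x) (Set.Ici x) x := by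
    intro J' hJ' x hx
    have h1 := hasDerivWithinAt_primitive (hKi J' hJ') (hKm J') hx (hKr J' hJ' x hx)
      (if J' = ∅ then 1 else 0)
    refine h1.congr_of_eventuallyEq ?_ (heq J' hJ' x ⟨hx.1, hx.2.le⟩)
    filter_upwards [Icc_mem_nhdsGE hx.2] with u hu
    exact heq J' hJ' u ⟨hx.1.trans hu.1, hu.2⟩
  set C : ℝ := J.card.factorial / 2 ^ J.card with hC
  -- The defect of the claimed formula, times the integrating factor. The merger terms will cancel,
  -- leaving D' = φ D.
  set D : ℝ → ℝ := fun t => E t * h J t - C * (E t * h ∅ t * ∏ j ∈ J, I j t) with hD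
  have hDc : ContinuousOn D (Set.Icc 0 T) := by
    refine (hE.mul (hh J hJ)).sub (continuousOn_const.mul
      ((hE.mul (hh ∅ (Finset.empty_subset _))).mul ?_))
    exact continuousOn_finsetProd _ fun j _ => hIc j
  have hDd : ∀ x ∈ Set.Ico 0 T, HasDerivWithinAt D (φ x * D x) (Set.Ici x) x := by
    intro x hx
    have hx' : x ∈ Set.Icc 0 T := ⟨hx.1, hx.2.le⟩
    have hprod := HasDerivWithinAt.fun_finsetProd (u := J) fun j _ => hId j x hx
    have hd := (hEh J hJ x hx).sub
      (((hEh ∅ (Finset.empty_subset _) x hx).mul hprod).const_mul C)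
    refine hd.congr_deriv ?_
    rw [hK J hJ x hx', hK ∅ (Finset.empty_subset _) x hx']
    -- By induction each product of two smaller solutions is |J₁|! |J₂|! times a factor that does
    -- not depend on the splitting, so `sum_powerset_factorial` sums them. The factor 1/2 of `g`
    -- supplies the missing power of 2.
    have hmerge : g x / 2 * mergeTerm c h J x =
        C * h ∅ x * ∑ m ∈ J, (∏ j ∈ J.erase m, I j x) •
          ((Set.Ico (c m) (c (m + 1))).indicator 1 x * (h ∅ x * g x)) := by
      rw [mergeTerm, Finset.mul_sum, Finset.mul_sum]
      refine Finset.sum_congr rfl fun m hm => ?_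
      have hlt : ∀ J' ⊆ J.erase m, J' ⊂ J := fun J' hJ' =>
        lt_of_le_of_lt hJ' (Finset.erase_ssubset hm)
      have hterm : ∀ J₁ ∈ (J.erase m).powerset, h J₁ x * h (J.erase m \ J₁) x =
          (J₁.card.factorial : ℝ) * ((J.erase m \ J₁).card.factorial : ℝ) *
            (h ∅ x ^ 2 / 2 ^ (J.erase m).card * ∏ j ∈ J.erase m, I j x) := by
        intro J₁ hJ₁
        rw [Finset.mem_powerset] at hJ₁
        rw [ih J₁ (hlt _ hJ₁) ((hlt _ hJ₁).subset.trans hJ) x hx',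
          ih _ (hlt _ Finset.sdiff_subset)
            ((hlt _ Finset.sdiff_subset).subset.trans hJ) x hx',
          ← Finset.prod_sdiff hJ₁]
        have hpow : (2 : ℝ) ^ (J.erase m).card = 2 ^ J₁.card * 2 ^ (J.erase m \ J₁).card := by
          rw [← pow_add, ← Finset.card_sdiff_add_card_eq_card hJ₁, add_comm]
        rw [hpow]
        simp only [hI]
        field_simp
      rw [Finset.sum_congr rfl hterm, ← Finset.sum_mul, sum_powerset_factorial,
        Finset.card_erase_add_one hm, smul_eq_mul, hC]
      have hpow : (2 : ℝ) ^ J.card = 2 ^ (J.erase m).card * 2 := by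
        rw [← pow_succ, Finset.card_erase_add_one hm]
      rw [hpow]
      field_simp
    rw [mul_add, hmerge]
    simp only [mergeTerm, Finset.sum_empty, hD]
    ring
  -- Here `J` is nonempty, so the integral equation has constant term 0, and the product contains an
  -- integral from 0 to 0.
  have hD0 : D 0 = 0 := by
    have h0 : (0 : ℝ) ∈ Set.Icc 0 T := ⟨le_rfl, hT⟩
    obtain ⟨j, hj⟩ := Finset.nonempty_iff_ne_empty.2 hJ0
    have : ∏ j ∈ J, I j 0 = 0 := Finset.prod_eq_zero hj (by simp [hI])
    simp only [hD, this, heq J hJ 0 h0, if_neg hJ0, intervalIntegral.integral_same]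
    ring
  -- A bound for φ is the Lipschitz constant in Gronwall's inequality, which forces D = 0.
  obtain ⟨B, hB⟩ := isCompact_Icc.exists_bound_of_continuousOn hφ
  have hzero := eq_zero_of_abs_deriv_le_mul_abs_self_of_eq_zero_right hDc hDd hD0
    (K := B) (fun x hx => by
      rw [norm_mul]
      exact mul_le_mul_of_nonneg_right (hB x ⟨hx.1, hx.2.le⟩) (norm_nonneg _)) t ht
  have : E t * h J t = E t * (C * h ∅ t * ∏ j ∈ J, I j t) := by
    simp only [hD] at hzero
    linear_combination hzero
  exact mul_left_cancel₀ (hE0 t).ne' this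

end VariationOfConstants

end BGW

/-! ### Power series of `μ`, and real-valued renewal equations. -/

namespace BGW

attribute [local instance] isProbabilityMeasure_markLaw isProbabilityMeasure_law_of_neZero

/-- The sum of a power series. -/
def powSum (a : ℕ → ℝ) (z : ℝ) : ℝ := ∑' k, a k * z ^ k

/-- A common majorant for the first two derivatives of the generating function of `μ`. -/
theorem summable_quadratic_mul_pow (C : ℝ) {r : ℝ} (hr0 : 0 ≤ r) (hr : r < 1) :
    Summable fun k : ℕ => C * ((k : ℝ) + 2) ^ 2 * r ^ k := by
  have hn : ‖r‖ < 1 := by rwa [Real.norm_of_nonneg hr0]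
  have h2 := summable_pow_mul_geometric_of_norm_lt_one 2 hn
  have h1 := summable_pow_mul_geometric_of_norm_lt_one 1 hn
  have h0 := summable_pow_mul_geometric_of_norm_lt_one 0 hn
  refine (((h2.add (h1.mul_left 4)).add (h0.mul_left 4)).mul_left C).congr fun k => ?_
  ring

theorem summable_powSum {a : ℕ → ℝ} {C : ℝ} (ha : ∀ k, |a k| ≤ C * ((k : ℝ) + 2) ^ 2) {z : ℝ}
    (hz0 : 0 ≤ z) (hz : z < 1) : Summable fun k => a k * z ^ k := by
  refine Summable.of_norm_bounded (summable_quadratic_mul_pow C hz0 hz) fun k => ?_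
  rw [norm_mul, Real.norm_eq_abs, Real.norm_of_nonneg (pow_nonneg hz0 k)]
  exact mul_le_mul_of_nonneg_right (ha k) (pow_nonneg hz0 k)

theorem continuousOn_powSum {a : ℕ → ℝ} {C : ℝ} (ha : ∀ k, |a k| ≤ C * ((k : ℝ) + 2) ^ 2) {r : ℝ}
    (hr : r < 1) : ContinuousOn (powSum a) (Set.Icc 0 r) := by
  rcases lt_or_ge r 0 with h0 | h0
  · rw [Set.Icc_eq_empty (not_le.2 h0)]
    exact continuousOn_empty _
  refine continuousOn_tsum (fun k => by fun_prop) (summable_quadratic_mul_pow C h0 hr) ?_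
  intro k z hz
  rw [norm_mul, Real.norm_eq_abs, Real.norm_of_nonneg (pow_nonneg hz.1 k)]
  exact mul_le_mul (ha k) (pow_le_pow_left₀ hz.1 hz.2 k) (pow_nonneg hz.1 k)
    ((abs_nonneg _).trans (ha k))

theorem measurable_powSum (a : ℕ → ℝ) : Measurable (powSum a) :=
  Measurable.tsum fun k => measurable_const.mul (measurable_id.pow_const k)

theorem ofReal_powSum {a : ℕ → ℝ} {C : ℝ} (ha0 : ∀ k, 0 ≤ a k)
    (ha : ∀ k, |a k| ≤ C * ((k : ℝ) + 2) ^ 2) {z : ℝ} (hz0 : 0 ≤ z) (hz : z < 1) :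
    ENNReal.ofReal (powSum a z) = ∑' k, ENNReal.ofReal (a k) * ENNReal.ofReal z ^ k := by
  rw [powSum, ENNReal.ofReal_tsum_of_nonneg (fun k => mul_nonneg (ha0 k) (pow_nonneg hz0 k))
    (summable_powSum ha hz0 hz)]
  refine tsum_congr fun k => ?_
  rw [ENNReal.ofReal_mul (ha0 k), ENNReal.ofReal_pow hz0]

section Coefficients

variable (μ : Measure ℕ)

/-- The coefficients of the derivative of the generating function of `μ`. -/
def coeff₁ (k : ℕ) : ℝ := ((k : ℝ) + 1) * μ.real {k + 1}

/-- The coefficients of the second derivative of the generating function of `μ`. -/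
def coeff₂ (k : ℕ) : ℝ := ((k : ℝ) + 2) * ((k : ℝ) + 1) * μ.real {k + 2}

theorem coeff₁_nonneg (k : ℕ) : 0 ≤ coeff₁ μ k := by unfold coeff₁; positivity

theorem coeff₂_nonneg (k : ℕ) : 0 ≤ coeff₂ μ k := by unfold coeff₂; positivity

variable [IsFiniteMeasure μ]

theorem coeff₁_le (k : ℕ) : |coeff₁ μ k| ≤ μ.real Set.univ * ((k : ℝ) + 2) ^ 2 := by
  rw [abs_of_nonneg (coeff₁_nonneg μ k), coeff₁, mul_comm]
  refine mul_le_mul (measureReal_mono (Set.subset_univ _)) ?_ (by positivity) (by positivity)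
  nlinarith [(Nat.cast_nonneg k : (0 : ℝ) ≤ k)]

theorem coeff₂_le (k : ℕ) : |coeff₂ μ k| ≤ μ.real Set.univ * ((k : ℝ) + 2) ^ 2 := by
  rw [abs_of_nonneg (coeff₂_nonneg μ k), coeff₂, mul_comm]
  refine mul_le_mul (measureReal_mono (Set.subset_univ _)) ?_ (by positivity) (by positivity)
  nlinarith [(Nat.cast_nonneg k : (0 : ℝ) ≤ k)]

/-- The truncated exponent `k - 1` at `k = 0` is harmless because of the factor `k`; dropping this
term shifts the index. -/
theorem ofReal_powSum_coeff₁ {z : ℝ} (hz0 : 0 ≤ z) (hz : z < 1) :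
    ∑' k : ℕ, (k : ℝ≥0∞) * ENNReal.ofReal z ^ (k - 1) * μ {k} =
      ENNReal.ofReal (powSum (coeff₁ μ) z) := by
  rw [ofReal_powSum (coeff₁_nonneg μ) (coeff₁_le μ) hz0 hz, tsum_eq_zero_add' ENNReal.summable]
  simp only [Nat.cast_zero, zero_mul, zero_add]
  refine tsum_congr fun k => ?_
  have h : ENNReal.ofReal (coeff₁ μ k) = ((k + 1 : ℕ) : ℝ≥0∞) * μ {k + 1} := by
    rw [coeff₁, ENNReal.ofReal_mul (by positivity), ofReal_measureReal (measure_ne_top μ _)]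
    congr 1
    rw [← ENNReal.ofReal_natCast]
    push_cast
    rfl
  rw [h, Nat.add_sub_cancel]
  ring

/-- The 1/2 comes from counting unordered pairs of children, k choose 2 = k(k - 1)/2. It is the
source of the power of 2 in the density. -/
theorem ofReal_powSum_coeff₂ {z : ℝ} (hz0 : 0 ≤ z) (hz : z < 1) :
    ∑' k : ℕ, (k.choose 2 : ℝ≥0∞) * ENNReal.ofReal z ^ (k - 2) * μ {k} =
      ENNReal.ofReal (powSum (coeff₂ μ) z / 2) := by
  rw [ENNReal.ofReal_div_of_pos two_pos,
    ofReal_powSum (coeff₂_nonneg μ) (coeff₂_le μ) hz0 hz, tsum_eq_zero_add' ENNReal.summable,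
    tsum_eq_zero_add' ENNReal.summable, ENNReal.div_eq_inv_mul, ← ENNReal.tsum_mul_left]
  simp only [Nat.choose_zero_succ, Nat.cast_zero, zero_mul, zero_add,
    Nat.choose_succ_self]
  refine tsum_congr fun k => ?_
  have h : ENNReal.ofReal (coeff₂ μ k) = 2 * (((k + 2).choose 2 : ℕ) : ℝ≥0∞) * μ {k + 2} := by
    rw [coeff₂, ENNReal.ofReal_mul (by positivity), ofReal_measureReal (measure_ne_top μ _)]
    congr 1
    rw [← ENNReal.ofReal_natCast, Nat.cast_choose_two, ← ENNReal.ofReal_ofNat 2,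
      ← ENNReal.ofReal_mul (by positivity)]
    congr 1
    push_cast
    ring
  rw [add_assoc, one_add_one_eq_two, h, Nat.add_sub_cancel, mul_assoc 2, ENNReal.ofReal_ofNat,
    mul_assoc 2, ← mul_assoc 2⁻¹, ENNReal.inv_mul_cancel two_ne_zero ENNReal.ofNat_ne_top, one_mul]
  ring

end Coefficients

/-- Multiplying by e^(rt) removes `t` from the kernel and turns the convolution into a primitive;
finiteness of `X` at `T` makes the integrand integrable. -/
theorem renewal_toReal {T r C : ℝ} (hT : 0 ≤ T) (hC : 0 ≤ C) {X G : ℝ → ℝ≥0∞} (hG : Measurable G)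
    (hGt : ∀ u ∈ Set.Icc 0 T, G u ≠ ⊤) (hXt : ∀ t ∈ Set.Icc 0 T, X t ≠ ⊤)
    (hX : ∀ t ∈ Set.Icc 0 T, X t = ENNReal.ofReal C * ENNReal.ofReal (Real.exp (-(r * t))) +
      ∫⁻ u in Set.Icc 0 t, ENNReal.ofReal (Real.exp (-(r * (t - u)))) * G u) :
    IntervalIntegrable (fun u => Real.exp (r * u) * (G u).toReal) volume 0 T ∧
    ∀ t ∈ Set.Icc 0 T, Real.exp (r * t) * (X t).toReal =
      C + ∫ u in (0 : ℝ)..t, Real.exp (r * u) * (G u).toReal := by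
  have hmeas : Measurable fun u => Real.exp (r * u) * (G u).toReal :=
    (by fun_prop : Measurable fun u => Real.exp (r * u)).mul hG.ennreal_toReal
  have key : ∀ t ∈ Set.Icc 0 T, ENNReal.ofReal (Real.exp (r * t)) * X t = ENNReal.ofReal C +
      ∫⁻ u in Set.Icc 0 t, ENNReal.ofReal (Real.exp (r * u) * (G u).toReal) := by
    intro t ht
    rw [hX t ht, mul_add, mul_left_comm, ← ENNReal.ofReal_mul (Real.exp_pos _).le, ← Real.exp_add,
      add_neg_cancel, Real.exp_zero, ENNReal.ofReal_one, mul_one,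
      ← lintegral_const_mul' _ _ ENNReal.ofReal_ne_top]
    congr 1
    refine setLIntegral_congr_fun measurableSet_Icc fun u hu => ?_
    rw [← mul_assoc, ← ENNReal.ofReal_mul (Real.exp_pos _).le, ← Real.exp_add,
      ENNReal.ofReal_mul (Real.exp_pos _).le,
      ENNReal.ofReal_toReal (hGt u ⟨hu.1, hu.2.trans ht.2⟩)]
    congr 3
    ring
  have hnn : ∀ u, 0 ≤ Real.exp (r * u) * (G u).toReal := fun u =>
    mul_nonneg (Real.exp_pos _).le ENNReal.toReal_nonneg
  have hfin : ∀ t ∈ Set.Icc 0 T,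
      ∫⁻ u in Set.Icc 0 t, ENNReal.ofReal (Real.exp (r * u) * (G u).toReal) ≠ ⊤ := by
    intro t ht h
    have := key t ht
    rw [h, add_top] at this
    exact ENNReal.mul_ne_top ENNReal.ofReal_ne_top (hXt t ht) this
  constructor
  · rw [intervalIntegrable_iff_integrableOn_Icc_of_le hT]
    refine ⟨hmeas.aestronglyMeasurable, ?_⟩
    rw [hasFiniteIntegral_iff_ofReal (ae_of_all _ hnn)]
    exact lt_top_iff_ne_top.2 (hfin T ⟨hT, le_rfl⟩)
  · intro t ht
    have h1 := congrArg ENNReal.toReal (key t ht)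
    rw [ENNReal.toReal_mul, ENNReal.toReal_ofReal (Real.exp_pos _).le,
      ENNReal.toReal_add ENNReal.ofReal_ne_top (hfin t ht), ENNReal.toReal_ofReal hC] at h1
    rw [h1, intervalIntegral.integral_of_le ht.1, ← integral_Icc_eq_integral_Ioc,
      integral_eq_lintegral_of_nonneg_ae (ae_of_all _ hnn) hmeas.aestronglyMeasurable]

theorem continuousOn_of_exp_mul_eq {T r C : ℝ} (hT : 0 ≤ T) {X : ℝ → ℝ} {f : ℝ → ℝ}
    (hf : IntervalIntegrable f volume 0 T)
    (h : ∀ t ∈ Set.Icc 0 T, Real.exp (r * t) * X t = C + ∫ u in (0 : ℝ)..t, f u) :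
    ContinuousOn X (Set.Icc 0 T) := by
  have h1 : ContinuousOn (fun t => Real.exp (-(r * t)) * (C + ∫ u in (0 : ℝ)..t, f u))
      (Set.Icc 0 T) :=
    (by fun_prop : Continuous fun t => Real.exp (-(r * t))).continuousOn.mul
      (continuousOn_primitive hf hT C)
  refine h1.congr fun t ht => ?_
  simp only
  rw [← h t ht, ← mul_assoc, ← Real.exp_add, neg_add_cancel, Real.exp_zero, one_mul]

section Real

variable (μ : Measure ℕ) [IsFiniteMeasure μ] [NeZero μ]
variable {s : ℝ≥0∞} {T : ℝ}

/-- The founder survives to time `t` with probability e^(-μ(ℕ)t), and then the weight is `s`; in the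
other case it is at most 1. This keeps ψ away from 1 uniformly on compact time intervals. -/
theorem sizeGen_add_le_one (hs : s ≤ 1) {t : ℝ} (ht : 0 ≤ t) :
    sizeGen μ s t + (1 - s) * ENNReal.ofReal (Real.exp (-(μ.real Set.univ * t))) ≤ 1 := by
  have h1 := lintegral_markLaw_ite μ s (g := fun _ _ => 1) (fun _ => measurable_const) ht
  have h2 := lintegral_markLaw_ite μ 1 (g := fun _ _ => 1) (fun _ => measurable_const) ht
  have h3 : sizeGen μ s t ≤ ∫⁻ a, (if t < a.1 then s else 1) ∂markLaw μ := by
    rw [sizeGen_renewal μ ht]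
    refine lintegral_mono fun a => ?_
    simp only
    split_ifs
    exacts [le_rfl, pow_le_one' (sizeGen_le_one μ hs _) _]
  calc _ ≤ _ := add_le_add_left h3 _
    _ = ∫⁻ a, (if t < a.1 then 1 else 1) ∂markLaw μ := by
        rw [h1, h2, add_right_comm, ← add_mul, add_tsub_cancel_of_le hs]
    _ = 1 := by simp

theorem sizeGen_toReal_le (hs : s ≤ 1) {t : ℝ} (ht : t ∈ Set.Icc 0 T) :
    (sizeGen μ s t).toReal ≤
      1 - (1 - s.toReal) * Real.exp (-(μ.real Set.univ * T)) := by
  have h1 := sizeGen_add_le_one μ hs ht.1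
  have hst : s ≠ ⊤ := ne_top_of_le_ne_top ENNReal.one_ne_top hs
  have h2 := ENNReal.toReal_mono ENNReal.one_ne_top h1
  have h3 : sizeGen μ s t ≠ ⊤ := ne_top_of_le_ne_top ENNReal.one_ne_top (sizeGen_le_one μ hs t)
  rw [ENNReal.toReal_add h3 (ENNReal.mul_ne_top (by simp) ENNReal.ofReal_ne_top),
    ENNReal.toReal_mul, ENNReal.toReal_ofReal (Real.exp_pos _).le,
    ENNReal.toReal_sub_of_le hs ENNReal.one_ne_top, ENNReal.toReal_one] at h2
  have h4 : Real.exp (-(μ.real Set.univ * T)) ≤ Real.exp (-(μ.real Set.univ * t)) := by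
    refine Real.exp_le_exp.2 (neg_le_neg (mul_le_mul_of_nonneg_left ht.2 measureReal_nonneg))
  have h5 : s.toReal ≤ 1 := by simpa using ENNReal.toReal_mono ENNReal.one_ne_top hs
  nlinarith [mul_le_mul_of_nonneg_left h4 (sub_nonneg.2 h5)]

theorem sizeGen_toReal_lt_one (hs : s < 1) {t : ℝ} (ht : 0 ≤ t) : (sizeGen μ s t).toReal < 1 := by
  have h1 := sizeGen_toReal_le μ hs.le (T := t) ⟨ht, le_rfl⟩
  have h2 : s.toReal < 1 := by
    simpa using (ENNReal.toReal_lt_toReal hs.ne_top ENNReal.one_ne_top).2 hs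
  nlinarith [Real.exp_pos (-(μ.real Set.univ * t))]

theorem ofReal_toReal_sizeGen (hs : s ≤ 1) (t : ℝ) :
    ENNReal.ofReal (sizeGen μ s t).toReal = sizeGen μ s t :=
  ENNReal.ofReal_toReal (ne_top_of_le_ne_top ENNReal.one_ne_top (sizeGen_le_one μ hs t))

/-- By the renewal equation ψ is an exponential times a primitive; its integrand is finite because
the inner sum is at most μ(ℕ). -/
theorem continuousOn_sizeGen (hs : s < 1) (hT : 0 ≤ T) :
    ContinuousOn (fun t => (sizeGen μ s t).toReal) (Set.Icc 0 T) := by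
  have hG : Measurable fun u => ∑' k, sizeGen μ s u ^ k * μ {k} :=
    Measurable.tsum fun k => ((measurable_sizeGen μ).pow_const k).mul_const _
  have hGt : ∀ u, ∑' k, sizeGen μ s u ^ k * μ {k} ≠ ⊤ := by
    intro u
    refine ne_top_of_le_ne_top (measure_ne_top μ Set.univ) ?_
    calc _ ≤ ∑' k, 1 * μ {k} := ENNReal.tsum_le_tsum fun k =>
          mul_le_mul_left (pow_le_one' (sizeGen_le_one μ hs.le _) _) _
      _ = μ Set.univ := by
          have := lintegral_countable' (μ := μ) (fun _ => 1)
          simpa using this.symm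
  have h := renewal_toReal (r := μ.real Set.univ) hT (ENNReal.toReal_nonneg (a := s)) hG
    (fun u _ => hGt u)
    (fun t _ => ne_top_of_le_ne_top ENNReal.one_ne_top (sizeGen_le_one μ hs.le t)) (by
      intro t ht
      rw [ENNReal.ofReal_toReal hs.ne_top, sizeGen_renewal μ ht.1]
      exact lintegral_markLaw_ite μ s (g := fun u k => sizeGen μ s u ^ k)
        (fun k => (measurable_sizeGen μ).pow_const k) ht.1)
  exact continuousOn_of_exp_mul_eq hT h.1 h.2

variable {c : ℕ → ℝ} {N : ℕ}

theorem mergeGen_ne_top (hc0 : c 0 = 0) (hs : s < 1) {J : Finset ℕ} (hJ : ∀ j ∈ J, j < N) (u : ℝ) :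
    mergeGen μ s c N u J ≠ ⊤ := by
  refine ENNReal.sum_ne_top.2 fun m _ => ENNReal.mul_ne_top ?_
    (ENNReal.sum_ne_top.2 fun J₁ hJ₁ => ENNReal.mul_ne_top ?_ ?_)
  · rw [Set.indicator_apply]; split_ifs <;> simp
  · exact coalescenceGen_ne_top μ hs hc0 (fun j hj =>
      hJ j (Finset.mem_of_mem_erase (Finset.mem_powerset.1 hJ₁ hj))) u
  · exact coalescenceGen_ne_top μ hs hc0 (fun j hj =>
      hJ j (Finset.mem_of_mem_erase (Finset.mem_sdiff.1 hj).1)) u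

theorem toReal_mergeGen (hc0 : c 0 = 0) (hs : s < 1) {J : Finset ℕ} (hJ : ∀ j ∈ J, j < N) (u : ℝ) :
    (mergeGen μ s c N u J).toReal =
      mergeTerm c (fun J t => (coalescenceGen μ s c N t J).toReal) J u := by
  have h1 : ∀ m, ∀ J₁ ∈ (J.erase m).powerset, coalescenceGen μ s c N u J₁ *
      coalescenceGen μ s c N u (J.erase m \ J₁) ≠ ⊤ := fun m J₁ hJ₁ =>
    ENNReal.mul_ne_top
      (coalescenceGen_ne_top μ hs hc0 (fun j hj =>
        hJ j (Finset.mem_of_mem_erase (Finset.mem_powerset.1 hJ₁ hj))) u)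
      (coalescenceGen_ne_top μ hs hc0 (fun j hj =>
        hJ j (Finset.mem_of_mem_erase (Finset.mem_sdiff.1 hj).1)) u)
  rw [mergeGen, ENNReal.toReal_sum, mergeTerm]
  · refine Finset.sum_congr rfl fun m _ => ?_
    rw [ENNReal.toReal_mul, ENNReal.toReal_sum (h1 m)]
    congr 1
    · rw [Set.indicator_apply, Set.indicator_apply]
      split_ifs <;> simp
    · exact Finset.sum_congr rfl fun J₁ _ => ENNReal.toReal_mul
  · intro m _
    refine ENNReal.mul_ne_top ?_ (ENNReal.sum_ne_top.2 (h1 m))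
    rw [Set.indicator_apply]; split_ifs <;> simp

/-- The expected coalescence sum as an explicit function of the first two generating functions. -/
theorem toReal_coalescenceGen (hc : Monotone c) (hc0 : c 0 = 0) (hs : s < 1) (hT : 0 ≤ T)
    {J : Finset ℕ} (hJ : J ⊆ Finset.range N) {t : ℝ} (ht : t ∈ Set.Icc 0 T) :
    (coalescenceGen μ s c N t J).toReal =
      J.card.factorial / 2 ^ J.card * (coalescenceGen μ s c N t ∅).toReal * ∏ j ∈ J,
        ∫ u in (0 : ℝ)..t, (Set.Ico (c j) (c (j + 1))).indicator 1 u *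
          ((coalescenceGen μ s c N u ∅).toReal *
            powSum (coeff₂ μ) (sizeGen μ s u).toReal) := by
  have hlt : ∀ {J}, J ⊆ Finset.range N → ∀ j ∈ J, j < N := fun h j hj => Finset.mem_range.1 (h hj)
  -- An upper bound below 1 for ψ on [0, T], so the power series of `μ` are only evaluated where
  -- they converge uniformly.
  set R := 1 - (1 - s.toReal) * Real.exp (-(μ.real Set.univ * T)) with hR
  have hR1 : R < 1 := by
    have h2 : s.toReal < 1 := by
      simpa using (ENNReal.toReal_lt_toReal hs.ne_top ENNReal.one_ne_top).2 hs
    nlinarith [Real.exp_pos (-(μ.real Set.univ * T))]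
  have hmaps : Set.MapsTo (fun t => (sizeGen μ s t).toReal) (Set.Icc 0 T) (Set.Icc 0 R) :=
    fun t ht => ⟨ENNReal.toReal_nonneg, sizeGen_toReal_le μ hs.le ht⟩
  have hq := continuousOn_sizeGen μ hs hT
  have hqm : Measurable fun t => (sizeGen μ s t).toReal := (measurable_sizeGen μ).ennreal_toReal
  set G : Finset ℕ → ℝ → ℝ≥0∞ := fun J u => ∑' k : ℕ,
    (k * (coalescenceGen μ s c N u J * sizeGen μ s u ^ (k - 1)) +
      k.choose 2 * (mergeGen μ s c N u J * sizeGen μ s u ^ (k - 2))) * μ {k} with hGdef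
  have hgk : ∀ J (k : ℕ), Measurable fun u =>
      k * (coalescenceGen μ s c N u J * sizeGen μ s u ^ (k - 1)) +
      k.choose 2 * (mergeGen μ s c N u J * sizeGen μ s u ^ (k - 2)) := fun J k =>
    (((measurable_coalescenceGen μ).mul ((measurable_sizeGen μ).pow_const _)).const_mul _).add
      (((measurable_mergeGen μ).mul ((measurable_sizeGen μ).pow_const _)).const_mul _)
  have hGm : ∀ J, Measurable (G J) := fun J => Measurable.tsum fun k => (hgk J k).mul_const _
  have hGeq : ∀ J, ∀ u ∈ Set.Icc 0 T, G J u =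
      coalescenceGen μ s c N u J *
        ENNReal.ofReal (powSum (coeff₁ μ) (sizeGen μ s u).toReal) +
      mergeGen μ s c N u J *
        ENNReal.ofReal (powSum (coeff₂ μ) (sizeGen μ s u).toReal / 2) := by
    intro J u hu
    have hlt1 := sizeGen_toReal_lt_one μ hs hu.1
    rw [← ofReal_powSum_coeff₁ μ ENNReal.toReal_nonneg hlt1,
      ← ofReal_powSum_coeff₂ μ ENNReal.toReal_nonneg hlt1, ofReal_toReal_sizeGen μ hs.le,
      ← ENNReal.tsum_mul_left, ← ENNReal.tsum_mul_left, ← ENNReal.tsum_add]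
    refine tsum_congr fun k => ?_
    ring
  have hGt : ∀ J ⊆ Finset.range N, ∀ u ∈ Set.Icc 0 T, G J u ≠ ⊤ := by
    intro J hJ u hu
    rw [hGeq J u hu]
    exact ENNReal.add_ne_top.2
      ⟨ENNReal.mul_ne_top (coalescenceGen_ne_top μ hs hc0 (hlt hJ) u) ENNReal.ofReal_ne_top,
      ENNReal.mul_ne_top (mergeGen_ne_top μ hc0 hs (hlt hJ) u) ENNReal.ofReal_ne_top⟩
  have hpow1 : ∀ {u : ℝ}, 0 ≤ powSum (coeff₁ μ) (sizeGen μ s u).toReal := fun {u} =>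
    tsum_nonneg fun k => mul_nonneg (coeff₁_nonneg μ k) (pow_nonneg ENNReal.toReal_nonneg _)
  have hpow2 : ∀ {u : ℝ}, 0 ≤ powSum (coeff₂ μ) (sizeGen μ s u).toReal := fun {u} =>
    tsum_nonneg fun k => mul_nonneg (coeff₂_nonneg μ k) (pow_nonneg ENNReal.toReal_nonneg _)
  have hGr : ∀ J ⊆ Finset.range N, ∀ u ∈ Set.Icc 0 T, (G J u).toReal =
      powSum (coeff₁ μ) (sizeGen μ s u).toReal * (coalescenceGen μ s c N u J).toReal +
      powSum (coeff₂ μ) (sizeGen μ s u).toReal / 2 *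
        mergeTerm c (fun J t => (coalescenceGen μ s c N t J).toReal) J u := by
    intro J hJ u hu
    rw [hGeq J u hu, ENNReal.toReal_add
      (ENNReal.mul_ne_top (coalescenceGen_ne_top μ hs hc0 (hlt hJ) u) ENNReal.ofReal_ne_top)
      (ENNReal.mul_ne_top (mergeGen_ne_top μ hc0 hs (hlt hJ) u) ENNReal.ofReal_ne_top),
      ENNReal.toReal_mul, ENNReal.toReal_mul, toReal_mergeGen μ hc0 hs (hlt hJ),
      ENNReal.toReal_ofReal hpow1, ENNReal.toReal_ofReal (div_nonneg hpow2 two_pos.le)]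
    ring
  have hren : ∀ J ⊆ Finset.range N, _ := fun J (hJ : J ⊆ Finset.range N) =>
    renewal_toReal (r := μ.real Set.univ) (C := if J = ∅ then 1 else 0) hT
      (by split_ifs <;> norm_num) (X := fun t => coalescenceGen μ s c N t J) (hGm J) (hGt J hJ)
      (fun t _ => coalescenceGen_ne_top μ hs hc0 (hlt hJ) t) (by
        intro t ht
        rw [coalescenceGen_renewal μ hc hc0 (hlt hJ) ht.1, lintegral_markLaw_ite μ _ (g := fun u k =>
          k * (coalescenceGen μ s c N u J * sizeGen μ s u ^ (k - 1)) +
          k.choose 2 * (mergeGen μ s c N u J * sizeGen μ s u ^ (k - 2))) (hgk J) ht.1]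
        congr 2
        split_ifs <;> simp)
  refine eq_factorial_mul_prod_of_renewal (N := N) (T := T)
    (E := fun t => Real.exp (μ.real Set.univ * t))
    (φ := fun u => powSum (coeff₁ μ) (sizeGen μ s u).toReal)
    (g := fun u => powSum (coeff₂ μ) (sizeGen μ s u).toReal)
    (h := fun J t => (coalescenceGen μ s c N t J).toReal)
    (K := fun J u => Real.exp (μ.real Set.univ * u) * (G J u).toReal) hT
    (by fun_prop) (fun t => Real.exp_pos _)
    ((continuousOn_powSum (coeff₁_le μ) hR1).comp hq hmaps)
    ((continuousOn_powSum (coeff₂_le μ) hR1).comp hq hmaps)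
    ((measurable_powSum _).comp hqm)
    (fun J => (measurable_coalescenceGen μ).ennreal_toReal)
    (fun J hJ => continuousOn_of_exp_mul_eq hT (hren J hJ).1 (hren J hJ).2)
    (fun J => (by fun_prop : Measurable fun u => Real.exp (μ.real Set.univ * u)).mul
      (hGm J).ennreal_toReal)
    (fun J hJ => (hren J hJ).1)
    (fun J hJ u hu => by rw [hGr J hJ u hu])
    (fun J hJ t ht => (hren J hJ).2 t ht) J hJ t ht

end Real

end BGW

/-! ### The generating function ψ and its derivative in s. -/

namespace BGW

attribute [local instance] isProbabilityMeasure_markLaw isProbabilityMeasure_law_of_neZero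

theorem Z_one_eq (r : ℝ) (ω : Realization) : Z 1 r ω = (living (branch ω 0) r).encard := by
  rw [← (Prod.mk_right_injective 0).encard_image, Z]
  refine congrArg Set.encard ?_
  ext ⟨i, l⟩
  rw [Set.mem_ofPred_eq, alive_iff]
  simp only [Nat.lt_one_iff, Set.mem_image, Prod.mk.injEq]
  constructor
  · rintro ⟨rfl, h⟩; exact ⟨l, h, rfl, rfl⟩
  · rintro ⟨l, h, rfl, rfl⟩; exact ⟨rfl, h⟩

section Size

/-- The distribution of the population size. -/
def sizeProb (μ : Measure ℕ) (r : ℝ) (k : ℕ) : ℝ := (law μ).real {ω | Z 1 r ω = k}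

theorem sizeProb_nonneg (μ : Measure ℕ) (r : ℝ) (k : ℕ) : 0 ≤ sizeProb μ r k := measureReal_nonneg

variable (μ : Measure ℕ) [IsFiniteMeasure μ] [NeZero μ]

theorem map_branch_zero : (law μ).map (fun ω => branch ω 0) = treeLaw μ := by
  rw [← Measure.infinitePi_map_eval (fun _ : ℕ => treeLaw μ) 0, ← map_branch,
    Measure.map_map (measurable_pi_apply 0)
      (measurable_pi_lambda _ fun i => measurable_branch i)]
  rfl

theorem measurable_encard_living (r : ℝ) : Measurable fun τ : Tree => (living τ r).encard :=
  measurable_encard fun l => measurable_prodMk_left (measurableSet_mem_living l)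

theorem ofReal_sizeProb (r : ℝ) (k : ℕ) :
    ENNReal.ofReal (sizeProb μ r k) = treeLaw μ {τ | (living τ r).encard = k} := by
  have hm : MeasurableSet {τ : Tree | (living τ r).encard = k} :=
    measurable_encard_living r (measurableSet_singleton (k : ℕ∞))
  rw [sizeProb, ofReal_measureReal (measure_ne_top _ _), ← map_branch_zero,
    Measure.map_apply (measurable_branch 0) hm]
  simp only [Z_one_eq]
  rfl

theorem sizeProb_le_one (r : ℝ) (k : ℕ) : sizeProb μ r k ≤ 1 := measureReal_le_one

/-- Because `F` vanishes at `⊤`, explosion contributes nothing and the sum runs over finite sizes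
only. -/
theorem lintegral_encard_living (r : ℝ) (F : ℕ∞ → ℝ≥0∞) (hF : F ⊤ = 0) :
    ∫⁻ τ, F (living τ r).encard ∂treeLaw μ =
      ∑' k : ℕ, ENNReal.ofReal (sizeProb μ r k) * F k := by
  rw [← lintegral_map (measurable_of_countable F) (measurable_encard_living r),
    lintegral_countable',
    ← (Nat.cast_injective (R := ℕ∞)).tsum_eq]
  · refine tsum_congr fun k => ?_
    rw [ofReal_sizeProb, Measure.map_apply (measurable_encard_living r)
      (measurableSet_singleton _), mul_comm]
    rfl
  · intro n hn
    induction n using ENat.recTopCoe with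
    | top => simp [hF] at hn
    | coe n => exact ⟨n, rfl⟩

variable {s : ℝ}

theorem psi_eq (hs0 : 0 ≤ s) (r : ℝ) :
    psi μ r s = (sizeGen μ (ENNReal.ofReal s) r).toReal := by
  unfold sizeGen sizeWeight
  rw [lintegral_encard_living μ r _ (epow_top _), ENNReal.tsum_toReal_eq]
  · refine tsum_congr fun k => ?_
    rw [epow_coe, ENNReal.toReal_mul, ENNReal.toReal_ofReal (sizeProb_nonneg μ r k),
      ENNReal.toReal_pow, ENNReal.toReal_ofReal hs0]
    rfl
  · intro k
    rw [epow_coe]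
    exact ENNReal.mul_ne_top ENNReal.ofReal_ne_top (ENNReal.pow_ne_top ENNReal.ofReal_ne_top)

theorem psi_nonneg (hs0 : 0 ≤ s) (r : ℝ) : 0 ≤ psi μ r s := by
  rw [psi_eq μ hs0]; exact ENNReal.toReal_nonneg

theorem psi_lt_one (hs0 : 0 ≤ s) (hs1 : s < 1) {r : ℝ} (hr : 0 ≤ r) : psi μ r s < 1 := by
  rw [psi_eq μ hs0]
  exact sizeGen_toReal_lt_one μ (by simpa using hs1) hr

/-- `n * s ^ (n - 1)` for an extended natural number `n`, with value `0` at `∞`. -/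
def epowDeriv (s : ℝ≥0∞) (n : ℕ∞) : ℝ≥0∞ := if n = ⊤ then 0 else n.toNat * s ^ (n.toNat - 1)

/-- Without mergers a set has one lineage already at look-back time 0, hence one member. Each of the
n singletons has weight s^(n-1), which is why ψ' appears. -/
theorem coalescenceSum_empty (s : ℝ≥0∞) {c : ℕ → ℝ} (hc0 : c 0 = 0) (N : ℕ) (t : ℝ) (τ : Tree) :
    coalescenceSum s c N t ∅ τ = epowDeriv s (living τ t).encard := by
  have hinj : Function.Injective (fun l : List ℕ => ({l} : Finset (List ℕ))) :=
    Finset.singleton_injective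
  rw [coalescenceSum, ← hinj.tsum_eq]
  · have hpat : ∀ l : List ℕ,
        patternIndicator N ∅ (fun i => lineages τ (t - c i) {l}) = 1 := by
      intro l
      have hlin : ∀ r, lineages τ r {l} = 1 := fun r => by simp [lineages]
      rw [patternIndicator, if_pos]
      exact ⟨hlin _, fun i _ => by simp [hlin]⟩
    simp only [hpat, one_mul]
    by_cases hfin : (living τ t).Finite
    · set L := hfin.toFinset with hL
      have hcoe : living τ t = (L : Set (List ℕ)) := by simp [hL]
      rw [tsum_eq_sum (s := L)]
      · rw [Finset.sum_congr rfl (g := fun _ => s ^ (L.card - 1)), Finset.sum_const, hcoe,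
          Set.encard_coe_eq_coe_finsetCard]
        · simp [epowDeriv]
        · intro l hl
          have hsub : ((({l} : Finset (List ℕ)) : Set (List ℕ))) ⊆ living τ t := by
            rw [hcoe]; simpa using hl
          rw [weight, if_pos hsub, hcoe, ← Finset.coe_sdiff, Set.encard_coe_eq_coe_finsetCard,
            epow_coe, Finset.card_sdiff_of_subset (by simpa using hl), Finset.card_singleton]
      · intro l hl
        refine if_neg fun h => hl ?_
        rw [hcoe] at h
        simpa using h
    · have h1 : (living τ t).encard = ⊤ := Set.encard_eq_top_iff.2 hfin
      rw [h1, epowDeriv, if_pos rfl]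
      rw [ENNReal.tsum_eq_zero]
      intro l
      rw [weight]
      split_ifs
      · have : (living τ t \ (({l} : Finset (List ℕ)) : Set (List ℕ))).encard = ⊤ := by
          rw [Set.encard_eq_top_iff]
          exact Set.Infinite.sdiff hfin (Finset.finite_toSet _)
        rw [this, epow_top]
      · rfl
  · intro P hP
    rw [Function.mem_support] at hP
    have hp : Pattern N ∅ (fun i => lineages τ (t - c i) P) := by
      by_contra hn
      exact hP (by rw [patternIndicator_of_not hn, zero_mul])
    have hsub : (P : Set (List ℕ)) ⊆ living τ t := by
      by_contra hn
      exact hP (by rw [weight, if_neg hn, mul_zero])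
    have hcard := hp.zero_eq (by simp)
    simp only [hc0, sub_zero, lineages_eq_card hsub, Finset.card_empty, zero_add] at hcard
    obtain ⟨l, hl⟩ := Finset.card_eq_one.1 hcard
    exact ⟨l, hl.symm⟩

theorem hasDerivAt_psi (hs0 : 0 ≤ s) (hs1 : s < 1) {c : ℕ → ℝ} (hc0 : c 0 = 0) (N : ℕ) (r : ℝ) :
    HasDerivAt (psi μ r) (coalescenceGen μ (ENNReal.ofReal s) c N r ∅).toReal s := by
  have h1 : (coalescenceGen μ (ENNReal.ofReal s) c N r ∅).toReal =
      ∑' k : ℕ, sizeProb μ r k * (k * s ^ (k - 1)) := by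
    unfold coalescenceGen
    rw [lintegral_congr fun τ => coalescenceSum_empty (ENNReal.ofReal s) hc0 N r τ,
      lintegral_encard_living μ r (epowDeriv _) (if_pos rfl), ENNReal.tsum_toReal_eq]
    · refine tsum_congr fun k => ?_
      simp [epowDeriv, ENNReal.toReal_ofReal (sizeProb_nonneg μ r k), ENNReal.toReal_ofReal hs0]
    · intro k
      simp only [epowDeriv, ENat.natCast_ne_top, if_false, ENat.toNat_natCast]
      exact ENNReal.mul_ne_top ENNReal.ofReal_ne_top (ENNReal.mul_ne_top (by simp)
        (ENNReal.pow_ne_top ENNReal.ofReal_ne_top))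
  rw [h1]
  -- The open ball of radius ρ around 0 contains `s`, even when `s = 0`, and carries the summable
  -- majorant k ρ^(k-1) of the derivatives.
  obtain ⟨ρ, hsρ, hρ1⟩ := exists_between hs1
  have hρ0 : 0 < ρ := hs0.trans_lt hsρ
  have hu : Summable fun k : ℕ => (k : ℝ) * ρ ^ (k - 1) := by
    have h := summable_pow_mul_geometric_of_norm_lt_one 1
      (show ‖ρ‖ < 1 by rwa [Real.norm_of_nonneg hρ0.le])
    refine (h.mul_left ρ⁻¹).congr fun k => ?_
    rcases k with _ | k
    · simp
    · rw [pow_one, Nat.add_sub_cancel, pow_succ]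
      field_simp
  have hs : s ∈ Metric.ball (0 : ℝ) ρ := by
    rw [mem_ball_zero_iff, Real.norm_of_nonneg hs0]; exact hsρ
  refine hasDerivAt_tsum_of_isPreconnected (g := fun (k : ℕ) z => sizeProb μ r k * z ^ k)
    (g' := fun (k : ℕ) z => sizeProb μ r k * (k * z ^ (k - 1))) hu Metric.isOpen_ball
    (convex_ball (0 : ℝ) ρ).isPreconnected ?_ ?_ (Metric.mem_ball_self hρ0) ?_ hs
  · intro k y _
    exact (hasDerivAt_pow k y).const_mul _
  · intro k y hy
    rw [mem_ball_zero_iff] at hy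
    rw [norm_mul, norm_mul, norm_pow, Real.norm_of_nonneg (sizeProb_nonneg μ r k), Real.norm_natCast]
    calc sizeProb μ r k * (k * ‖y‖ ^ (k - 1)) ≤ 1 * (k * ρ ^ (k - 1)) := by
          refine mul_le_mul (sizeProb_le_one μ r k) ?_ (by positivity) zero_le_one
          exact mul_le_mul_of_nonneg_left (pow_le_pow_left₀ (norm_nonneg _) hy.le _)
            (Nat.cast_nonneg k)
      _ = _ := one_mul _
  -- Convergence is needed at a single point of the ball; at 0 only the constant term survives.
  · refine summable_of_ne_finset_zero (s := {0}) fun k hk => ?_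
    rw [zero_pow (by simpa using hk), mul_zero]

/-- The density of a single coalescence time. -/
def coalescenceRate (s u : ℝ) : ℝ := deriv (psi μ u) s * powSum (coeff₂ μ) (psi μ u s)

theorem toReal_coalescenceGen_eq_psi (hs0 : 0 ≤ s) (hs1 : s < 1) {c : ℕ → ℝ} (hc : Monotone c)
    (hc0 : c 0 = 0) {N : ℕ} {J : Finset ℕ} (hJ : J ⊆ Finset.range N) {t : ℝ} (ht : 0 ≤ t) :
    (coalescenceGen μ (ENNReal.ofReal s) c N t J).toReal =
      J.card.factorial / 2 ^ J.card * deriv (psi μ t) s * ∏ j ∈ J,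
        ∫ u in (0 : ℝ)..t, (Set.Ico (c j) (c (j + 1))).indicator 1 u * coalescenceRate μ s u := by
  rw [toReal_coalescenceGen μ hc hc0 (by simpa using hs1) ht hJ ⟨ht, le_rfl⟩]
  simp only [(hasDerivAt_psi μ hs0 hs1 hc0 N _).deriv, coalescenceRate, psi_eq μ hs0]

end Size

end BGW

/-! ### Coalescence times in terms of lineage counts. -/

namespace BGW

section Ancestors

open Filter Topology

variable {τ : Tree}

theorem death_le_of_suffix (hτ : ∀ l, 0 ≤ (τ l).1) {m l : List ℕ} (h : m <:+ l) :
    treeBirth τ m + (τ m).1 ≤ treeBirth τ l + (τ l).1 := by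
  induction l with
  | nil => rw [List.suffix_nil.1 h]
  | cons j l ih =>
    rcases List.suffix_cons_iff.1 h with rfl | h
    · exact le_rfl
    · refine (ih h).trans ?_
      rw [treeBirth]
      linarith [hτ (j :: l)]

/-- Along an ancestral line each birth is the death of the parent, so the lifetimes tile the time
axis and exactly one member of the line lives at `r`. -/
theorem mem_living_and_suffix_iff (hτ : ∀ l, 0 ≤ (τ l).1) {r : ℝ} (hr : 0 ≤ r) {l : List ℕ}
    (hl : TreeMem τ l) (hd : r < treeBirth τ l + (τ l).1) (m : List ℕ) :
    m ∈ living τ r ∧ m <:+ l ↔ m = lastBorn τ r l := by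
  induction l with
  | nil =>
    rw [lastBorn, List.suffix_nil]
    constructor
    · exact fun h => h.2
    · rintro rfl
      refine ⟨(nil_mem_living _ _).2 ⟨hr, ?_⟩, rfl⟩
      simpa [treeBirth] using hd
  | cons j l ih =>
    rw [lastBorn, List.suffix_cons_iff]
    split_ifs with hb
    · constructor
      · rintro ⟨hm, rfl | hs⟩
        · rfl
        · have := death_le_of_suffix hτ hs
          rw [treeBirth] at hb
          linarith [hm.2.2]
      · rintro rfl
        exact ⟨⟨hl, hb, hd⟩, Or.inl rfl⟩
    · rw [treeBirth, not_le] at hb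
      rw [← ih hl.1 hb]
      refine and_congr_right fun hm => ⟨?_, Or.inr⟩
      rintro (rfl | hs)
      · have := hm.2.1
        rw [treeBirth] at this
        linarith
      · exact hs

/-- Being born by time `r` is a closed condition and an ancestral line is finite, so ancestral lines
are right-continuous in time. -/
theorem eventually_lastBorn_eq (τ : Tree) (r : ℝ) (l : List ℕ) :
    ∀ᶠ r' in 𝓝[≥] r, lastBorn τ r' l = lastBorn τ r l := by
  induction l with
  | nil => exact Eventually.of_forall fun _ => rfl
  | cons j l ih =>
    by_cases hb : treeBirth τ (j :: l) ≤ r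
    · filter_upwards [self_mem_nhdsWithin] with r' hr'
      rw [lastBorn, lastBorn, if_pos hb, if_pos (hb.trans hr')]
    · filter_upwards [ih, mem_nhdsWithin_of_mem_nhds (Iio_mem_nhds (not_le.1 hb))] with r' h1 h2
      rw [lastBorn, lastBorn, if_neg hb, if_neg (not_le.2 h2), h1]

theorem eventually_forestLineages_eq (ω : Realization) (r : ℝ) (P : Finset Individual) :
    ∀ᶠ r' in 𝓝[≥] r, forestLineages ω r' P = forestLineages ω r P := by
  have h : ∀ᶠ r' in 𝓝[≥] r, ∀ v ∈ P,
      lastBorn (branch ω v.1) r' v.2 = lastBorn (branch ω v.1) r v.2 :=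
    (Finset.eventually_all P).2 fun v _ => eventually_lastBorn_eq _ r v.2
  filter_upwards [h] with r' hr'
  rw [forestLineages, forestLineages]
  exact congrArg Finset.card (Finset.image_congr fun v hv => by simp only [hr' v hv])

theorem forestLineages_mono (ω : Realization) {r r' : ℝ} (h : r ≤ r') (P : Finset Individual) :
    forestLineages ω r P ≤ forestLineages ω r' P := by
  have : (P.image fun v => (v.1, lastBorn (branch ω v.1) r v.2)) =
      (P.image fun v => (v.1, lastBorn (branch ω v.1) r' v.2)).image
        fun v => (v.1, lastBorn (branch ω v.1) r v.2) := by
    rw [Finset.image_image]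
    exact Finset.image_congr fun v _ => by simp [lastBorn_lastBorn h]
  rw [forestLineages, forestLineages, this]
  exact Finset.card_image_le

theorem forestLineages_eq_card {x : ℕ} {ω : Realization} {t : ℝ} {P : Finset Individual}
    (h : (P : Set Individual) ⊆ {v | Alive x ω t v}) : forestLineages ω t P = P.card := by
  rw [forestLineages, Finset.image_congr (g := id), Finset.image_id]
  intro v hv
  have := ((alive_iff _ _ _ _).1 (h hv)).2.2.1
  simp [lastBorn_of_le this]

variable {n x : ℕ} {t : ℝ} {ω : Realization} {σ : Fin (n + 1) → Individual}

theorem ancestors_eq (hω : ∀ v, 0 ≤ (ω v).1) (hσ : ∀ i, Alive x ω t (σ i)) {u : ℝ} (hu0 : 0 ≤ u)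
    (hut : u ≤ t) :
    ancestors n x t u ω σ =
      (((Finset.univ.image σ).image fun v => (v.1, lastBorn (branch ω v.1) (t - u) v.2) :
        Finset Individual) : Set Individual) := by
  have key : ∀ v, Alive x ω t v → ∀ w, Alive x ω (t - u) w ∧ IsAncestor w v ↔
      w = (v.1, lastBorn (branch ω v.1) (t - u) v.2) := by
    rintro ⟨i, l⟩ hv ⟨j, m⟩
    rw [alive_iff] at hv
    simp only [alive_iff, IsAncestor, Prod.mk.injEq]
    rw [← mem_living_and_suffix_iff (τ := branch ω i) (l := l) (fun l => hω (i, l))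
      (sub_nonneg.2 hut) hv.2.1 ((sub_le_self t hu0).trans_lt hv.2.2.2)]
    constructor
    · rintro ⟨⟨_, h1⟩, rfl, h2⟩; exact ⟨rfl, h1, h2⟩
    · rintro ⟨rfl, h1, h2⟩; exact ⟨⟨hv.1, h1⟩, rfl, h2⟩
  ext w
  simp only [ancestors, Set.mem_ofPred_eq, Finset.coe_image, Finset.coe_univ, Set.image_univ,
    Set.mem_image, Set.mem_range, exists_exists_eq_and]
  constructor
  · rintro ⟨hw, i, hi⟩
    exact ⟨i, ((key _ (hσ i) w).1 ⟨hw, hi⟩).symm⟩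
  · rintro ⟨i, rfl⟩
    have := (key _ (hσ i) _).2 rfl
    exact ⟨this.1, i, this.2⟩

/-- The number of ancestral lines of a sample, looking back by `u` from time `t`. -/
def sampleLineages (t : ℝ) (ω : Realization) (σ : Fin (n + 1) → Individual) (u : ℝ) : ℕ :=
  forestLineages ω (t - u) (Finset.univ.image σ)

theorem antitone_sampleLineages (t : ℝ) (ω : Realization) (σ : Fin (n + 1) → Individual) :
    Antitone (sampleLineages t ω σ) := fun _ _ h => forestLineages_mono ω (by linarith) _

theorem sampleLineages_pos (t : ℝ) (ω : Realization) (σ : Fin (n + 1) → Individual) (u : ℝ) :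
    0 < sampleLineages t ω σ u :=
  Finset.card_pos.2 ((Finset.univ_nonempty.image σ).image _)

theorem sampleLineages_zero (hinj : Function.Injective σ) (hσ : ∀ i, Alive x ω t (σ i)) :
    sampleLineages t ω σ 0 = n + 1 := by
  rw [sampleLineages, sub_zero, forestLineages_eq_card (x := x),
    Finset.card_image_of_injective _ hinj, Finset.card_univ, Fintype.card_fin]
  intro v hv
  simp only [Finset.coe_image, Finset.coe_univ, Set.image_univ, Set.mem_range] at hv
  obtain ⟨i, rfl⟩ := hv
  exact hσ i

/-- Right-continuity in forward time becomes left-continuity in look-back time. -/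
theorem exists_lt_sampleLineages_eq (t : ℝ) (ω : Realization) (σ : Fin (n + 1) → Individual)
    {b : ℝ} (hb : 0 < b) :
    ∃ u, 0 < u ∧ u < b ∧ sampleLineages t ω σ u = sampleLineages t ω σ b := by
  have h := eventually_forestLineages_eq ω (t - b) (Finset.univ.image σ)
  have h2 : ∀ᶠ r' in 𝓝[>] (t - b), r' < t ∧ t - b < r' ∧
      forestLineages ω r' (Finset.univ.image σ) = forestLineages ω (t - b) (Finset.univ.image σ) := by
    filter_upwards [h.filter_mono (nhdsWithin_mono _ Set.Ioi_subset_Ici_self),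
      mem_nhdsWithin_of_mem_nhds (Iio_mem_nhds (show t - b < t by linarith)),
      self_mem_nhdsWithin] with r' h1 h2 h3
    exact ⟨h2, h3, h1⟩
  obtain ⟨r', h3, h4, h5⟩ := h2.exists
  refine ⟨t - r', by linarith, by linarith, ?_⟩
  rw [sampleLineages, sub_sub_cancel, h5, sampleLineages]

theorem coalescenceTime_some (hω : ∀ v, 0 ≤ (ω v).1) (hσ : ∀ i, Alive x ω t (σ i)) (k : Fin n) :
    coalescenceTime x t k (ω, (some σ : Sample n)) =
      sInf {e : EReal | ∃ u : ℝ, e = u ∧ 0 < u ∧ u ≤ t ∧ sampleLineages t ω σ u ≤ n - k} := by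
  change sInf _ = _
  congr 1
  ext e
  simp only [Set.mem_ofPred_eq]
  refine exists_congr fun u => and_congr_right fun _ => and_congr_right fun h0 =>
    and_congr_right fun h1 => ?_
  rw [ancestors_eq hω hσ h0.le h1, Set.encard_coe_eq_coe_finsetCard, Nat.cast_le]
  rfl

/-- The inequality can be strict because a lineage count reached at `b` was already reached slightly
before, so the infimum is not attained at `b`. For `b = 0` both sides fail, as all `n + 1` members
are distinct. -/
theorem coalescenceTime_lt_iff (hω : ∀ v, 0 ≤ (ω v).1) (hinj : Function.Injective σ)
    (hσ : ∀ i, Alive x ω t (σ i)) (k : Fin n) {b : ℝ} (hb0 : 0 ≤ b) (hbt : b ≤ t) :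
    coalescenceTime x t k (ω, (some σ : Sample n)) < b ↔ sampleLineages t ω σ b ≤ n - k := by
  rw [coalescenceTime_some hω hσ, sInf_lt_iff]
  constructor
  · rintro ⟨_, ⟨u, rfl, h0, h1, h2⟩, hlt⟩
    exact (antitone_sampleLineages t ω σ (EReal.coe_lt_coe_iff.1 hlt).le).trans h2
  · intro h
    rcases hb0.eq_or_lt with rfl | hb
    · rw [sampleLineages_zero hinj hσ] at h
      omega
    · obtain ⟨u, h0, hub, hu⟩ := exists_lt_sampleLineages_eq t ω σ hb
      exact ⟨u, ⟨u, rfl, h0, hub.le.trans hbt, hu ▸ h⟩, EReal.coe_lt_coe_iff.2 hub⟩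

theorem coalescenceTime_lt_iff_of_lt (hω : ∀ v, 0 ≤ (ω v).1) (hσ : ∀ i, Alive x ω t (σ i))
    (ht : 0 < t) (k : Fin n) {e : EReal} (he : t < e) :
    coalescenceTime x t k (ω, (some σ : Sample n)) < e ↔ sampleLineages t ω σ t ≤ n - k := by
  rw [coalescenceTime_some hω hσ, sInf_lt_iff]
  constructor
  · rintro ⟨_, ⟨u, rfl, h0, h1, h2⟩, -⟩
    exact (antitone_sampleLineages t ω σ h1).trans h2
  · intro h
    exact ⟨t, ⟨t, rfl, ht, le_rfl, h⟩, he⟩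

theorem coalescenceTime_nonneg (k : Fin n) (p : Realization × Sample n) :
    0 ≤ coalescenceTime x t k p := by
  obtain ⟨ω, q⟩ := p
  cases q with
  | none => exact le_top
  | some σ =>
    refine le_sInf ?_
    rintro _ ⟨u, rfl, hu, -⟩
    exact EReal.coe_nonneg.2 hu.le

/-- No coalescence time equals `t`. -/
theorem coalescenceTime_ne (hω : ∀ v, 0 ≤ (ω v).1) (hinj : Function.Injective σ)
    (hσ : ∀ i, Alive x ω t (σ i)) (ht : 0 < t) (k : Fin n) :
    coalescenceTime x t k (ω, (some σ : Sample n)) ≠ t := by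
  intro h
  have h1 : coalescenceTime x t k (ω, (some σ : Sample n)) < ((t + 1 : ℝ) : EReal) := by
    rw [h]; exact EReal.coe_lt_coe_iff.2 (by linarith)
  -- Being less than `t + 1` and being less than `t` are the same condition on the lineages at
  -- look-back time `t`.
  rw [coalescenceTime_lt_iff_of_lt hω hσ ht k (EReal.coe_lt_coe_iff.2 (by linarith)),
    ← coalescenceTime_lt_iff hω hinj hσ k ht.le le_rfl, h] at h1
  exact lt_irrefl _ h1

end Ancestors

/-! ### Boxes of coalescence times as patterns. -/

section Chain

/-- The points `0, a 0, b 0, a 1, b 1, …`. -/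
def chain (a b : ℕ → ℝ) : ℕ → ℝ
  | 0 => 0
  | i + 1 => if i % 2 = 0 then a (i / 2) else b (i / 2)

variable {a b : ℕ → ℝ}

theorem chain_odd (k : ℕ) : chain a b (2 * k + 1) = a k := by
  rw [chain, if_pos (by omega)]
  congr 1
  omega

theorem chain_even (k : ℕ) : chain a b (2 * k + 2) = b k := by
  rw [chain, if_neg (by omega)]
  congr 1
  omega

theorem monotone_chain (h0 : 0 ≤ a 0) (hab : ∀ k, a k ≤ b k) (hba : ∀ k, b k ≤ a (k + 1)) :
    Monotone (chain a b) := by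
  refine monotone_nat_of_le_succ fun i => ?_
  rcases i with _ | i
  · exact (chain_odd 0).symm ▸ h0
  · rcases Nat.even_or_odd' i with ⟨k, rfl | rfl⟩
    · rw [chain_odd, chain_even]; exact hab k
    · rw [chain_even]
      exact (chain_odd (k + 1)).symm ▸ hba k

/-- The indices of the intervals `[a k, b k)`, `k < n`. -/
def boxIndices (n : ℕ) : Finset ℕ := (Finset.range n).image fun k => 2 * k + 1

theorem card_boxIndices (n : ℕ) : (boxIndices n).card = n := by
  rw [boxIndices, Finset.card_image_of_injective, Finset.card_range]
  intro i j h
  simp only at h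
  omega

theorem boxIndices_subset (n : ℕ) : boxIndices n ⊆ Finset.range (2 * n) := by
  intro i hi
  simp only [boxIndices, Finset.mem_image, Finset.mem_range] at hi ⊢
  omega

theorem prod_boxIndices {M : Type*} [CommMonoid M] (n : ℕ) (f : ℕ → M) :
    ∏ j ∈ boxIndices n, f j = ∏ k ∈ Finset.range n, f (2 * k + 1) := by
  rw [boxIndices, Finset.prod_image]
  intro i _ j _ h
  simp only at h
  omega

/-- The right side says that the successive coalescence times lie in [a k, b k). Together with
monotonicity it squeezes the counts to n + 1 - k at `a k` and n - k at `b k`, so the drops are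
exactly at the odd indices of the chain. -/
theorem pattern_chain_iff (h0 : 0 ≤ a 0) (hba : ∀ k, b k ≤ a (k + 1))
    {n : ℕ} {A : ℝ → ℕ} (hA : Antitone A) (hpos : ∀ u, 0 < A u) (hA0 : A 0 = n + 1) :
    Pattern (2 * n) (boxIndices n) (fun i => A (chain a b i)) ↔
      ∀ k < n, ¬ A (a k) ≤ n - k ∧ A (b k) ≤ n - k := by
  have hodd : ∀ k, 2 * k + 1 ∈ boxIndices n ↔ k < n := by
    intro k
    simp only [boxIndices, Finset.mem_image, Finset.mem_range]
    exact ⟨fun ⟨j, hj, h⟩ => by omega, fun h => ⟨k, h, rfl⟩⟩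
  have heven : ∀ k, 2 * k ∉ boxIndices n := by
    intro k
    simp only [boxIndices, Finset.mem_image, Finset.mem_range, not_exists, not_and]
    intro j _
    omega
  constructor
  · rintro ⟨-, h⟩
    have key : ∀ k < n, A (a k) = n + 1 - k ∧ A (b k) = n - k := by
      intro k
      induction k with
      | zero =>
        intro hk
        have h1 := h 0 (by omega)
        have h2 := h 1 (by omega)
        have e1 : chain a b (0 + 1) = a 0 := chain_odd 0
        have e2 : chain a b (1 + 1) = b 0 := chain_even 0
        have e3 : chain a b 0 = 0 := rfl
        have m1 := heven 0
        have m2 := (hodd 0).2 hk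
        simp only [mul_zero, zero_add] at m1 m2
        simp only [e1, e2, e3, m1, m2, if_true, if_false] at h1 h2
        omega
      | succ k ih =>
        intro hk
        obtain ⟨-, ih2⟩ := ih (by omega)
        have h1 := h (2 * k + 2) (by omega)
        have h2 := h (2 * (k + 1) + 1) (by omega)
        have e1 : chain a b (2 * k + 2 + 1) = a (k + 1) := chain_odd (k + 1)
        have m1 : 2 * k + 2 ∉ boxIndices n := heven (k + 1)
        simp only [chain_even, chain_odd, e1, m1, (hodd (k + 1)).2 hk, if_true,
          if_false] at h1 h2
        omega
    intro k hk
    obtain ⟨h1, h2⟩ := key k hk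
    omega
  · intro h
    have hb : ∀ k < n, A (b k) = n - k := by
      intro k hk
      refine le_antisymm (h k hk).2 ?_
      by_cases hk' : k + 1 < n
      · have h1 := (h (k + 1) hk').1
        have h2 := hA (hba k)
        omega
      · have := hpos (b k); omega
    have ha : ∀ k < n, A (a k) = n + 1 - k := by
      intro k hk
      have h1 := (h k hk).1
      rcases k with _ | k
      · have := hA h0; omega
      · have h2 := hA (hba k)
        rw [hb k (by omega)] at h2
        omega
    constructor
    · rcases n with _ | n
      · exact hA0
      · have e : chain a b (2 * (n + 1)) = b n := chain_even n
        simp only [e, hb n (by omega)]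
        omega
    · intro i hi
      rcases i with _ | i
      · have e1 : chain a b (0 + 1) = a 0 := chain_odd 0
        have e3 : chain a b 0 = 0 := rfl
        have m1 := heven 0
        rw [mul_zero] at m1
        simp only [e1, e3, m1, if_false, hA0, ha 0 (by omega)]
        omega
      · rcases Nat.even_or_odd' i with ⟨k, rfl | rfl⟩
        · have hk : k < n := by omega
          simp only [chain_odd, chain_even, (hodd k).2 hk, if_true, ha k hk, hb k hk]
          omega
        · have hk : k + 1 < n := by omega
          have e1 : chain a b (2 * k + 1 + 1 + 1) = a (k + 1) := chain_odd (k + 1)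
          have m1 : 2 * k + 1 + 1 ∉ boxIndices n := heven (k + 1)
          simp only [e1, chain_even, m1, if_false, ha (k + 1) hk, hb k (by omega)]
          omega

end Chain

end BGW

/-! ### Uniform sampling as a sum over sets of living individuals. -/

namespace BGW

attribute [local instance] isProbabilityMeasure_markLaw isProbabilityMeasure_law_of_neZero

section Injections

variable {α : Type*} [DecidableEq α]

/-- The injections with image `P` are the bijections of `Fin m` onto `P`. -/
theorem tsum_injective_image_eq (m : ℕ) (P : Finset α) :
    ∑' σ : Fin m → α, (if Function.Injective σ ∧ Finset.univ.image σ = P then (1 : ℝ≥0∞) else 0) =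
      if P.card = m then (m.factorial : ℝ≥0∞) else 0 := by
  classical
  split_ifs with hP
  · have hset : {σ : Fin m → α | Function.Injective σ ∧ Finset.univ.image σ = P} =
        Set.range fun (e : Fin m ≃ P) i => (e i : α) := by
      ext σ
      simp only [Set.mem_ofPred_eq, Set.mem_range]
      constructor
      · rintro ⟨hinj, himg⟩
        have hmem : ∀ i, σ i ∈ P := fun i => himg ▸ Finset.mem_image_of_mem σ (Finset.mem_univ i)
        refine ⟨Equiv.ofBijective (fun i => ⟨σ i, hmem i⟩) ⟨fun i j h => ?_, fun ⟨y, hy⟩ => ?_⟩, ?_⟩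
        · exact hinj (congrArg Subtype.val h)
        · rw [← himg, Finset.mem_image] at hy
          obtain ⟨i, -, rfl⟩ := hy
          exact ⟨i, rfl⟩
        · rfl
      · rintro ⟨e, rfl⟩
        refine ⟨Subtype.val_injective.comp e.injective, ?_⟩
        ext y
        simp only [Finset.mem_image, Finset.mem_univ, true_and]
        constructor
        · rintro ⟨i, rfl⟩; exact (e i).2
        · intro hy; exact ⟨e.symm ⟨y, hy⟩, by simp⟩
    have hinj : Function.Injective fun (e : Fin m ≃ P) i => (e i : α) := by
      intro e e' h
      ext i
      exact congrFun h i
    calc _ = ∑' σ, ({σ : Fin m → α | Function.Injective σ ∧ Finset.univ.image σ = P}).indicator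
          (1 : (Fin m → α) → ℝ≥0∞) σ := by
          refine tsum_congr fun σ => ?_
          rw [Set.indicator_apply]
          rfl
      _ = ({σ : Fin m → α | Function.Injective σ ∧ Finset.univ.image σ = P}.encard : ℝ≥0∞) := by
          rw [← tsum_subtype, ← ENNReal.tsum_set_one]
          rfl
      _ = m.factorial := by
          rw [hset, ← Set.image_univ, hinj.encard_image, Set.encard_univ,
            ENat.card_eq_coe_fintype_card, Fintype.card_equiv (Fintype.equivOfCardEq (by simp [hP]))]
          simp
  · rw [ENNReal.tsum_eq_zero]
    intro σ
    refine if_neg ?_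
    rintro ⟨hinj, rfl⟩
    refine hP ?_
    rw [Finset.card_image_of_injective _ hinj, Finset.card_univ, Fintype.card_fin]

theorem tsum_injective_image (m : ℕ) (f : Finset α → ℝ≥0∞) :
    ∑' σ : Fin m → α, (if Function.Injective σ then f (Finset.univ.image σ) else 0) =
      m.factorial * ∑' P, if P.card = m then f P else 0 := by
  classical
  calc _ = ∑' σ : Fin m → α, ∑' P : Finset α,
        (if Function.Injective σ ∧ Finset.univ.image σ = P then (1 : ℝ≥0∞) else 0) * f P := by
        refine tsum_congr fun σ => ?_
        rw [tsum_eq_single (Finset.univ.image σ)]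
        · by_cases h : Function.Injective σ <;> simp [h]
        · intro P hP
          rw [if_neg fun h => hP h.2.symm, zero_mul]
    _ = _ := by
        rw [ENNReal.tsum_comm, ← ENNReal.tsum_mul_left]
        refine tsum_congr fun P => ?_
        rw [ENNReal.tsum_mul_right, tsum_injective_image_eq]
        split_ifs <;> simp

theorem tsum_injective_subset (m : ℕ) (L : Finset α) :
    ∑' σ : Fin m → α, (if Function.Injective σ then (if Finset.univ.image σ ⊆ L then 1 else 0)
      else (0 : ℝ≥0∞)) = L.card.descFactorial m := by
  rw [tsum_injective_image m (fun P => if P ⊆ L then 1 else 0), tsum_eq_sum (s := L.powersetCard m)]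
  · rw [Finset.sum_congr rfl (g := fun _ => 1), Finset.sum_const, Finset.card_powersetCard,
      Nat.descFactorial_eq_factorial_mul_choose]
    · simp
    · intro P hP
      rw [Finset.mem_powersetCard] at hP
      simp [hP]
  · intro P hP
    rw [Finset.mem_powersetCard] at hP
    split_ifs with h1 h2
    · exact absurd ⟨h2, h1⟩ hP
    · rfl
    · rfl

end Injections

/-- The weight of a realization in the weighted law of the coalescence times. -/
def sampleWeight (s : ℝ) (n x : ℕ) (t : ℝ) (ω : Realization) : ℝ≥0∞ :=
  ENNReal.ofReal (((Z x t ω).toNat.descFactorial (n + 1) : ℝ) * s ^ ((Z x t ω).toNat - (n + 1)))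

theorem measurable_sampleWeight (s : ℝ) (n x : ℕ) (t : ℝ) :
    Measurable (sampleWeight s n x t) :=
  (measurable_of_countable fun N : ℕ∞ =>
    ENNReal.ofReal ((N.toNat.descFactorial (n + 1) : ℝ) * s ^ (N.toNat - (n + 1)))).comp
    (measurable_encard fun v => measurableSet_alive x t v)

theorem lintegral_uniformOn {α : Type*} [MeasurableSpace α] [MeasurableSingletonClass α]
    [Countable α] (S : Set α) (f : α → ℝ≥0∞) :
    ∫⁻ q, f q ∂uniformOn S = (Measure.count S)⁻¹ * ∑' q, S.indicator f q := by
  rw [uniformOn, ProbabilityTheory.cond, lintegral_smul_measure,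
    ← lintegral_indicator S.to_countable.measurableSet,
    lintegral_count, smul_eq_mul]

/-- The sample consisting of the individuals `σ i`. -/
def Sample.of {n : ℕ} (σ : Fin (n + 1) → Individual) : Sample n := some σ

theorem Sample.of_injective {n : ℕ} :
    Function.Injective (Sample.of : (Fin (n + 1) → Individual) → Sample n) :=
  Option.some_injective _

theorem mem_samples_iff {n x : ℕ} {t : ℝ} {ω : Realization} {σ : Fin (n + 1) → Individual} :
    Sample.of σ ∈ samples n x t ω ↔ Function.Injective σ ∧ ∀ i, Alive x ω t (σ i) := by
  constructor
  · rintro ⟨σ', h, h1, h2⟩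
    obtain rfl := Sample.of_injective h
    exact ⟨h1, h2⟩
  · rintro ⟨h1, h2⟩
    exact ⟨σ, rfl, h1, h2⟩

open Classical in
theorem tsum_indicator_samples (n x : ℕ) (t : ℝ) (ω : Realization) (G : Sample n → ℝ≥0∞) :
    ∑' q, (samples n x t ω).indicator G q = ∑' σ : Fin (n + 1) → Individual,
      (if Function.Injective σ then
        (if (Finset.univ.image σ : Set Individual) ⊆ {v | Alive x ω t v} then G (.of σ) else 0)
        else 0) := by
  rw [← (Sample.of_injective (n := n)).tsum_eq]
  · refine tsum_congr fun σ => ?_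
    have h : (Finset.univ.image σ : Set Individual) ⊆ {v | Alive x ω t v} ↔
        ∀ i, Alive x ω t (σ i) := by
      simp [Set.subset_def]
    rw [Set.indicator_apply]
    simp only [mem_samples_iff, h, ite_and]
  · intro q hq
    have := Set.mem_of_indicator_ne_zero hq
    obtain ⟨σ, rfl, -⟩ := this
    exact ⟨σ, rfl⟩

/-- The falling factorial in the weight is the number of possible samples, so it cancels the uniform
probability and each ordered sample counts s ^ (number of individuals left out). -/
theorem lintegral_sampling {s : ℝ} (hs0 : 0 ≤ s) (n x : ℕ) (t : ℝ) (ω : Realization)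
    (G : Sample n → ℝ≥0∞) :
    ∫⁻ q, G q * sampleWeight s n x t ω ∂sampling n x t ω = ∑' σ : Fin (n + 1) → Individual,
      (if Function.Injective σ then
        G (.of σ) * forestWeight (ENNReal.ofReal s) x t ω (Finset.univ.image σ) else 0) := by
  classical
  by_cases hfin : {v | Alive x ω t v}.Finite
  · set L := hfin.toFinset with hL
    have hcoe : {v | Alive x ω t v} = (L : Set Individual) := by simp [hL]
    have hZ : Z x t ω = L.card := by
      rw [Z, hcoe, Set.encard_coe_eq_coe_finsetCard]
    have hcount : Measure.count (samples n x t ω) = (L.card.descFactorial (n + 1) : ℝ≥0∞) := by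
      rw [← tsum_injective_subset, ← lintegral_indicator_one MeasurableSet.of_discrete,
        lintegral_count]
      have := tsum_indicator_samples n x t ω 1
      simp only [hcoe, Finset.coe_subset, Pi.one_apply] at this
      exact_mod_cast this
    have hw : sampleWeight s n x t ω =
        L.card.descFactorial (n + 1) * ENNReal.ofReal s ^ (L.card - (n + 1)) := by
      rw [sampleWeight, hZ, ENat.toNat_natCast, ENNReal.ofReal_mul (Nat.cast_nonneg _),
        ENNReal.ofReal_natCast, ENNReal.ofReal_pow hs0]
    have hweight : ∀ σ : Fin (n + 1) → Individual, Function.Injective σ →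
        forestWeight (ENNReal.ofReal s) x t ω (Finset.univ.image σ) =
        if Finset.univ.image σ ⊆ L then ENNReal.ofReal s ^ (L.card - (n + 1)) else 0 := by
      intro σ hσ
      rw [forestWeight, hcoe]
      simp only [Finset.coe_subset]
      split_ifs with h
      · rw [← Finset.coe_sdiff, Set.encard_coe_eq_coe_finsetCard, epow_coe,
          Finset.card_sdiff_of_subset h, Finset.card_image_of_injective _ hσ, Finset.card_univ,
          Fintype.card_fin]
      · rfl
    -- This happens exactly for fewer than n + 1 individuals; then no sample exists and both sides
    -- are 0.
    by_cases hd : L.card.descFactorial (n + 1) = 0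
    · rw [hw, hd]
      simp only [Nat.cast_zero, zero_mul, mul_zero, lintegral_zero]
      symm
      rw [ENNReal.tsum_eq_zero]
      intro σ
      split_ifs with hσ
      · rw [hweight σ hσ, if_neg, mul_zero]
        intro hsub
        have h1 := Finset.card_le_card hsub
        rw [Finset.card_image_of_injective _ hσ, Finset.card_univ, Fintype.card_fin] at h1
        rw [Nat.descFactorial_eq_zero_iff_lt] at hd
        omega
      · rfl
    · have hne : (samples n x t ω).Finite ∧ (samples n x t ω).Nonempty := by
        constructor
        · rw [← Measure.count_apply_lt_top, hcount]
          exact ENNReal.natCast_lt_top _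
        · rw [Set.nonempty_iff_ne_empty]
          intro h0
          rw [h0, measure_empty] at hcount
          exact hd (by exact_mod_cast hcount.symm)
      have hsamp : sampling n x t ω = uniformOn (samples n x t ω) := by
        simp only [sampling, Kernel.coe_mk, if_pos hne]
      have hd' : (L.card.descFactorial (n + 1) : ℝ≥0∞) ≠ 0 := by exact_mod_cast hd
      rw [hsamp, lintegral_uniformOn, tsum_indicator_samples, hcount, ← ENNReal.tsum_mul_left]
      refine tsum_congr fun σ => ?_
      split_ifs with hσ hsub
      · rw [hweight σ hσ, if_pos (by rw [hcoe] at hsub; exact_mod_cast hsub), hw,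
          mul_left_comm, ← mul_assoc (_⁻¹), ENNReal.inv_mul_cancel hd' (ENNReal.natCast_ne_top _),
          one_mul]
      · rw [hweight σ hσ, if_neg (by rw [hcoe] at hsub; exact_mod_cast hsub), mul_zero, mul_zero]
      · rw [mul_zero]
  -- For an infinite population `toNat` gives 0, whose falling factorial of order n + 1 vanishes, in
  -- agreement with `s ^ ∞ = 0`.
  · have hZ : Z x t ω = ⊤ := Set.encard_eq_top_iff.2 hfin
    have hw : sampleWeight s n x t ω = 0 := by simp [sampleWeight, hZ]
    rw [hw]
    simp only [mul_zero, lintegral_zero]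
    symm
    rw [ENNReal.tsum_eq_zero]
    intro σ
    split_ifs
    · rw [forestWeight]
      split_ifs
      · have : ({v | Alive x ω t v} \
            ((Finset.univ.image σ : Finset Individual) : Set Individual)).encard = ⊤ := by
          rw [Set.encard_eq_top_iff]
          exact Set.Infinite.sdiff hfin (Finset.finite_toSet _)
        rw [this, epow_top, mul_zero]
      · rw [mul_zero]
    · rfl

section Box

variable (μ : Measure ℕ) [IsFiniteMeasure μ] [NeZero μ]

theorem measurable_forestLineages (r : ℝ) (P : Finset Individual) :
    Measurable fun ω => forestLineages ω r P := by
  have hP : ∀ v ∈ P, v.1 < P.sup Prod.fst + 1 := fun v hv =>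
    Nat.lt_succ_of_le (Finset.le_sup (f := Prod.fst) hv)
  simp only [forestLineages_eq_sum _ _ P _ hP]
  refine Finset.measurable_sum _ fun i _ => ?_
  exact (measurable_lineages _).comp (measurable_const.prodMk (measurable_branch i))

/-- The event that the sample coalesces according to the pattern `J`. -/
def patternEvent (n : ℕ) (t : ℝ) (c : ℕ → ℝ) (N : ℕ) (J : Finset ℕ) :
    Set (Realization × Sample n) :=
  {p | ∃ σ : Fin (n + 1) → Individual, p.2 = .of σ ∧
    Pattern N J (fun i => sampleLineages t p.1 σ (c i))}

theorem measurableSet_patternEvent (n : ℕ) (t : ℝ) (c : ℕ → ℝ) (N : ℕ) (J : Finset ℕ) :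
    MeasurableSet (patternEvent n t c N J) := by
  have h : patternEvent n t c N J = ⋃ σ : Fin (n + 1) → Individual,
      {ω | Pattern N J (fun i => sampleLineages t ω σ (c i))} ×ˢ {Sample.of σ} := by
    ext ⟨ω, q⟩
    simp only [patternEvent, Set.mem_ofPred_eq, Set.mem_iUnion, Set.mem_prod,
      Set.mem_singleton_iff]
    exact exists_congr fun σ => and_comm
  rw [h]
  refine MeasurableSet.iUnion fun σ => MeasurableSet.prod ?_ MeasurableSet.of_discrete
  have h1 := measurable_patternIndicator N J (A := fun ω i => sampleLineages t ω σ (c i))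
    fun i => measurable_forestLineages _ _
  have h2 : {ω | Pattern N J (fun i => sampleLineages t ω σ (c i))} =
      (fun ω => patternIndicator N J (fun i => sampleLineages t ω σ (c i))) ⁻¹' {1} := by
    ext ω
    simp [patternIndicator]
  rw [h2]
  exact h1 (measurableSet_singleton _)

/-- Each set arises from (n + 1)! ordered samples; it lies in one of `x` families, and the other `x
- 1` contribute independent factors ψ. -/
theorem setLIntegral_patternEvent {s : ℝ} (hs0 : 0 ≤ s) (n x : ℕ) (t : ℝ)
    {c : ℕ → ℝ} (hc0 : c 0 = 0) {N : ℕ} {J : Finset ℕ} (hJ : J ⊆ Finset.range N)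
    (hcard : J.card = n) :
    ∫⁻ p in patternEvent n t c N J, sampleWeight s n x t p.1 ∂sampledLaw μ n x t =
      (n + 1).factorial * (x * (coalescenceGen μ (ENNReal.ofReal s) c N t J *
        sizeGen μ (ENNReal.ofReal s) t ^ (x - 1))) := by
  classical
  have hE := measurableSet_patternEvent n t c N J
  have hw : Measurable fun p : Realization × Sample n => sampleWeight s n x t p.1 :=
    (measurable_sampleWeight s n x t).comp measurable_fst
  rw [← lintegral_indicator hE, sampledLaw, Measure.lintegral_compProd (hw.indicator hE)]
  have hinner : ∀ ω, ∫⁻ q, (patternEvent n t c N J).indicator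
      (fun p => sampleWeight s n x t p.1) (ω, q) ∂sampling n x t ω =
      (n + 1).factorial * ∑ i ∈ Finset.range x,
        coalescenceSum (ENNReal.ofReal s) c N t J (branch ω i) *
        ∏ a ∈ (Finset.range x).erase i, sizeWeight (ENNReal.ofReal s) t (branch ω a) := by
    intro ω
    have h1 := lintegral_sampling hs0 n x t ω
      fun q => (patternEvent n t c N J).indicator 1 (ω, q)
    have h2 : ∀ q, (patternEvent n t c N J).indicator (fun p => sampleWeight s n x t p.1) (ω, q) =
        (patternEvent n t c N J).indicator 1 (ω, q) * sampleWeight s n x t ω := by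
      intro q
      by_cases h : (ω, q) ∈ patternEvent n t c N J <;> simp [h]
    rw [lintegral_congr h2, h1, ← tsum_forest_pattern]
    have h3 : ∀ σ : Fin (n + 1) → Individual,
        (patternEvent n t c N J).indicator (1 : Realization × Sample n → ℝ≥0∞) (ω, Sample.of σ) =
        patternIndicator N J (fun i => forestLineages ω (t - c i) (Finset.univ.image σ)) := by
      intro σ
      have h4 : (ω, Sample.of σ) ∈ patternEvent n t c N J ↔
          Pattern N J (fun i => forestLineages ω (t - c i) (Finset.univ.image σ)) := by
        constructor
        · rintro ⟨σ', h, hp⟩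
          obtain rfl := Sample.of_injective h
          exact hp
        · intro hp; exact ⟨σ, rfl, hp⟩
      rw [Set.indicator_apply, patternIndicator]
      simp only [h4, Pi.one_apply]
    simp only [h3]
    rw [tsum_injective_image (n + 1) (fun P => patternIndicator N J
      (fun i => forestLineages ω (t - c i) P) * forestWeight (ENNReal.ofReal s) x t ω P)]
    congr 1
    refine tsum_congr fun P => ?_
    split_ifs with h
    · rfl
    -- A living set that shows `J` has `J.card + 1 = n + 1` members, so sets of other sizes
    -- contribute nothing.
    · symm
      by_contra hne
      have hp : Pattern N J (fun i => forestLineages ω (t - c i) P) := by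
        by_contra hn
        exact hne (by rw [patternIndicator_of_not hn, zero_mul])
      have hsub : (P : Set Individual) ⊆ {v | Alive x ω t v} := by
        by_contra hn
        exact hne (by rw [forestWeight, if_neg hn, mul_zero])
      have := hp.zero_eq fun j hj => Finset.mem_range.1 (hJ hj)
      simp only [hc0, sub_zero, forestLineages_eq_card hsub, hcard] at this
      exact h this
  have hm : ∀ i, Measurable fun ω : Realization =>
      coalescenceSum (ENNReal.ofReal s) c N t J (branch ω i) *
        ∏ a ∈ (Finset.range x).erase i, sizeWeight (ENNReal.ofReal s) t (branch ω a) := fun i =>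
    ((measurable_coalescenceSum_right _ c N t J).comp (measurable_branch i)).mul
      (Finset.measurable_prod _ fun a _ =>
        (measurable_sizeWeight_right _ t).comp (measurable_branch a))
  rw [lintegral_congr hinner, lintegral_const_mul _ (Finset.measurable_sum _ fun i _ => hm i),
    lintegral_finsetSum _ fun i _ => hm i,
    Finset.sum_congr rfl fun i hi => lintegral_mul_prod_erase μ
      (measurable_coalescenceSum_right _ c N t J) (measurable_sizeWeight_right _ t)
      (Finset.mem_range.1 hi), Finset.sum_const, Finset.card_range, nsmul_eq_mul]
  rfl

end Box

end BGW

/-! ### The density and its integral over boxes. -/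

namespace BGW

attribute [local instance] isProbabilityMeasure_markLaw isProbabilityMeasure_law_of_neZero

section Density

variable (μ : Measure ℕ) [IsFiniteMeasure μ] [NeZero μ] {s : ℝ}

/-- For `J = ∅` the grid does not matter, so the trivial one is used to transfer nonnegativity,
measurability and bounds to ψ'. -/
theorem deriv_psi (hs0 : 0 ≤ s) (hs1 : s < 1) (r : ℝ) : deriv (psi μ r) s =
    (coalescenceGen μ (ENNReal.ofReal s) (fun _ => 0) 0 r ∅).toReal :=
  (hasDerivAt_psi μ hs0 hs1 rfl 0 r).deriv

theorem deriv_psi_nonneg (hs0 : 0 ≤ s) (hs1 : s < 1) (r : ℝ) : 0 ≤ deriv (psi μ r) s := by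
  rw [deriv_psi μ hs0 hs1]; exact ENNReal.toReal_nonneg

theorem coalescenceRate_nonneg (hs0 : 0 ≤ s) (hs1 : s < 1) (u : ℝ) : 0 ≤ coalescenceRate μ s u :=
  mul_nonneg (deriv_psi_nonneg μ hs0 hs1 u)
    (tsum_nonneg fun k => mul_nonneg (coeff₂_nonneg μ k) (pow_nonneg (psi_nonneg μ hs0 u) k))

theorem measurable_coalescenceRate (hs0 : 0 ≤ s) (hs1 : s < 1) :
    Measurable (coalescenceRate μ s) := by
  unfold coalescenceRate
  simp only [deriv_psi μ hs0 hs1, psi_eq μ hs0]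
  exact (measurable_coalescenceGen μ).ennreal_toReal.mul
    ((measurable_powSum _).comp (measurable_sizeGen μ).ennreal_toReal)

/-- The rate is bounded: ψ' is at most 1/(1 - s) by the binomial bound, and ψ stays in a compact
part of [0, 1), where the power series is bounded. -/
theorem integrableOn_coalescenceRate (hs0 : 0 ≤ s) (hs1 : s < 1) (t : ℝ) :
    IntegrableOn (coalescenceRate μ s) (Set.Icc 0 t) := by
  have hs1' : ENNReal.ofReal s < 1 := by simpa using hs1
  obtain ⟨C, hC⟩ := isCompact_Icc.exists_bound_of_continuousOn (continuousOn_powSum (coeff₂_le μ)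
    (show 1 - (1 - (ENNReal.ofReal s).toReal) * Real.exp (-(μ.real Set.univ * t)) < 1 by
      rw [ENNReal.toReal_ofReal hs0]
      nlinarith [Real.exp_pos (-(μ.real Set.univ * t))]))
  have hD : ∀ u, deriv (psi μ u) s ≤ ((1 - ENNReal.ofReal s)⁻¹).toReal := by
    intro u
    have h := mul_coalescenceGen_le_one μ hs1'.le (c := fun _ => 0) rfl (N := 0) (J := ∅)
      (by simp) u
    rw [Finset.card_empty, zero_add, pow_one] at h
    rw [deriv_psi μ hs0 hs1]
    exact ENNReal.toReal_mono (ENNReal.inv_ne_top.2 (tsub_pos_of_lt hs1').ne')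
      (ENNReal.le_inv_iff_mul_le.2 (by rwa [mul_comm]))
  refine Measure.integrableOn_of_bounded (M := ((1 - ENNReal.ofReal s)⁻¹).toReal * C)
    (by simp) (measurable_coalescenceRate μ hs0 hs1).aestronglyMeasurable ?_
  filter_upwards [ae_restrict_mem measurableSet_Icc] with u hu
  rw [coalescenceRate, norm_mul, Real.norm_of_nonneg (deriv_psi_nonneg μ hs0 hs1 u)]
  refine mul_le_mul (hD u) (hC _ ?_) (norm_nonneg _) ENNReal.toReal_nonneg
  rw [psi_eq μ hs0]
  exact ⟨ENNReal.toReal_nonneg, sizeGen_toReal_le μ hs1'.le hu⟩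

/-- The density of the weighted law of the coalescence times. -/
def coalescenceDensity (s : ℝ) (n x : ℕ) (t : ℝ) (τ : Fin n → ℝ) : ℝ :=
  ((n.factorial : ℝ) * ((n + 1).factorial : ℝ) / 2 ^ n) *
    ((x : ℝ) * deriv (psi μ t) s * psi μ t s ^ (x - 1)) * ∏ i : Fin n, coalescenceRate μ s (τ i)

theorem setLIntegral_coalescenceDensity (hs0 : 0 ≤ s) (hs1 : s < 1) (n x : ℕ) {t : ℝ} (ht : 0 ≤ t)
    {a b : Fin n → ℝ} (ha : ∀ i, 0 ≤ a i) (hb : ∀ i, b i ≤ t) :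
    ∫⁻ τ in Set.univ.pi fun i => Set.Ico (a i) (b i),
      ENNReal.ofReal (coalescenceDensity μ s n x t τ) =
    ENNReal.ofReal (((n.factorial : ℝ) * ((n + 1).factorial : ℝ) / 2 ^ n) *
      ((x : ℝ) * deriv (psi μ t) s * psi μ t s ^ (x - 1)) * ∏ i : Fin n,
        ∫ u in (0 : ℝ)..t, (Set.Ico (a i) (b i)).indicator 1 u * coalescenceRate μ s u) := by
  have hd := deriv_psi_nonneg μ hs0 hs1 t
  have hp := psi_nonneg μ hs0 t
  have hint : ∀ i, Integrable (coalescenceRate μ s) (volume.restrict (Set.Ico (a i) (b i))) :=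
    fun i => (integrableOn_coalescenceRate μ hs0 hs1 t).mono_set fun u hu =>
      ⟨(ha i).trans hu.1, hu.2.le.trans (hb i)⟩
  have h1 : ∀ i, ∫ u in (0 : ℝ)..t, (Set.Ico (a i) (b i)).indicator 1 u * coalescenceRate μ s u =
      ∫ u in Set.Ico (a i) (b i), coalescenceRate μ s u := by
    intro i
    rw [intervalIntegral.integral_of_le ht, ← integral_Icc_eq_integral_Ioc,
      ← integral_indicator measurableSet_Ico, ← integral_indicator measurableSet_Icc]
    refine integral_congr_ae ?_
    filter_upwards with u
    simp only [Set.indicator_apply, Pi.one_apply, Set.mem_Icc, Set.mem_Ico]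
    split_ifs with h h' h'
    · rw [one_mul]
    · rw [zero_mul]
    · exact absurd ⟨(ha i).trans h'.1, h'.2.le.trans (hb i)⟩ h
    · rfl
  simp only [h1]
  rw [volume_pi, Measure.restrict_pi_pi, ← ofReal_integral_eq_lintegral_ofReal]
  · unfold coalescenceDensity
    rw [integral_const_mul, integral_fintype_prod_eq_prod]
  · exact (Integrable.fintype_prod hint).const_mul _
  · exact ae_of_all _ fun τ => mul_nonneg (by positivity)
      (Finset.prod_nonneg fun i _ => coalescenceRate_nonneg μ hs0 hs1 _)

theorem setLIntegral_patternEvent_chain (hs0 : 0 ≤ s) (hs1 : s < 1) (n x : ℕ) {t : ℝ} (ht : 0 ≤ t)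
    {a b : ℕ → ℝ} (h0 : 0 ≤ a 0) (hab : ∀ k, a k ≤ b k) (hba : ∀ k, b k ≤ a (k + 1)) :
    ∫⁻ p in patternEvent n t (chain a b) (2 * n) (boxIndices n), sampleWeight s n x t p.1
      ∂sampledLaw μ n x t =
    ENNReal.ofReal (((n.factorial : ℝ) * ((n + 1).factorial : ℝ) / 2 ^ n) *
      ((x : ℝ) * deriv (psi μ t) s * psi μ t s ^ (x - 1)) * ∏ i : Fin n,
        ∫ u in (0 : ℝ)..t, (Set.Ico (a i) (b i)).indicator 1 u * coalescenceRate μ s u) := by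
  have hs1' : ENNReal.ofReal s < 1 := by simpa using hs1
  have hJ := boxIndices_subset n
  rw [setLIntegral_patternEvent μ hs0 n x t rfl hJ (card_boxIndices n)]
  have hc := toReal_coalescenceGen_eq_psi μ hs0 hs1 (monotone_chain h0 hab hba) rfl hJ ht
  rw [prod_boxIndices, card_boxIndices] at hc
  have hc' : (∏ k ∈ Finset.range n, ∫ u in (0 : ℝ)..t,
      (Set.Ico (chain a b (2 * k + 1)) (chain a b (2 * k + 1 + 1))).indicator 1 u *
        coalescenceRate μ s u) = ∏ i : Fin n,
        ∫ u in (0 : ℝ)..t, (Set.Ico (a i) (b i)).indicator 1 u * coalescenceRate μ s u := by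
    rw [Finset.prod_range]
    refine Finset.prod_congr rfl fun i _ => ?_
    rw [show 2 * (i : ℕ) + 1 + 1 = 2 * i + 2 from rfl, chain_odd, chain_even]
  rw [hc'] at hc
  have hne : coalescenceGen μ (ENNReal.ofReal s) (chain a b) (2 * n) t (boxIndices n) ≠ ⊤ :=
    coalescenceGen_ne_top μ hs1' rfl (fun j hj => Finset.mem_range.1 (hJ hj)) t
  rw [← ENNReal.ofReal_toReal hne, hc, ← ofReal_toReal_sizeGen μ hs1'.le, ← psi_eq μ hs0,
    ← ENNReal.ofReal_natCast, ← ENNReal.ofReal_natCast,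
    ← ENNReal.ofReal_pow (psi_nonneg μ hs0 t),
    ← ENNReal.ofReal_mul' (pow_nonneg (psi_nonneg μ hs0 t) _),
    ← ENNReal.ofReal_mul (Nat.cast_nonneg _), ← ENNReal.ofReal_mul (Nat.cast_nonneg _)]
  congr 1
  ring

end Density

end BGW

/-! ### The coalescence times as random variables. -/

namespace BGW

attribute [local instance] isProbabilityMeasure_markLaw isProbabilityMeasure_law_of_neZero

section Times

variable (μ : Measure ℕ) [IsFiniteMeasure μ] [NeZero μ] {n x : ℕ} {t : ℝ}

theorem ae_mem_samples (ω : Realization) :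
    ∀ᵐ q ∂sampling n x t ω, q = none ∨ q ∈ samples n x t ω := by
  simp only [sampling, Kernel.coe_mk]
  split_ifs with h
  · have : uniformOn (samples n x t ω) (samples n x t ω)ᶜ = 0 := by
      rw [uniformOn, cond_apply MeasurableSet.of_discrete, Set.inter_compl_self, measure_empty,
        mul_zero]
    filter_upwards [measure_eq_zero_iff_ae_notMem.1 this] with q hq
    exact Or.inr (not_not.1 hq)
  · exact (ae_dirac_iff (α := Sample n) (p := fun q => q = none ∨ q ∈ samples n x t ω)
      MeasurableSet.of_discrete).2 (Or.inl rfl)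

theorem ae_sampledLaw : ∀ᵐ p ∂sampledLaw μ n x t, (∀ v, 0 ≤ (p.1 v).1) ∧
    (p.2 = none ∨ p.2 ∈ samples n x t p.1) := by
  have h2 : {p : Realization × Sample n | p.2 = none ∨ p.2 ∈ samples n x t p.1} =
      ⋃ q : Sample n, {ω | q = none ∨ q ∈ samples n x t ω} ×ˢ {q} := by
    ext ⟨ω, q⟩
    simp only [Set.mem_iUnion, Set.mem_prod, Set.mem_singleton_iff, Set.mem_ofPred_eq]
    exact ⟨fun h => ⟨q, h, rfl⟩, fun ⟨q', h, h'⟩ => h' ▸ h⟩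
  have hm : MeasurableSet {p : Realization × Sample n | p.2 = none ∨ p.2 ∈ samples n x t p.1} := by
    rw [h2]
    exact MeasurableSet.iUnion fun q => ((MeasurableSet.const _).union
      (measurableSet_mem_samples n x t q)).prod MeasurableSet.of_discrete
  have hm1 : MeasurableSet {ω : Realization | ∀ v, 0 ≤ (ω v).1} := by
    simp only [Set.ofPred_forall]
    exact MeasurableSet.iInter fun v => measurableSet_le measurable_const (measurable_pi_apply v).fst
  exact (Measure.ae_compProd_of_ae_fst _ hm1 (ae_law_nonneg μ)).and
    (Measure.ae_compProd_of_ae_ae hm (ae_of_all _ fun ω => ae_mem_samples ω))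

/-- The event that the sample has at most `m` lineages at time `t - u`. -/
def lineagesEvent (n : ℕ) (t u : ℝ) (m : ℕ) : Set (Realization × Sample n) :=
  {p | ∃ σ : Fin (n + 1) → Individual, p.2 = .of σ ∧ sampleLineages t p.1 σ u ≤ m}

theorem measurableSet_lineagesEvent (n : ℕ) (t u : ℝ) (m : ℕ) :
    MeasurableSet (lineagesEvent n t u m) := by
  have h : lineagesEvent n t u m = ⋃ σ : Fin (n + 1) → Individual,
      {ω | sampleLineages t ω σ u ≤ m} ×ˢ {Sample.of σ} := by
    ext ⟨ω, q⟩
    simp only [lineagesEvent, Set.mem_ofPred_eq, Set.mem_iUnion, Set.mem_prod,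
      Set.mem_singleton_iff]
    exact exists_congr fun σ => and_comm
  rw [h]
  exact MeasurableSet.iUnion fun σ => MeasurableSet.prod
    (measurableSet_le (measurable_forestLineages _ _) measurable_const) MeasurableSet.of_discrete

theorem lineagesEvent_of {u : ℝ} {m : ℕ} {ω : Realization} {σ : Fin (n + 1) → Individual} :
    (ω, Sample.of σ) ∈ lineagesEvent n t u m ↔ sampleLineages t ω σ u ≤ m := by
  constructor
  · rintro ⟨σ', h, h'⟩
    obtain rfl := Sample.of_injective h
    exact h'
  · exact fun h => ⟨σ, rfl, h⟩

theorem patternEvent_of {c : ℕ → ℝ} {N : ℕ} {J : Finset ℕ} {ω : Realization}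
    {σ : Fin (n + 1) → Individual} : (ω, Sample.of σ) ∈ patternEvent n t c N J ↔
      Pattern N J (fun i => sampleLineages t ω σ (c i)) := by
  constructor
  · rintro ⟨σ', h, h'⟩
    obtain rfl := Sample.of_injective h
    exact h'
  · exact fun h => ⟨σ, rfl, h⟩

/-- Only look-back times up to `t` count, so the lineages are inspected at `e` if `e ≤ t` and at `t`
otherwise. The identity needs nonnegative lifetimes and is therefore only almost sure. -/
theorem exists_lineagesEvent_ae_eq (ht : 0 < t) (k : Fin n) {e : EReal} (he : 0 < e) :
    ∃ u, {p | coalescenceTime x t k p < e} =ᵐ[sampledLaw μ n x t] lineagesEvent n t u (n - k) := by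
  have key : ∀ u : ℝ, (∀ ω σ, (∀ v, 0 ≤ (ω v).1) → Function.Injective σ →
      (∀ i, Alive x ω t (σ i)) → (coalescenceTime x t k (ω, (some σ : Sample n)) < e ↔
        sampleLineages t ω σ u ≤ n - k)) →
      {p | coalescenceTime x t k p < e} =ᵐ[sampledLaw μ n x t] lineagesEvent n t u (n - k) := by
    intro u hu
    filter_upwards [ae_sampledLaw μ] with ⟨ω, q⟩ ⟨hω, hq⟩
    refine propext ?_
    rcases hq with rfl | ⟨σ, rfl, hinj, hσ⟩
    · refine iff_of_false (fun h => not_top_lt (show (⊤ : EReal) < e from h)) ?_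
      rintro ⟨σ, h, -⟩
      exact Option.some_ne_none σ (Eq.symm h)
    · exact (hu ω σ hω hinj hσ).trans lineagesEvent_of.symm
  rcases lt_or_ge (t : EReal) e with h | h
  · exact ⟨t, key t fun ω σ hω _ hσ => coalescenceTime_lt_iff_of_lt hω hσ ht k h⟩
  · obtain ⟨u, rfl⟩ : ∃ u : ℝ, (u : EReal) = e :=
      ⟨e.toReal, EReal.coe_toReal (h.trans_lt (EReal.coe_lt_top t)).ne
        (lt_of_le_of_lt bot_le he).ne'⟩
    exact ⟨u, key u fun ω σ hω hinj hσ => coalescenceTime_lt_iff hω hinj hσ k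
      (EReal.coe_nonneg.1 he.le) (EReal.coe_le_coe_iff.1 h)⟩

theorem aemeasurable_coalescenceTime (ht : 0 < t) (k : Fin n) :
    AEMeasurable (coalescenceTime x t k) (sampledLaw μ n x t) := by
  refine NullMeasurable.aemeasurable ?_
  refine measurable_of_Iio (δ := NullMeasurableSpace (Realization × Sample n) (sampledLaw μ n x t))
    fun e => ?_
  change NullMeasurableSet {p | coalescenceTime x t k p < e} _
  rcases le_or_gt e 0 with he | he
  · have : {p | coalescenceTime x t k p < e} = (∅ : Set (Realization × Sample n)) := by
      ext p
      simpa using he.trans (coalescenceTime_nonneg k p)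
    rw [this]
    exact MeasurableSet.empty.nullMeasurableSet
  · obtain ⟨u, hu⟩ := exists_lineagesEvent_ae_eq μ (x := x) ht k he
    exact (measurableSet_lineagesEvent n t u _).nullMeasurableSet.congr hu.symm

theorem ae_coalescenceTime_ne (ht : 0 < t) (k : Fin n) :
    ∀ᵐ p ∂sampledLaw μ n x t, coalescenceTime x t k p ≠ t := by
  filter_upwards [ae_sampledLaw μ] with ⟨ω, q⟩ ⟨hω, hq⟩
  rcases hq with rfl | ⟨σ, rfl, hinj, hσ⟩
  · exact (EReal.coe_ne_top t).symm
  · exact coalescenceTime_ne hω hinj hσ ht k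

/-- The vector of coalescence times, with `0` in place of `∞`. -/
def coalescenceVector (n x : ℕ) (t : ℝ) (p : Realization × Sample n) (k : Fin n) : ℝ :=
  (coalescenceTime x t k p).toReal

theorem aemeasurable_coalescenceVector (ht : 0 < t) :
    AEMeasurable (coalescenceVector n x t) (sampledLaw μ n x t) :=
  aemeasurable_pi_iff.2 fun k =>
    measurable_ereal_toReal.comp_aemeasurable (aemeasurable_coalescenceTime μ ht k)

/-- `EReal.toReal` sends both infinities to 0, so a positive value comes from a genuine finite time.
-/
theorem coalescenceVector_eq_iff {k : Fin n} {p : Realization × Sample n} {u : ℝ} (hu : 0 < u) :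
    coalescenceVector n x t p k = u ↔ coalescenceTime x t k p = u := by
  unfold coalescenceVector
  constructor
  · intro h
    rw [← h, EReal.coe_toReal]
    · intro h'
      rw [h', EReal.toReal_top] at h
      exact hu.ne h
    · intro h'
      rw [h', EReal.toReal_bot] at h
      exact hu.ne h
  · intro h
    rw [h, EReal.toReal_coe]

theorem coalescenceVector_preimage {B : Set (Fin n → ℝ)} (hB : ∀ τ ∈ B, ∀ i, 0 < τ i) :
    {p | ∃ τ ∈ B, ∀ k, coalescenceTime x t k p = (τ k : EReal)} =
      coalescenceVector n x t ⁻¹' B := by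
  ext p
  constructor
  · rintro ⟨τ, hτ, h⟩
    have : coalescenceVector n x t p = τ :=
      funext fun k => (coalescenceVector_eq_iff (hB τ hτ k)).2 (h k)
    rwa [Set.mem_preimage, this]
  · intro h
    exact ⟨_, h, fun k => (coalescenceVector_eq_iff (hB _ h k)).1 rfl⟩

theorem coalescenceVector_mem_Ico_iff {k : Fin n} {p : Realization × Sample n} {a b : ℝ}
    (ha : 0 < a) : coalescenceVector n x t p k ∈ Set.Ico a b ↔
      ¬ coalescenceTime x t k p < a ∧ coalescenceTime x t k p < b := by
  rw [not_lt]
  constructor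
  · intro h
    rw [(coalescenceVector_eq_iff (ha.trans_le h.1)).1 rfl]
    exact ⟨EReal.coe_le_coe_iff.2 h.1, EReal.coe_lt_coe_iff.2 h.2⟩
  · rintro ⟨h1, h2⟩
    obtain ⟨u, hu⟩ : ∃ u : ℝ, (u : EReal) = coalescenceTime x t k p :=
      ⟨_, EReal.coe_toReal (h2.trans (EReal.coe_lt_top b)).ne
        ((EReal.bot_lt_coe a).trans_le h1).ne'⟩
    rw [coalescenceVector, ← hu, EReal.toReal_coe]
    rw [← hu] at h1 h2
    exact ⟨EReal.coe_le_coe_iff.1 h1, EReal.coe_lt_coe_iff.1 h2⟩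

theorem coalescenceVector_box_ae_eq (hn : 1 ≤ n) {a b : ℕ → ℝ} (h0 : ∀ k < n, 0 < a k)
    (hab : ∀ k, a k ≤ b k) (hba : ∀ k, b k ≤ a (k + 1)) (hb : ∀ k, b k ≤ t) :
    (coalescenceVector n x t ⁻¹' Set.univ.pi fun i : Fin n => Set.Ico (a i) (b i))
      =ᵐ[sampledLaw μ n x t] patternEvent n t (chain a b) (2 * n) (boxIndices n) := by
  have ha : 0 ≤ a 0 := (h0 0 hn).le
  filter_upwards [ae_sampledLaw μ] with ⟨ω, q⟩ ⟨hω, hq⟩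
  refine propext ?_
  change (_ ∈ Set.univ.pi _) ↔ _
  simp only [Set.mem_univ_pi]
  rw [forall_congr' fun i : Fin n => coalescenceVector_mem_Ico_iff (h0 i i.2)]
  rcases hq with rfl | ⟨σ, rfl, hinj, hσ⟩
  · refine iff_of_false (fun h => not_top_lt (h ⟨0, hn⟩).2) ?_
    rintro ⟨σ, h, -⟩
    exact Option.some_ne_none σ (Eq.symm h)
  · refine Iff.trans ?_ patternEvent_of.symm
    rw [pattern_chain_iff ha hba (antitone_sampleLineages t ω σ)
      (sampleLineages_pos t ω σ) (sampleLineages_zero hinj hσ)]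
    have hak : ∀ k, 0 ≤ a k := fun k => by
      induction k with
      | zero => exact ha
      | succ k ih => exact ih.trans ((hab k).trans (hba k))
    refine ⟨fun h k hk => ?_, fun h k => ?_⟩
    · have := h ⟨k, hk⟩
      rwa [coalescenceTime_lt_iff hω hinj hσ _ (hak k) ((hab k).trans (hb k)),
        coalescenceTime_lt_iff hω hinj hσ _ ((hak k).trans (hab k)) (hb k)] at this
    · rw [coalescenceTime_lt_iff hω hinj hσ _ (hak k) ((hab k).trans (hb k)),
        coalescenceTime_lt_iff hω hinj hσ _ ((hak k).trans (hab k)) (hb k)]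
      exact h k k.2

end Times

end BGW

/-! ### From ordered boxes to Borel sets, and the main theorem. -/

namespace BGW

attribute [local instance] isProbabilityMeasure_markLaw isProbabilityMeasure_law_of_neZero

section Boxes

variable {n : ℕ}

/-- The half-open box with corners `a` and `b`. -/
def box (a b : Fin n → ℝ) : Set (Fin n → ℝ) := Set.univ.pi fun i => Set.Ico (a i) (b i)

/-- The corners `a`, `b` span a box contained in `{0 < τ₀ < τ₁ < ⋯ < t}`. -/
structure IsOrderedBox (t : ℝ) (a b : Fin n → ℝ) : Prop where
  pos : ∀ i, 0 < a i
  le : ∀ i, a i ≤ b i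
  sep : ∀ i j, i < j → b i ≤ a j
  bound : ∀ i, b i ≤ t

theorem measurableSet_box (a b : Fin n → ℝ) : MeasurableSet (box a b) :=
  MeasurableSet.univ_pi fun _ => measurableSet_Ico

/-- The maximum keeps the corners in order when the intersection is empty, so ordered boxes are
stable under truncation by orthants. -/
theorem box_inter_pi_Iio (a b c : Fin n → ℝ) :
    (Set.univ.pi fun i => Set.Iio (c i)) ∩ box a b =
      box a fun i => max (a i) (min (b i) (c i)) := by
  ext τ
  simp only [box, Set.mem_inter_iff, Set.mem_univ_pi, Set.mem_Ico, Set.mem_Iio, ← forall_and,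
    lt_max_iff, lt_min_iff]
  refine forall_congr' fun i => ?_
  constructor
  · rintro ⟨h1, h2, h3⟩
    exact ⟨h2, Or.inr ⟨h3, h1⟩⟩
  · rintro ⟨h1, h2 | h2⟩
    · exact absurd h2 (not_lt.2 h1)
    · exact ⟨h2.2, h1, h2.1⟩

theorem IsOrderedBox.truncate {t : ℝ} {a b : Fin n → ℝ} (h : IsOrderedBox t a b) (c : Fin n → ℝ) :
    IsOrderedBox t a fun i => max (a i) (min (b i) (c i)) where
  pos := h.pos
  le _ := le_max_left _ _
  sep i j hij := (max_le (h.le i) (min_le_left _ _)).trans (h.sep i j hij)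
  bound i := (max_le (h.le i) (min_le_left _ _)).trans (h.bound i)

/-- The open lower orthants form a generating π-system, and inside an ordered box each of them cuts
out another ordered box. -/
theorem restrict_box_eq {t : ℝ} {ν ν' : Measure (Fin n → ℝ)}
    (h : ∀ a b, IsOrderedBox t a b → ν (box a b) = ν' (box a b) ∧ ν (box a b) ≠ ⊤)
    {a b : Fin n → ℝ} (hab : IsOrderedBox t a b) :
    ν.restrict (box a b) = ν'.restrict (box a b) := by
  have : IsFiniteMeasure (ν.restrict (box a b)) :=
    ⟨by rw [Measure.restrict_apply_univ]; exact (h a b hab).2.lt_top⟩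
  refine ext_of_generate_finite
    (Set.pi Set.univ '' Set.pi Set.univ fun _ : Fin n => Set.range (Set.Iio : ℝ → Set ℝ)) ?_
    (IsPiSystem.pi fun _ => isPiSystem_Iio) ?_ ?_
  · rw [← generateFrom_pi_eq]
    · rw [← borel_eq_generateFrom_Iio, ← BorelSpace.measurable_eq (α := ℝ)]
    · refine fun _ => ⟨fun k => Set.Iio (k : ℝ), fun k => ⟨k, rfl⟩, ?_⟩
      exact Set.eq_univ_of_forall fun z => Set.mem_iUnion.2 (exists_nat_gt z)
  · rintro _ ⟨S, hS, rfl⟩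
    choose c hc using fun i => hS i (Set.mem_univ i)
    obtain rfl : (fun i => Set.Iio (c i)) = S := funext hc
    have hm : MeasurableSet (Set.univ.pi fun i => Set.Iio (c i)) :=
      MeasurableSet.univ_pi fun _ => measurableSet_Iio
    rw [Measure.restrict_apply hm, Measure.restrict_apply hm, box_inter_pi_Iio]
    exact (h _ _ (hab.truncate c)).1
  · rw [Measure.restrict_apply_univ, Measure.restrict_apply_univ]
    exact (h a b hab).1

open Filter Topology in
theorem exists_isOrderedBox {t : ℝ} {τ : Fin n → ℝ} (h0 : ∀ i, 0 < τ i) (ht : ∀ i, τ i < t)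
    (hτ : StrictMono τ) : ∃ a b : Fin n → ℚ,
      IsOrderedBox t (fun i => (a i : ℝ)) (fun i => (b i : ℝ)) ∧
      τ ∈ box (fun i => (a i : ℝ)) (fun i => (b i : ℝ)) := by
  have hev : ∀ z : ℝ, 0 < z → ∀ᶠ δ in 𝓝[>] (0 : ℝ), 2 * δ < z := by
    intro z hz
    have h : Tendsto (fun δ : ℝ => 2 * δ) (𝓝 0) (𝓝 (2 * 0)) := by
      exact (continuous_const.mul continuous_id).tendsto 0
    rw [mul_zero] at h
    exact (h.eventually_lt_const hz).filter_mono nhdsWithin_le_nhds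
  have h1 : ∀ᶠ δ in 𝓝[>] (0 : ℝ), ∀ i, 2 * δ < τ i :=
    eventually_all.2 fun i => hev _ (h0 i)
  have h2 : ∀ᶠ δ in 𝓝[>] (0 : ℝ), ∀ i, 2 * δ < t - τ i :=
    eventually_all.2 fun i => hev _ (sub_pos.2 (ht i))
  have h3 : ∀ᶠ δ in 𝓝[>] (0 : ℝ), ∀ i j, i < j → 2 * δ < τ j - τ i :=
    eventually_all.2 fun i => eventually_all.2 fun j => by
      by_cases hij : i < j
      · simpa [hij] using hev _ (sub_pos.2 (hτ hij))
      · simp [hij]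
  -- With 2δ below every gap of 0 < τ₀ < τ₁ < ⋯ < t, any corners within δ of τ span an ordered box.
  obtain ⟨δ, e1, e2, e3, hδ⟩ := (h1.and (h2.and (h3.and self_mem_nhdsWithin))).exists
  have hδ' : 0 < δ := hδ
  choose a ha using fun i => exists_rat_btwn (show τ i - δ < τ i by linarith)
  choose b hb using fun i => exists_rat_btwn (show τ i < τ i + δ by linarith)
  refine ⟨a, b, ⟨fun i => ?_, fun i => ?_, fun i j hij => ?_, fun i => ?_⟩, fun i _ => ?_⟩
  · linarith [(ha i).1, e1 i]
  · exact ((ha i).2.trans (hb i).1).le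
  · linarith [(hb i).2, (ha j).1, e3 i j hij]
  · linarith [(hb i).2, e2 i]
  · exact ⟨(ha i).2.le, (hb i).1⟩

/-- Two measures on `ℝⁿ` that agree on the ordered boxes agree on the sets of strictly increasing
vectors with entries in `(0, t]`, provided that the hyperplanes `τᵢ = t` are null sets. -/
theorem measure_eq_of_box {t : ℝ} {ν ν' : Measure (Fin n → ℝ)}
    (h : ∀ a b, IsOrderedBox t a b → ν (box a b) = ν' (box a b) ∧ ν (box a b) ≠ ⊤)
    (hν : ∀ i, ν {τ | τ i = t} = 0) (hν' : ∀ i, ν' {τ | τ i = t} = 0)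
    {B : Set (Fin n → ℝ)} (hB : MeasurableSet B)
    (hsub : B ⊆ {τ | (∀ i, 0 < τ i ∧ τ i ≤ t) ∧ StrictMono τ}) : ν B = ν' B := by
  -- Rational corners make the cover countable, so equality of the restrictions passes to the union
  -- although the boxes overlap.
  set ι := {p : (Fin n → ℚ) × (Fin n → ℚ) //
    IsOrderedBox t (fun i => (p.1 i : ℝ)) (fun i => (p.2 i : ℝ))}
  set U : Set (Fin n → ℝ) :=
    ⋃ p : ι, box (fun i => (p.1.1 i : ℝ)) (fun i => (p.1.2 i : ℝ)) with hU
  have hUm : MeasurableSet U := MeasurableSet.iUnion fun _ => measurableSet_box _ _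
  have hres : ν.restrict U = ν'.restrict U :=
    Measure.restrict_iUnion_congr.2 fun p => restrict_box_eq h p.2
  have hrest : B \ U ⊆ ⋃ i, {τ : Fin n → ℝ | τ i = t} := by
    rintro τ ⟨hτ, hτU⟩
    by_contra hne
    simp only [Set.mem_iUnion, Set.mem_ofPred_eq, not_exists] at hne
    obtain ⟨h1, h2⟩ := hsub hτ
    obtain ⟨a, b, hab, hmem⟩ := exists_isOrderedBox (fun i => (h1 i).1)
      (fun i => lt_of_le_of_ne (h1 i).2 (hne i)) h2
    exact hτU (Set.mem_iUnion.2 ⟨⟨(a, b), hab⟩, hmem⟩)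
  have hz : ν (B \ U) = 0 := measure_mono_null hrest (measure_iUnion_null hν)
  have hz' : ν' (B \ U) = 0 := measure_mono_null hrest (measure_iUnion_null hν')
  rw [← measure_inter_add_sdiff B hUm, ← measure_inter_add_sdiff (μ := ν') B hUm, hz, hz',
    ← Measure.restrict_apply hB, ← Measure.restrict_apply hB, hres]

end Boxes

section Main

variable (μ : Measure ℕ) [IsFiniteMeasure μ] [NeZero μ] {s : ℝ} {n x : ℕ} {t : ℝ}

theorem setLIntegral_coalescenceVector_box (hs0 : 0 ≤ s) (hs1 : s < 1) (hn : 1 ≤ n) (ht : 0 < t)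
    {a b : Fin n → ℝ} (h : IsOrderedBox t a b) :
    ∫⁻ p in coalescenceVector n x t ⁻¹' box a b, sampleWeight s n x t p.1 ∂sampledLaw μ n x t =
      ENNReal.ofReal (((n.factorial : ℝ) * ((n + 1).factorial : ℝ) / 2 ^ n) *
        ((x : ℝ) * deriv (psi μ t) s * psi μ t s ^ (x - 1)) * ∏ i : Fin n,
          ∫ u in (0 : ℝ)..t, (Set.Ico (a i) (b i)).indicator 1 u * coalescenceRate μ s u) := by
  -- Padding with `t` after the last interval keeps the infinite chain monotone.
  set a' : ℕ → ℝ := fun k => if h : k < n then a ⟨k, h⟩ else t with ha'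
  set b' : ℕ → ℝ := fun k => if h : k < n then b ⟨k, h⟩ else t with hb'
  have ha : ∀ i : Fin n, a i = a' i := fun i => by simp [ha']
  have hb : ∀ i : Fin n, b i = b' i := fun i => by simp [hb']
  have hpos : ∀ k < n, 0 < a' k := fun k hk => by
    rw [ha']; simp only [hk, dif_pos]; exact h.pos _
  have hab : ∀ k, a' k ≤ b' k := fun k => by
    by_cases hk : k < n
    · simp only [ha', hb', hk, dif_pos]; exact h.le _
    · simp [ha', hb', hk]
  have hbt : ∀ k, b' k ≤ t := fun k => by
    by_cases hk : k < n
    · simp only [hb', hk, dif_pos]; exact h.bound _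
    · simp [hb', hk]
  have hba : ∀ k, b' k ≤ a' (k + 1) := fun k => by
    by_cases hk : k + 1 < n
    · simp only [ha', hb', hk, (Nat.lt_succ_self k).trans hk, dif_pos]
      exact h.sep _ _ (Nat.lt_succ_self k)
    · rw [show a' (k + 1) = t by simp [ha', hk]]; exact hbt k
  have hae := coalescenceVector_box_ae_eq μ (x := x) hn hpos hab hba hbt
  simp only [← ha, ← hb] at hae
  rw [setLIntegral_congr
      (show coalescenceVector n x t ⁻¹' box a b =ᵐ[sampledLaw μ n x t] _ from hae),
    setLIntegral_patternEvent_chain μ hs0 hs1 n x ht.le (hpos 0 hn).le hab hba]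
  simp only [← ha, ← hb]

theorem lintegral_sampleWeight_eq (hs0 : 0 ≤ s) (hs1 : s < 1) (hn : 1 ≤ n) (ht : 0 < t)
    {B : Set (Fin n → ℝ)} (hB : MeasurableSet B)
    (hsub : B ⊆ {τ | (∀ i, 0 < τ i ∧ τ i ≤ t) ∧ StrictMono τ}) :
    ∫⁻ p in {p | ∃ τ ∈ B, ∀ k, coalescenceTime x t k p = (τ k : EReal)},
      sampleWeight s n x t p.1 ∂sampledLaw μ n x t =
    ∫⁻ τ in B, ENNReal.ofReal (coalescenceDensity μ s n x t τ) := by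
  set ρ := (sampledLaw μ n x t).withDensity fun p => sampleWeight s n x t p.1
  have hR : AEMeasurable (coalescenceVector n x t) (sampledLaw μ n x t) :=
    aemeasurable_coalescenceVector μ ht
  have hRρ : AEMeasurable (coalescenceVector n x t) ρ :=
    hR.mono_ac (withDensity_absolutelyContinuous _ _)
  have hν : ∀ {A : Set (Fin n → ℝ)}, MeasurableSet A → ρ.map (coalescenceVector n x t) A =
      ∫⁻ p in coalescenceVector n x t ⁻¹' A, sampleWeight s n x t p.1 ∂sampledLaw μ n x t := by
    intro A hA
    rw [Measure.map_apply_of_aemeasurable hRρ hA, withDensity_apply₀ _ (hR.nullMeasurable hA)]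
  have hhyp : ∀ i : Fin n, MeasurableSet {τ : Fin n → ℝ | τ i = t} := fun i =>
    measurableSet_eq_fun (measurable_pi_apply i) measurable_const
  rw [coalescenceVector_preimage fun τ hτ i => ((hsub hτ).1 i).1, ← hν hB, ← withDensity_apply _ hB]
  refine measure_eq_of_box (t := t) (fun a b h => ?_) (fun i => ?_) (fun i => ?_) hB hsub
  · rw [hν (measurableSet_box a b), withDensity_apply _ (measurableSet_box a b),
      setLIntegral_coalescenceVector_box μ hs0 hs1 hn ht h]
    exact ⟨(setLIntegral_coalescenceDensity μ hs0 hs1 n x ht.le (fun i => (h.pos i).le)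
      h.bound).symm, ENNReal.ofReal_ne_top⟩
  -- No coalescence time equals `t` almost surely, so the faces τᵢ = t carry no mass; on the density
  -- side they are Lebesgue null.
  · rw [hν (hhyp i)]
    refine setLIntegral_measure_zero _ _ ?_
    rw [measure_eq_zero_iff_ae_notMem]
    filter_upwards [ae_coalescenceTime_ne μ (x := x) ht i] with p hp hmem
    exact hp ((coalescenceVector_eq_iff ht).1 hmem)
  · refine withDensity_absolutelyContinuous _ _ ?_
    rw [volume_pi]
    exact Measure.pi_hyperplane (fun _ : Fin n => (volume : Measure ℝ)) i t

end Main

end BGW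

end

theorem theorem4 (μ : Measure ℕ) [IsFiniteMeasure μ] (hμ1 : μ {1} = 0) (hμ0 : μ {0} ≠ 0)
    (x n : ℕ) (hn : 1 ≤ n) (t : ℝ) (ht : 0 < t) (s : ℝ) (hs0 : 0 ≤ s) (hs1 : s < 1) :
    (∀ r, 0 ≤ r → r ≤ t → DifferentiableAt ℝ (BGW.psi μ r) s) ∧
    (∀ r, 0 ≤ r → r ≤ t →
      Summable fun k : ℕ =>
        ((k : ℝ) + 2) * ((k : ℝ) + 1) * μ.real {k + 2} * BGW.psi μ r s ^ k) ∧
    ∀ B : Set (Fin n → ℝ), MeasurableSet B →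
      B ⊆ {τ | (∀ i, 0 < τ i ∧ τ i ≤ t) ∧ StrictMono τ} →
      ∫⁻ q in {q | ∃ τ ∈ B, ∀ k, BGW.coalescenceTime x t k q = (τ k : EReal)},
          ENNReal.ofReal (((BGW.Z x t q.1).toNat.descFactorial (n + 1) : ℝ) *
            s ^ ((BGW.Z x t q.1).toNat - (n + 1))) ∂(BGW.sampledLaw μ n x t) =
        ∫⁻ τ in B, ENNReal.ofReal
          (((n.factorial : ℝ) * ((n + 1).factorial : ℝ) / 2 ^ n) *
            ((x : ℝ) * deriv (BGW.psi μ t) s * BGW.psi μ t s ^ (x - 1)) *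
            ∏ i : Fin n, (deriv (BGW.psi μ (τ i)) s *
              ∑' k : ℕ, ((k : ℝ) + 2) * ((k : ℝ) + 1) * μ.real {k + 2} *
                BGW.psi μ (τ i) s ^ k)) := by
  have : NeZero μ := ⟨fun h => hμ0 (by simp [h])⟩
  refine ⟨fun r _ _ => (BGW.hasDerivAt_psi μ hs0 hs1 (c := fun _ => 0) rfl 0 r).differentiableAt,
    fun r hr _ => BGW.summable_powSum (BGW.coeff₂_le μ) (BGW.psi_nonneg μ hs0 r)
      (BGW.psi_lt_one μ hs0 hs1 hr), fun B hB hsub => ?_⟩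
  exact BGW.lintegral_sampleWeight_eq μ hs0 hs1 hn ht hB hsub
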